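/- Let $E$ be a complex vector space of dimension $7$, let $F=E^*$, and equip $V_{14}=F\oplus E$ with the nondegenerate quadratic form $q(f,e)=2f(e)$. The Clifford algebra of $(V_{14},q)$ (with the convention $v^2=q(v)$) acts on $\wedge^*E$: vectors $e\in E$ act by wedge product and $f\in F$ by twice the contraction. Let $\mathrm{Spin}_{14}$ be the (complex) spin group of $(V_{14},q)$ and $\Delta_{14}=\wedge^+E$ its half-spin representation given by the even part of $\wedge^*E$. For a nondegenerate seven-dimensional subspace $V_7\subset V_{14}$, choose a splitting $V_7=F_3\oplus E_3\oplus L$ with $E_3,F_3$ isotropic of dimension $3$ and dual to each other under $q$, and $L$ a line orthogonal to $E_3\oplus F_3$; let $\Delta_7=\wedge^*E_3$ be the resulting spin representation of $\mathrm{Spin}(V_7)$ ($E_3$ acts by wedge product, $F_3$ by twice the contraction, and a unit vector of $L$ by the parity operator). A point of $\mathbb{P}(\Delta_7)$ is called generic if its orbit under $\mathrm{Spin}(V_7)$ is Zariski open in $\mathbb{P}(\Delta_7)$. There is a nonempty Zariski open subset $U\subset\mathbb{P}(\Delta_{14})$, which is a single $\mathrm{Spin}_{14}$-orbit, such that the following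 holds for every $[\psi]\in U$. 1. There exists a unique unordered pair $\{V_7,V_7'\}$ of seven-dimensional subspaces of $V_{14}$ with $V_{14}=V_7\oplus V_7'$ an orthogonal direct sum and such that every element of the stabilizer of $[\psi]$ in $\mathrm{Spin}_{14}$ maps the pair $\{V_7,V_7'\}$ to itself (each element either fixes both subspaces or exchanges them). 2. Splittings of $V_7$ and $V_7'$ as above exist. For any choice of them, with associated spin representations $\Delta_7$ of $\mathrm{Spin}(V_7)$ and $\Delta_7'$ of $\mathrm{Spin}(V_7')$, there is an isomorphism $\Phi:\Delta_{14}\simeq\Delta_7\otimes\Delta_7'$ that is equivariant under $\mathrm{Spin}(V_7)\times\mathrm{Spin}(V_7')$ (acting on $\Delta_{14}$ through $\mathrm{Spin}_{14}$); it is unique up to a nonzero scalar. Under this isomorphism, $[\Phi(\psi)]=[\chi\otimes\chi']$ for some generic points $[\chi]\in\mathbb{P}(\Delta_7)$ and $[\chi']\in\mathbb{P}(\Delta_7')$. -/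

import Mathlib

open scoped LinearAlgebra.Projectivization TensorProduct

noncomputable section

namespace SpinFourteen

/-! ### Zariski open subsets of projective space, and generic points -/

section Zariski

variable (V : Type*) [AddCommGroup V] [Module ℂ V]

/-- The algebra of polynomial functions on a complex vector space: the algebra of functions
generated by the linear forms. -/
def polynomialFunctions : Subalgebra ℂ (V → ℂ) :=
  Algebra.adjoin ℂ (Set.range fun (l : Module.Dual ℂ V) (v : V) => l v)

/-- `F` is a homogeneous polynomial function of degree `d`. -/
def IsHomogeneousPolynomial (d : ℕ) (F : V → ℂ) : Prop :=
  F ∈ polynomialFunctions V ∧ ∀ (c : ℂ) (v : V), F (c • v) = c ^ d * F v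

variable {V}

/-- A subset of `ℙ(V)` is Zariski open if it is the complement of the common zero locus of a set of
homogeneous polynomial functions. -/
def IsZariskiOpen (U : Set (ℙ ℂ V)) : Prop :=
  ∃ S : Set (V → ℂ), (∀ F ∈ S, ∃ d, IsHomogeneousPolynomial V d F) ∧
    ∀ (v : V) (hv : v ≠ 0), Projectivization.mk ℂ v hv ∈ U ↔ ∃ F ∈ S, F v ≠ 0

/-- The orbit of the point `[x]` of `ℙ(V)` under a group acting linearly on `V`. -/
def projOrbit {G : Type*} [Group G] (ρ : Representation ℂ G V) (x : V) : Set (ℙ ℂ V) :=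
  {p | ∃ (g : G) (h : ρ g x ≠ 0), p = Projectivization.mk ℂ (ρ g x) h}

/-- `[x]` is a generic point of `ℙ(V)` for a group acting linearly on `V`: it lies in the (unique)
Zariski open orbit. -/
def IsGenericPoint {G : Type*} [Group G] (ρ : Representation ℂ G V) (x : V) : Prop :=
  x ≠ 0 ∧ IsZariskiOpen (projOrbit ρ x)

end Zariski

/-! ### Quadratic spaces with a splitting, and their Clifford modules -/

section Models

variable (E : Type*) [AddCommGroup E] [Module ℂ E]

/-- The quadratic form `q(f, e) = 2 f(e)` on `F ⊕ E`, `F = E*`. Its polarisation, normalised by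
`q(v, v) = q(v)`, restricts to the duality pairing on `E × F`. -/
def evenForm : QuadraticForm ℂ (Module.Dual ℂ E × E) :=
  (2 : ℂ) • QuadraticForm.dualProd ℂ E

/-- The quadratic form `q((f, e), t) = 2 f(e) + t²` on `(F ⊕ E) ⊕ L`, `F = E*`, `L = ℂ`. -/
def oddForm : QuadraticForm ℂ ((Module.Dual ℂ E × E) × ℂ) :=
  (evenForm E).prod QuadraticMap.sq

variable {E}

/-- The parity operator on the exterior algebra: `+1` on `⋀⁺E` and `-1` on `⋀⁻E`. -/
def parity : Module.End ℂ (ExteriorAlgebra ℂ E) :=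
  (CliffordAlgebra.involute (Q := (0 : QuadraticForm ℂ E))).toLinearMap

/-- `(f, e)` acts on `⋀E` by `e ∧ ·` plus twice the contraction by `f`. -/
def wedgeContract :
    (Module.Dual ℂ E × E) →ₗ[ℂ] Module.End ℂ (ExteriorAlgebra ℂ E) :=
  (LinearMap.mul ℂ (ExteriorAlgebra ℂ E) ∘ₗ ExteriorAlgebra.ι ℂ) ∘ₗ LinearMap.snd ℂ _ _ +
    (2 : ℂ) • (CliffordAlgebra.contractLeft (Q := (0 : QuadraticForm ℂ E))) ∘ₗ LinearMap.fst ℂ _ _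

/-- `((f, e), t)` acts on `⋀E` by `e ∧ ·`, plus twice the contraction by `f`, plus `t` times the
parity operator. -/
def wedgeContractParity :
    ((Module.Dual ℂ E × E) × ℂ) →ₗ[ℂ] Module.End ℂ (ExteriorAlgebra ℂ E) :=
  wedgeContract ∘ₗ LinearMap.fst ℂ _ _ + (LinearMap.toSpanSingleton ℂ _ parity) ∘ₗ
    LinearMap.snd ℂ _ _

theorem wedgeContract_apply (v : Module.Dual ℂ E × E) (x : ExteriorAlgebra ℂ E) :
    wedgeContract v x = ExteriorAlgebra.ι ℂ v.2 * x +
      (2 : ℂ) • CliffordAlgebra.contractLeft (Q := (0 : QuadraticForm ℂ E)) v.1 x := by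
  simp [wedgeContract]

theorem contractLeft_involute (d : Module.Dual ℂ E) (x : ExteriorAlgebra ℂ E) :
    CliffordAlgebra.contractLeft (Q := (0 : QuadraticForm ℂ E)) d (CliffordAlgebra.involute x) =
      -CliffordAlgebra.involute
        (CliffordAlgebra.contractLeft (Q := (0 : QuadraticForm ℂ E)) d x) := by
  induction x using CliffordAlgebra.left_induction with
  | algebraMap r => simp [CliffordAlgebra.contractLeft_algebraMap]
  | add x y hx hy => simp only [map_add, hx, hy, neg_add]
  | ι_mul x m hx =>
    simp only [map_mul, CliffordAlgebra.involute_ι, neg_mul, map_neg,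
      CliffordAlgebra.contractLeft_ι_mul, hx, map_sub, map_smul]
    simp only [mul_neg, sub_neg_eq_add]

theorem wedgeContract_involute (v : Module.Dual ℂ E × E) (x : ExteriorAlgebra ℂ E) :
    CliffordAlgebra.involute (wedgeContract v x) =
      -wedgeContract v (CliffordAlgebra.involute x) := by
  rw [wedgeContract_apply, wedgeContract_apply, contractLeft_involute, map_add, map_mul, map_smul]
  have h : CliffordAlgebra.involute (ExteriorAlgebra.ι ℂ v.2) = -ExteriorAlgebra.ι ℂ v.2 :=
    CliffordAlgebra.involute_ι v.2
  rw [h, smul_neg, neg_mul, neg_add, neg_neg]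

theorem wedgeContract_sq (v : Module.Dual ℂ E × E) :
    wedgeContract v * wedgeContract v =
      algebraMap ℂ (Module.End ℂ (ExteriorAlgebra ℂ E)) (evenForm E v) := by
  refine LinearMap.ext fun x => ?_
  have h0 : ExteriorAlgebra.ι ℂ v.2 * (ExteriorAlgebra.ι ℂ v.2 * x) = 0 := by
    rw [← mul_assoc, ExteriorAlgebra.ι_sq_zero, zero_mul]
  have h1 := CliffordAlgebra.contractLeft_ι_mul (Q := (0 : QuadraticForm ℂ E)) (d := v.1) v.2 x
  change CliffordAlgebra.contractLeft (Q := (0 : QuadraticForm ℂ E)) v.1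
    (ExteriorAlgebra.ι ℂ v.2 * x) = v.1 v.2 • x - ExteriorAlgebra.ι ℂ v.2 * _ at h1
  have h2 := CliffordAlgebra.contractLeft_contractLeft (Q := (0 : QuadraticForm ℂ E)) (d := v.1) x
  rw [Module.End.mul_apply, wedgeContract_apply, wedgeContract_apply, map_add, map_smul, h1, h2,
    mul_add, h0, Module.algebraMap_end_apply]
  simp only [evenForm, _root_.smul_apply, QuadraticForm.dualProd_apply, smul_eq_mul,
    mul_smul_comm, smul_sub, smul_zero, add_zero, zero_add, mul_smul]
  abel

theorem wedgeContractParity_sq (v : (Module.Dual ℂ E × E) × ℂ) :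
    wedgeContractParity v * wedgeContractParity v =
      algebraMap ℂ (Module.End ℂ (ExteriorAlgebra ℂ E)) (oddForm E v) := by
  have ha : parity * wedgeContract v.1 = -(wedgeContract v.1 * parity) := by
    refine LinearMap.ext fun x => ?_
    exact wedgeContract_involute v.1 x
  have hp : (parity : Module.End ℂ (ExteriorAlgebra ℂ E)) * parity = 1 := by
    refine LinearMap.ext fun x => ?_
    exact CliffordAlgebra.involute_involute x
  have hv : wedgeContractParity v = wedgeContract v.1 + v.2 • parity := by
    simp [wedgeContractParity]
  rw [hv, add_mul, mul_add, mul_add, wedgeContract_sq, smul_mul_assoc, smul_mul_assoc,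
    mul_smul_comm, mul_smul_comm, ha, hp, Algebra.algebraMap_eq_smul_one,
    Algebra.algebraMap_eq_smul_one, oddForm, QuadraticMap.prod_apply, QuadraticMap.sq_apply,
    add_smul, mul_smul, smul_neg]
  abel

variable (E)

/-- The action of the Clifford algebra of `F ⊕ E` on `⋀E`. -/
def evenCliffordAction : CliffordAlgebra (evenForm E) →ₐ[ℂ] Module.End ℂ (ExteriorAlgebra ℂ E) :=
  CliffordAlgebra.lift (evenForm E) ⟨wedgeContract, wedgeContract_sq⟩

/-- The action of the Clifford algebra of `F ⊕ E ⊕ L` on `⋀E`. -/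
def oddCliffordAction : CliffordAlgebra (oddForm E) →ₐ[ℂ] Module.End ℂ (ExteriorAlgebra ℂ E) :=
  CliffordAlgebra.lift (oddForm E) ⟨wedgeContractParity, wedgeContractParity_sq⟩

/-- `⋀⁺E`, the even part of the exterior algebra. -/
def evenExterior : Submodule ℂ (ExteriorAlgebra ℂ E) :=
  CliffordAlgebra.evenOdd (0 : QuadraticForm ℂ E) 0

variable {E}

theorem mem_evenExterior_iff (x : ExteriorAlgebra ℂ E) :
    x ∈ evenExterior E ↔ CliffordAlgebra.involute x = x := by
  refine ⟨fun h => CliffordAlgebra.involute_eq_of_mem_even h, fun h => ?_⟩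
  obtain ⟨a, ha, b, hb, rfl⟩ := Submodule.mem_sup.1
    ((CliffordAlgebra.evenOdd_isCompl (Q := (0 : QuadraticForm ℂ E))).sup_eq_top ▸
      Submodule.mem_top : x ∈ CliffordAlgebra.evenOdd (0 : QuadraticForm ℂ E) 0 ⊔
        CliffordAlgebra.evenOdd (0 : QuadraticForm ℂ E) 1)
  rw [map_add, CliffordAlgebra.involute_eq_of_mem_even ha,
    CliffordAlgebra.involute_eq_of_mem_odd hb, add_right_inj, neg_eq_iff_add_eq_zero,
    ← two_smul ℂ b, smul_eq_zero_iff_right (two_ne_zero : (2 : ℂ) ≠ 0)] at h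
  rw [h, add_zero]
  exact ha

theorem evenCliffordAction_involute (a : CliffordAlgebra (evenForm E)) (x : ExteriorAlgebra ℂ E) :
    CliffordAlgebra.involute (evenCliffordAction E a x) =
      evenCliffordAction E (CliffordAlgebra.involute a) (CliffordAlgebra.involute x) := by
  induction a using CliffordAlgebra.induction generalizing x with
  | algebraMap r => simp [Module.algebraMap_end_apply]
  | ι v => simp [evenCliffordAction, wedgeContract_involute]
  | mul a b ha hb => simp [Module.End.mul_apply, ha, hb]
  | add a b ha hb => simp [ha, hb]

theorem evenCliffordAction_mem {a : CliffordAlgebra (evenForm E)}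
    (ha : CliffordAlgebra.involute a = a) {x : ExteriorAlgebra ℂ E} (hx : x ∈ evenExterior E) :
    evenCliffordAction E a x ∈ evenExterior E := by
  rw [mem_evenExterior_iff] at hx ⊢
  rw [evenCliffordAction_involute, ha, hx]

variable (E)

/-- The half-spin representation `Δ = ⋀⁺E` of the spin group of `F ⊕ E`. -/
def halfSpin : Representation ℂ (spinGroup (evenForm E)) (evenExterior E) where
  toFun g := (evenCliffordAction E g).restrict
    fun _ hx => evenCliffordAction_mem (spinGroup.involute_eq g.2) hx
  map_one' := by ext x; simp
  map_mul' g h := by ext x; simp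

end Models

/-! ### Spin groups of subspaces and spin representations in odd dimension -/

section Spin

variable {V : Type*} [AddCommGroup V] [Module ℂ V] (Q : QuadraticForm ℂ V)

theorem map_mem_spinGroup {V' : Type*} [AddCommGroup V'] [Module ℂ V'] {Q : QuadraticForm ℂ V}
    {Q' : QuadraticForm ℂ V'} (f : Q →qᵢ Q')
    {g : CliffordAlgebra Q} (hg : g ∈ spinGroup Q) :
    CliffordAlgebra.map f g ∈ spinGroup Q' := by
  have hstar : ∀ a, star (CliffordAlgebra.map f a) = CliffordAlgebra.map f (star a) := by
    intro a
    induction a using CliffordAlgebra.induction with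
    | algebraMap r => simp
    | ι v => simp
    | mul a b ha hb => simp [ha, hb]
    | add a b ha hb => simp [ha, hb]
  obtain ⟨⟨⟨u, hu, rfl⟩, h1, h2⟩, he⟩ := hg
  refine ⟨⟨⟨Units.map (CliffordAlgebra.map f : _ →* CliffordAlgebra Q') u, ?_, rfl⟩, ?_, ?_⟩, ?_⟩
  · have : lipschitzGroup Q ≤ (lipschitzGroup Q').comap
        (Units.map (CliffordAlgebra.map f : _ →* CliffordAlgebra Q')) := by
      refine (Subgroup.closure_le _).2 ?_
      rintro w ⟨v, hv⟩
      refine Subgroup.subset_closure ⟨f v, ?_⟩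
      simp [← hv]
    exact this hu
  · rw [hstar, ← map_mul, h1, map_one]
  · rw [hstar, ← map_mul, h2, map_one]
  · have key : ∀ a ∈ CliffordAlgebra.evenOdd Q 0,
        CliffordAlgebra.map f a ∈ CliffordAlgebra.evenOdd Q' 0 := by
      intro a ha
      induction a, ha using CliffordAlgebra.even_induction with
      | algebraMap r =>
        rw [AlgHom.commutes]
        exact (CliffordAlgebra.even Q').algebraMap_mem r
      | add x y _ _ hx hy => rw [map_add]; exact add_mem hx hy
      | ι_mul_ι_mul m₁ m₂ x _ hx =>
        rw [map_mul, map_mul, CliffordAlgebra.map_apply_ι, CliffordAlgebra.map_apply_ι]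
        exact (CliffordAlgebra.even Q').mul_mem
          (CliffordAlgebra.ι_mul_ι_mem_evenOdd_zero Q' _ _) hx
    exact key _ he

/-- The homomorphism of spin groups induced by an isometry. -/
def spinMap {V' : Type*} [AddCommGroup V'] [Module ℂ V'] {Q : QuadraticForm ℂ V}
    {Q' : QuadraticForm ℂ V'} (f : Q →qᵢ Q') : spinGroup Q →* spinGroup Q' where
  toFun g := ⟨CliffordAlgebra.map f g, map_mem_spinGroup f g.2⟩
  map_one' := by ext; simp
  map_mul' g h := by ext; simp

/-- The inclusion of a subspace as an isometry. -/
def subspaceIsometry (W : Submodule ℂ V) : Q.restrict W →qᵢ Q where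
  toLinearMap := W.subtype
  map_app' _ := rfl

/-- A splitting `W = F₃ ⊕ E₃ ⊕ L` of a seven-dimensional quadratic space, with `E₃`, `F₃` isotropic
in duality and `L` a line orthogonal to them, together with a basis of `E₃` and a unit vector of
`L`. -/
abbrev SevenSplitting (W : Submodule ℂ V) : Type _ :=
  (Q.restrict W).IsometryEquiv (oddForm (Fin 3 → ℂ))

/-- The spin representation `Δ₇ = ⋀E₃` of the spin group of a seven-dimensional quadratic
space with a splitting. -/
def sevenSpin {W : Submodule ℂ V} (s : SevenSplitting Q W) :
    Representation ℂ (spinGroup (Q.restrict W)) (ExteriorAlgebra ℂ (Fin 3 → ℂ)) :=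
  ((oddCliffordAction (Fin 3 → ℂ) : CliffordAlgebra (oddForm (Fin 3 → ℂ)) →* _).comp
    (spinGroup (oddForm (Fin 3 → ℂ))).subtype).comp (spinMap s.toIsometry)

/-- The image `g(W)` of a subspace `W` of `V` under `g` in the spin group: `v ∈ g(W)` if and only
if `v = g w g⁻¹` in the Clifford algebra for some `w ∈ W`. -/
def spinTranslate {Q : QuadraticForm ℂ V} (g : spinGroup Q) (W : Submodule ℂ V) :
    Submodule ℂ V :=
  ((W.map (CliffordAlgebra.ι Q)).map
    (LinearMap.mulLeftRight ℂ ((g : CliffordAlgebra Q), ((g⁻¹ : spinGroup Q) : CliffordAlgebra Q)))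
    ).comap (CliffordAlgebra.ι Q)

/-- `V = W ⊕ W'` is an orthogonal decomposition into seven-dimensional subspaces. -/
structure IsOrthogonalDecomposition (W W' : Submodule ℂ V) : Prop where
  finrank_left : Module.finrank ℂ W = 7
  finrank_right : Module.finrank ℂ W' = 7
  isCompl : IsCompl W W'
  orthogonal : ∀ w ∈ W, ∀ w' ∈ W', QuadraticMap.polar Q w w' = 0

end Spin

/-! ### The case of dimension fourteen -/

section Fourteen

variable {E : Type*} [AddCommGroup E] [Module ℂ E]

/-- The stabilizer of the point `[ψ]` preserves the (unordered) decomposition `V = W ⊕ W'`. -/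
def StabilizerPreserves (ψ : evenExterior E) (W W' : Submodule ℂ (Module.Dual ℂ E × E)) : Prop :=
  ∀ g : spinGroup (evenForm E), (∃ c : ℂ, halfSpin E g ψ = c • ψ) →
    (spinTranslate g W = W ∧ spinTranslate g W' = W') ∨
    (spinTranslate g W = W' ∧ spinTranslate g W' = W)

/-- `Φ : Δ₁₄ ≃ Δ₇ ⊗ Δ₇'` is equivariant under `Spin(W) × Spin(W')`, which acts on `Δ₁₄` through
the homomorphisms `Spin(W) → Spin₁₄` and `Spin(W') → Spin₁₄` induced by the inclusions. -/
def IsSpinEquivariant {W W' : Submodule ℂ (Module.Dual ℂ E × E)}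
    (s : SevenSplitting (evenForm E) W) (s' : SevenSplitting (evenForm E) W')
    (Φ : evenExterior E ≃ₗ[ℂ]
      ExteriorAlgebra ℂ (Fin 3 → ℂ) ⊗[ℂ] ExteriorAlgebra ℂ (Fin 3 → ℂ)) : Prop :=
  ∀ (g : spinGroup ((evenForm E).restrict W)) (g' : spinGroup ((evenForm E).restrict W'))
    (x : evenExterior E),
    Φ (halfSpin E (spinMap (subspaceIsometry _ W) g * spinMap (subspaceIsometry _ W') g') x) =
      TensorProduct.map (sevenSpin _ s g) (sevenSpin _ s' g') (Φ x)

end Fourteen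

end SpinFourteen

end

open scoped LinearAlgebra.Projectivization TensorProduct

noncomputable section

namespace SpinFourteen

/-! ### Elements of the spin group -/

section SpinElements

variable {V : Type*} [AddCommGroup V] [Module ℂ V] {Q : QuadraticForm ℂ V}

open CliffordAlgebra

/-! Call a spinor regular if the products of two vectors, applied to it, span the whole module;
infinitesimally, the spin group and scaling then move it in every direction. By the open mapping
theorem the orbit of a regular spinor, up to scale, contains a neighbourhood of it in every
direction (`eventually_sameOrbit`). Regularity is the nonvanishing of some maximal minor, so it is a
Zariski open condition, and two regular spinors are joined by a complex line minus finitely many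
points, which is connected. Hence the regular locus is one projective orbit (`IsRegular.sameOrbit`).
This locus is $U$; the same argument in dimension seven produces the generic points.

To exhibit a regular spinor, two copies of $\Delta_7\otimes\Delta_7$ are made into a Clifford module
for $V_7\oplus V_7'$ with a parity. Its dimension is $2^7$, so by uniqueness of the Fock module
(`exists_fock_equiv`) it is $\wedge^*E$, and one copy is $\Delta_{14}$ (`exists_model`). A mixed
product $vw'$ acts by $\varepsilon\, v\otimes w'$ with $\varepsilon=\pm i$. Take $\chi=1+e_1e_2e_3$.
Then $\Delta_7=\mathbb{C}\chi\oplus V_7\chi$ and $V_7V_7\chi$ spans $\Delta_7$, which makes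
$\chi\otimes\chi$ regular. Moving along the orbit, every point of $U$ has a model in which it is
$\chi\otimes\chi$.

Split the bivectors as $\wedge^2V_7\oplus\wedge^2V_7'\oplus V_7\otimes V_7'$. Applied to
$\chi\otimes\chi$, the first two parts land in $\Delta_7\otimes\chi+\chi\otimes\Delta_7$ and the
third injects into $V_7\chi\otimes V_7\chi$, which is independent of it. So the annihilator of
$\psi$ has no mixed part and preserves both summands (`Model.IsAdapted.bracket_left`). It contains
explicit short root vectors of $\mathfrak{g}_2$ on each side, and these generate $V_7$ from any
nonzero vector, so the only invariant subspaces of dimension seven are $V_7$ and $V_7'$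
(`Model.eq_left_or_eq_right`). An element fixing $[\psi]$ normalizes the annihilator, hence permutes
the two. Conversely, the exponentials of the root vectors fix $\psi$, and their squares preserve
each member of any invariant pair; taking logarithms, the members are $V_7$ and $V_7'$.

Two splittings of $V_7$ differ by an isometry, which lifts to $\Delta_7$ up to a sign
(`exists_intertwiner`), and the sign disappears on even products. Uniqueness of $\Phi$ is Schur's
lemma: the even Clifford algebra of $V_7$ contains enough rank one operators on $\Delta_7$. -/

theorem ι_mul_ι_mem_spinGroup {v w : V} (h : Q v * Q w = 1) : ι Q v * ι Q w ∈ spinGroup Q := by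
  have hv : Q v ≠ 0 := left_ne_zero_of_mul_eq_one h
  have hw : Q w ≠ 0 := right_ne_zero_of_mul_eq_one h
  have unit : ∀ u : V, Q u ≠ 0 → ∃ x : (CliffordAlgebra Q)ˣ, (x : CliffordAlgebra Q) = ι Q u := by
    intro u hu
    refine ⟨⟨ι Q u, (Q u)⁻¹ • ι Q u, ?_, ?_⟩, rfl⟩ <;>
    simp [Algebra.algebraMap_eq_smul_one, smul_smul, hu]
  obtain ⟨x, hx⟩ := unit v hv
  obtain ⟨y, hy⟩ := unit w hw
  have hstar : star (ι Q v * ι Q w) = ι Q w * ι Q v := by simp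
  have key : ∀ a b : V, Q a * Q b = 1 → ι Q a * ι Q b * (ι Q b * ι Q a) = 1 := by
    intro a b hab
    rw [mul_assoc, ← mul_assoc (ι Q b), ι_sq_scalar, ← Algebra.smul_def, mul_smul_comm,
      ι_sq_scalar, Algebra.algebraMap_eq_smul_one, smul_smul, mul_comm, hab, one_smul]
  refine ⟨⟨⟨x * y, ?_, by simp [hx, hy]⟩, ?_, ?_⟩, ι_mul_ι_mem_evenOdd_zero Q v w⟩
  · exact mul_mem (Subgroup.subset_closure ⟨v, hx.symm⟩) (Subgroup.subset_closure ⟨w, hy.symm⟩)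
  · rw [hstar]; exact key w v (by rw [mul_comm, h])
  · rw [hstar]; exact key v w h

/-- Over $\mathbb{C}$ one factor can be rescaled by a square root so that the two norms multiply to
1. -/
theorem exists_spinGroup_eq_smul {v w : V} (hv : Q v ≠ 0) (hw : Q w ≠ 0) :
    ∃ c : ℂ, c ≠ 0 ∧ ∃ g : spinGroup Q, (g : CliffordAlgebra Q) = c • (ι Q v * ι Q w) := by
  obtain ⟨c, hc⟩ := IsAlgClosed.exists_pow_nat_eq ((Q v * Q w)⁻¹) (n := 2) (by norm_num)
  have hne : Q v * Q w ≠ 0 := mul_ne_zero hv hw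
  refine ⟨c, ?_, ⟨ι Q (c • v) * ι Q w, ι_mul_ι_mem_spinGroup ?_⟩, ?_⟩
  · rintro rfl
    simp [hv, hw] at hc
  · rw [QuadraticMap.map_smul, smul_eq_mul, ← pow_two, hc, mul_assoc, inv_mul_cancel₀ hne]
  · simp

theorem spinGroup_conj_mem (g : spinGroup Q) (v : V) :
    ∃ v' : V, ι Q v' = (g : CliffordAlgebra Q) * ι Q v * ((g⁻¹ : spinGroup Q) : CliffordAlgebra Q) := by
  have : Invertible (2 : ℂ) := invertibleOfNonzero two_ne_zero
  obtain ⟨v', hv'⟩ := spinGroup.conjAct_smul_ι_mem_range_ι (Q := Q)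
    (x := spinGroup.toUnits g) (by exact g.2) v
  refine ⟨v', hv'.trans ?_⟩
  rw [ConjAct.units_smul_def]
  rfl

theorem coe_mul_coe_inv (g : spinGroup Q) :
    (g : CliffordAlgebra Q) * ((g⁻¹ : spinGroup Q) : CliffordAlgebra Q) = 1 := by
  rw [← Submonoid.coe_mul, mul_inv_cancel, Submonoid.coe_one]

theorem coe_inv_mul_coe (g : spinGroup Q) :
    ((g⁻¹ : spinGroup Q) : CliffordAlgebra Q) * (g : CliffordAlgebra Q) = 1 := by
  rw [← Submonoid.coe_mul, inv_mul_cancel, Submonoid.coe_one]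

/-- Over a nonzero quadratic form, anisotropic vectors span. -/
theorem span_anisotropic (hQ : Q ≠ 0) : Submodule.span ℂ {v : V | Q v ≠ 0} = ⊤ := by
  obtain ⟨v₀, h₀⟩ : ∃ v, Q v ≠ 0 := by
    by_contra! h
    exact hQ (QuadraticMap.ext h)
  refine eq_top_iff.2 fun v _ => ?_
  by_cases hv : Q v = 0
  -- Along $v+tv_0$ the form is $t$ times an affine function of $t$ with slope $Q(v_0)\neq0$, which
  -- cannot vanish at both 1 and 2.
  · have hlin : ∃ t : ℂ, t ≠ 0 ∧ Q (v + t • v₀) ≠ 0 := by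
      have hq : ∀ t : ℂ, Q (v + t • v₀) = t * (t * Q v₀ + QuadraticMap.polar Q v v₀) := by
        intro t
        rw [QuadraticMap.map_add Q, hv, QuadraticMap.map_smul, QuadraticMap.polar_smul_right]
        simp only [smul_eq_mul]
        ring
      by_cases h1 : Q v₀ + QuadraticMap.polar Q v v₀ = 0
      · refine ⟨2, two_ne_zero, ?_⟩
        rw [hq]
        refine mul_ne_zero two_ne_zero fun h => h₀ ?_
        linear_combination h - h1
      · exact ⟨1, one_ne_zero, by rw [hq]; simpa using h1⟩
    obtain ⟨t, ht, h⟩ := hlin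
    have : v = (v + t • v₀) - t • v₀ := by simp
    rw [this]
    exact sub_mem (Submodule.subset_span h) (Submodule.smul_mem _ _ (Submodule.subset_span h₀))
  · exact Submodule.subset_span hv

end SpinElements

/-! ### Polynomial functions -/

section Polynomial

variable {S : Type*} [AddCommGroup S] [Module ℂ S]

theorem linear_mem_polynomialFunctions (l : S →ₗ[ℂ] ℂ) :
    (fun v => l v) ∈ polynomialFunctions S :=
  Algebra.subset_adjoin ⟨l, rfl⟩

/-- This reduces the zeros of a minor along a line to the finitely many roots of a polynomial in one
variable. -/
theorem exists_polynomial_on_line {F : S → ℂ} (hF : F ∈ polynomialFunctions S) (x d : S) :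
    ∃ p : Polynomial ℂ, ∀ t : ℂ, F (x + t • d) = p.eval t := by
  induction hF using Algebra.adjoin_induction with
  | mem F h =>
    obtain ⟨l, rfl⟩ := h
    exact ⟨Polynomial.C (l x) + Polynomial.C (l d) * Polynomial.X, fun t => by simp; ring⟩
  | algebraMap r => exact ⟨Polynomial.C r, fun t => by simp⟩
  | add F G _ _ hF hG =>
    obtain ⟨p, hp⟩ := hF
    obtain ⟨q, hq⟩ := hG
    exact ⟨p + q, fun t => by simp [hp, hq]⟩
  | mul F G _ _ hF hG =>
    obtain ⟨p, hp⟩ := hF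
    obtain ⟨q, hq⟩ := hG
    exact ⟨p * q, fun t => by simp [hp, hq]⟩

theorem det_mem_polynomialFunctions {n : ℕ} (M : Fin n → Fin n → (S →ₗ[ℂ] ℂ)) :
    (fun x => (Matrix.of fun i j => M i j x).det) ∈ polynomialFunctions S := by
  have : (fun x => (Matrix.of fun i j => M i j x).det) =
      ∑ σ : Equiv.Perm (Fin n), ((Equiv.Perm.sign σ : ℤ) : ℂ) •
        ∏ i, (fun x => M (σ i) i x) := by
    funext x
    simp [Matrix.det_apply', Finset.sum_apply, Finset.prod_apply]
  rw [this]
  exact sum_mem fun σ _ => Subalgebra.smul_mem _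
    (prod_mem fun i _ => linear_mem_polynomialFunctions _) _

theorem exists_basis_mem {s : Set S} [Module.Finite ℂ S]
    (hs : Submodule.span ℂ s = ⊤) :
    ∃ b : Module.Basis (Fin (Module.finrank ℂ S)) ℂ S, ∀ i, b i ∈ s := by
  let b := Module.Basis.ofSpan (K := ℂ) (s := s) hs.ge
  have : Fintype _ := FiniteDimensional.fintypeBasisIndex b
  let e := Fintype.equivFinOfCardEq (Module.finrank_eq_card_basis b).symm
  refine ⟨b.reindex e, fun i => ?_⟩
  rw [Module.Basis.reindex_apply]
  exact Module.Basis.ofSpan_subset hs.ge ⟨_, rfl⟩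

end Polynomial

/-! ### Points with maximal infinitesimal orbit -/

section Regular

variable {V : Type*} [AddCommGroup V] [Module ℂ V] {Q : QuadraticForm ℂ V}
  {S : Type*} [AddCommGroup S] [Module ℂ S]
  (β : CliffordAlgebra.even Q →ₐ[ℂ] Module.End ℂ S)

open CliffordAlgebra Filter Topology

/-- A vector of a module over the even Clifford algebra is regular if its translates by products
of two vectors span. -/
def IsRegular (x : S) : Prop :=
  Submodule.span ℂ (Set.range fun p : V × V => β ((even.ι Q).bilin p.1 p.2) x) = ⊤

/-- An element of the spin group as an element of the even Clifford algebra. -/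
def spinToEven : spinGroup Q →* CliffordAlgebra.even Q where
  toFun g := ⟨g, spinGroup.mem_even g.2⟩
  map_one' := rfl
  map_mul' _ _ := rfl

variable {β} (ρ : Representation ℂ (spinGroup Q) S)

theorem IsRegular.smul {x : S} (hx : IsRegular β x) {c : ℂ} (hc : c ≠ 0) :
    IsRegular β (c • x) := by
  refine eq_top_iff.2 (hx.ge.trans (Submodule.span_le.2 ?_))
  rintro _ ⟨p, rfl⟩
  refine Submodule.subset_span ⟨(c⁻¹ • p.1, p.2), ?_⟩
  simp [smul_smul, hc]

theorem IsRegular.ne_zero [Nontrivial S] {x : S} (hx : IsRegular β x) : x ≠ 0 := by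
  rintro rfl
  have : Submodule.span ℂ (Set.range fun p : V × V => β ((even.ι Q).bilin p.1 p.2) (0 : S)) ≤ ⊥ := by
    rw [Submodule.span_le]
    rintro _ ⟨p, rfl⟩
    simp
  rw [IsRegular] at hx
  rw [hx] at this
  exact bot_ne_top (α := Submodule ℂ S) (le_antisymm bot_le this)

/-- Conjugation by $g$ sends vectors to vectors, and $g\,vw\,x=(gvg^{-1})(gwg^{-1})\,gx$. -/
theorem IsRegular.map (hρ : ∀ g, ρ g = β (spinToEven g)) {x : S} (hx : IsRegular β x)
    (g : spinGroup Q) : IsRegular β (ρ g x) := by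
  have hsurj : Function.Surjective (ρ g) := fun y => ⟨ρ g⁻¹ y, by simp⟩
  have h1 : Submodule.map (ρ g) ⊤ = ⊤ := by
    rw [Submodule.map_top]; exact LinearMap.range_eq_top.2 hsurj
  rw [IsRegular] at hx ⊢
  rw [← hx, Submodule.map_span] at h1
  refine eq_top_iff.2 ((h1.trans hx).ge.trans (Submodule.span_le.2 ?_))
  rintro _ ⟨_, ⟨⟨v, w⟩, rfl⟩, rfl⟩
  obtain ⟨v', hv⟩ := spinGroup_conj_mem g v
  obtain ⟨w', hw⟩ := spinGroup_conj_mem g w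
  refine Submodule.subset_span ⟨(v', w'), ?_⟩
  simp only [hρ, ← Module.End.mul_apply, ← map_mul]
  congr 2
  apply Subtype.ext
  change ι Q v' * ι Q w' * (g : CliffordAlgebra Q) = g * (ι Q v * ι Q w)
  rw [hv, hw]
  calc _ = (g : CliffordAlgebra Q) * ι Q v * (((g⁻¹ : spinGroup Q) : CliffordAlgebra Q) * g) *
        ι Q w * (((g⁻¹ : spinGroup Q) : CliffordAlgebra Q) * g) := by noncomm_ring
    _ = _ := by rw [coe_inv_mul_coe]; noncomm_ring

/-- Two vectors are related if they span lines in the same orbit. -/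
def SameOrbit (x y : S) : Prop := ∃ c : ℂ, c ≠ 0 ∧ ∃ g : spinGroup Q, y = c • ρ g x

variable {ρ}

theorem SameOrbit.refl (x : S) : SameOrbit ρ x x := ⟨1, one_ne_zero, 1, by simp⟩

theorem SameOrbit.symm {x y : S} (h : SameOrbit ρ x y) : SameOrbit ρ y x := by
  obtain ⟨c, hc, g, rfl⟩ := h
  exact ⟨c⁻¹, inv_ne_zero hc, g⁻¹, by simp [smul_smul, hc]⟩

theorem SameOrbit.trans {x y z : S} (h : SameOrbit ρ x y) (h' : SameOrbit ρ y z) :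
    SameOrbit ρ x z := by
  obtain ⟨c, hc, g, rfl⟩ := h
  obtain ⟨c', hc', g', rfl⟩ := h'
  exact ⟨c' * c, mul_ne_zero hc' hc, g' * g, by simp [smul_smul]⟩

theorem sameOrbit_bilin (hρ : ∀ g, ρ g = β (spinToEven g)) {v w : V} (hv : Q v ≠ 0)
    (hw : Q w ≠ 0) {c : ℂ} (hc : c ≠ 0) (x : S) :
    SameOrbit ρ x (c • β ((even.ι Q).bilin v w) x) := by
  obtain ⟨a, ha, g, hg⟩ := exists_spinGroup_eq_smul hv hw
  refine ⟨c * a⁻¹, mul_ne_zero hc (inv_ne_zero ha), g, ?_⟩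
  have : spinToEven g = a • (even.ι Q).bilin v w := Subtype.ext hg
  rw [hρ, this, map_smul, LinearMap.smul_apply, smul_smul, mul_assoc, inv_mul_cancel₀ ha, mul_one]

/-- The product of the operators `1 + t i • N i` over a list, applied to a vector. -/
def listProd {ι F : Type*} [AddCommGroup F] [Module ℂ F] (N : ι → F →ₗ[ℂ] F) (y : F)
    (t : ι → ℂ) : List ι → F
  | [] => y
  | i :: l => listProd N y t l + t i • N i (listProd N y t l)

theorem listProd_zero {ι F : Type*} [AddCommGroup F] [Module ℂ F] (N : ι → F →ₗ[ℂ] F) (y : F)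
    (l : List ι) : listProd N y 0 l = y := by
  induction l with
  | nil => rfl
  | cons i l ih => simp [listProd, ih]

theorem hasStrictFDerivAt_listProd {ι F : Type*} [Fintype ι] [NormedAddCommGroup F]
    [NormedSpace ℂ F] [FiniteDimensional ℂ F] (N : ι → F →ₗ[ℂ] F) (y : F) (l : List ι) :
    HasStrictFDerivAt (fun t => listProd N y t l)
      (l.map fun i => (ContinuousLinearMap.proj (R := ℂ) (φ := fun _ : ι => ℂ) i).smulRight
        (N i y)).sum 0 := by
  induction l with
  | nil => exact hasStrictFDerivAt_const _ _
  | cons i l ih =>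
    have h1 := (LinearMap.toContinuousLinearMap (N i)).hasStrictFDerivAt.comp (0 : ι → ℂ) ih
    have h2 := ((ContinuousLinearMap.proj (R := ℂ) (φ := fun _ : ι => ℂ) i).hasStrictFDerivAt
      (x := 0)).smul h1
    have h3 := ih.add h2
    refine h3.congr_fderiv ?_
    ext t
    simp [listProd_zero, add_comm]

/-- Choose a basis of the module of the form $N_iy$ with $N_i=Q(w_i)^{-1}v_iw_i$. The map
$t\mapsto\prod(1+t_iN_i)\,y$ has invertible derivative at 0, so it covers a neighbourhood of $y$,
and for small $t$ its values lie in the orbit of $y$ up to scale. -/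
theorem eventually_sameOrbit [Module.Finite ℂ S] (hQ : Q ≠ 0)
    (hρ : ∀ g, ρ g = β (spinToEven g)) {y : S} (hy : IsRegular β y) (z : S) :
    ∀ᶠ t in 𝓝 (0 : ℂ), SameOrbit ρ y (y + t • z) := by
  have hspan : Submodule.span ℂ {x | ∃ v w, Q w ≠ 0 ∧ x = (Q w)⁻¹ • β ((even.ι Q).bilin v w) y}
      = ⊤ := by
    refine eq_top_iff.2 (hy.ge.trans (Submodule.span_le.2 ?_))
    rintro _ ⟨⟨v, w⟩, rfl⟩
    have hw : w ∈ Submodule.span ℂ {v : V | Q v ≠ 0} := by rw [span_anisotropic hQ]; trivial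
    let L : V →ₗ[ℂ] S := (LinearMap.applyₗ y) ∘ₗ β.toLinearMap ∘ₗ (even.ι Q).bilin v
    change L w ∈ _
    induction hw using Submodule.span_induction with
    | mem w hw =>
      have : L w = Q w • ((Q w)⁻¹ • β ((even.ι Q).bilin v w) y) := by
        rw [smul_smul, mul_inv_cancel₀ hw, one_smul]; rfl
      rw [this]
      exact Submodule.smul_mem _ _ (Submodule.subset_span ⟨v, w, hw, rfl⟩)
    | zero => rw [map_zero]; exact zero_mem _
    | add w w' _ _ h h' => rw [map_add]; exact add_mem h h'
    | smul c w _ h => rw [map_smul]; exact Submodule.smul_mem _ _ h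
  obtain ⟨b, hb⟩ := exists_basis_mem hspan
  choose v w hw hvw using hb
  let e : S ≃ₗ[ℂ] (Fin (Module.finrank ℂ S) → ℂ) := b.equivFun
  let N₀ : Fin (Module.finrank ℂ S) → S →ₗ[ℂ] S :=
    fun i => (Q (w i))⁻¹ • β ((even.ι Q).bilin (v i) (w i))
  let N := fun i => e.toLinearMap ∘ₗ N₀ i ∘ₗ e.symm.toLinearMap
  have hderiv := hasStrictFDerivAt_listProd N (e y) (List.finRange _)
  -- In the coordinates of the basis $N_iy$ the derivative is the identity, so each vector is its
  -- own preimage.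
  have hsurj : (((List.finRange (Module.finrank ℂ S)).map fun i =>
      (ContinuousLinearMap.proj (R := ℂ) (φ := fun _ => ℂ) i).smulRight
        (N i (e y))).sum).range = ⊤ := by
    refine LinearMap.range_eq_top.2 fun x => ⟨x, ?_⟩
    have h2 : ∀ i, N i (e y) = e (b i) := by
      intro i
      simp [N, N₀, hvw i]
    have : ∀ l : List (Fin (Module.finrank ℂ S)), ((l.map fun i =>
        (ContinuousLinearMap.proj (R := ℂ) (φ := fun _ => ℂ) i).smulRight
        (N i (e y))).sum) x = (l.map fun i => x i • e (b i)).sum := by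
      intro l
      induction l with
      | nil => rfl
      | cons i l ih =>
        rw [List.map_cons, List.sum_cons, _root_.add_apply, ih]
        simp [h2]
    refine (this _).trans ?_
    rw [← Fin.sum_univ_def, ← e.symm.injective.eq_iff, map_sum]
    simp only [map_smul, LinearEquiv.symm_apply_apply]
    exact (b.equivFun_symm_apply x).symm
  have hmap := hderiv.map_nhds_eq_of_surj hsurj
  rw [listProd_zero] at hmap
  have hgood : ∀ᶠ s in 𝓝 (0 : Fin (Module.finrank ℂ S) → ℂ), ∀ i, Q (w i + s i • v i) ≠ 0 := by
    rw [eventually_all]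
    intro i
    have hc : Continuous fun s : Fin (Module.finrank ℂ S) → ℂ => Q (w i + s i • v i) := by
      have : (fun s : Fin (Module.finrank ℂ S) → ℂ => Q (w i + s i • v i)) = fun s =>
          Q (w i) + s i * s i * Q (v i) + s i * QuadraticMap.polar Q (w i) (v i) := by
        funext s
        rw [QuadraticMap.map_add Q, QuadraticMap.map_smul, QuadraticMap.polar_smul_right]
        simp
      rw [this]
      fun_prop
    refine hc.continuousAt.eventually_ne ?_
    simpa using hw i
  -- As $w_i^2=Q(w_i)$, the factor $1+s_iN_i$ equals $Q(w_i)^{-1}(w_i+s_iv_i)w_i$, a multiple of a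
  -- spin element as soon as $w_i+s_iv_i$ is anisotropic.
  have hor : ∀ s : Fin (Module.finrank ℂ S) → ℂ, (∀ i, Q (w i + s i • v i) ≠ 0) →
      ∀ l, SameOrbit ρ y (e.symm (listProd N (e y) s l)) := by
    intro s hs l
    induction l with
    | nil => simpa [listProd] using SameOrbit.refl y
    | cons i l ih =>
      refine ih.trans ?_
      have := sameOrbit_bilin hρ (hs i) (hw i) (inv_ne_zero (hw i))
        (e.symm (listProd N (e y) s l))
      convert this using 1
      have hww : (even.ι Q).bilin (w i) (w i) = algebraMap ℂ _ (Q (w i)) :=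
        Subtype.ext (ι_sq_scalar Q (w i))
      simp only [listProd, map_add, map_smul, N, N₀, LinearMap.add_apply, hww,
        AlgHom.commutes, Module.algebraMap_end_apply, LinearMap.smul_apply, smul_add, smul_smul,
        LinearMap.comp_apply, LinearEquiv.coe_coe, LinearEquiv.symm_apply_apply]
      rw [inv_mul_cancel₀ (hw i), one_smul, mul_comm]
  have himg : {x | SameOrbit ρ y (e.symm x)} ∈ 𝓝 (e y) := by
    rw [← hmap]
    refine mem_map.2 ?_
    filter_upwards [hgood] with s hs
    exact hor s hs _
  have hcont : Tendsto (fun t : ℂ => e y + t • e z) (𝓝 0) (𝓝 (e y)) := by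
    have : Continuous fun t : ℂ => e y + t • e z := by fun_prop
    simpa using this.tendsto 0
  filter_upwards [hcont himg] with t ht
  simpa using ht

/-! ### Regularity as a Zariski open condition, and uniqueness of the regular orbit -/

variable (β)

/-- A maximal minor of the infinitesimal action. -/
def minor {n : ℕ} (b : Module.Basis (Fin n) ℂ S) (p : Fin n → V × V) (x : S) : ℂ :=
  (Matrix.of fun i j => b.repr (β ((even.ι Q).bilin (p j).1 (p j).2) x) i).det

theorem isHomogeneousPolynomial_minor {n : ℕ} (b : Module.Basis (Fin n) ℂ S) (p : Fin n → V × V) :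
    IsHomogeneousPolynomial S n (minor β b p) := by
  refine ⟨det_mem_polynomialFunctions fun i j =>
    b.coord i ∘ₗ β ((even.ι Q).bilin (p j).1 (p j).2), fun c x => ?_⟩
  have : (Matrix.of fun i j => b.repr (β ((even.ι Q).bilin (p j).1 (p j).2) (c • x)) i) =
      c • (Matrix.of fun i j => b.repr (β ((even.ι Q).bilin (p j).1 (p j).2) x) i) := by
    ext i j
    simp
  rw [minor, this, Matrix.det_smul, Fintype.card_fin, minor]

theorem isRegular_iff_minor [Module.Finite ℂ S]
    (b : Module.Basis (Fin (Module.finrank ℂ S)) ℂ S) (x : S) :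
    IsRegular β x ↔ ∃ p, minor β b p x ≠ 0 := by
  constructor
  · intro hx
    obtain ⟨b', hb'⟩ := exists_basis_mem hx
    choose p hp using hb'
    refine ⟨p, ?_⟩
    have : minor β b p x = b.det b' := by
      rw [minor, Module.Basis.det_apply]
      congr 1
      ext i j
      rw [Module.Basis.toMatrix_apply, ← hp j]
      rfl
    rw [this]
    exact (Module.Basis.isUnit_det b b').ne_zero
  · rintro ⟨p, hp⟩
    have h : IsUnit (b.det fun j => β ((even.ι Q).bilin (p j).1 (p j).2) x) := by
      rw [isUnit_iff_ne_zero]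
      exact hp
    have h2 := ((Module.Basis.is_basis_iff_det b).2 h).2
    refine eq_top_iff.2 (h2.ge.trans (Submodule.span_mono ?_))
    rintro _ ⟨j, rfl⟩
    exact ⟨p j, rfl⟩

variable {β}

/-- Being in the same orbit up to scale is locally constant along the regular points of a line, and
the chosen set of regular points on the line through $x$ and $y$ is connected. -/
theorem IsRegular.sameOrbit [Module.Finite ℂ S] (hQ : Q ≠ 0)
    (hρ : ∀ g, ρ g = β (spinToEven g)) {x y : S} (hx : IsRegular β x) (hy : IsRegular β y) :
    SameOrbit ρ x y := by
  let b := Module.finBasis ℂ S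
  obtain ⟨p, hp⟩ := (isRegular_iff_minor β b x).1 hx
  obtain ⟨q, hq⟩ := (isRegular_iff_minor β b y).1 hy
  obtain ⟨P, hP⟩ := exists_polynomial_on_line (isHomogeneousPolynomial_minor β b p).1 x (y - x)
  obtain ⟨R, hR⟩ := exists_polynomial_on_line (isHomogeneousPolynomial_minor β b q).1 x (y - x)
  have hP0 : P ≠ 0 := by
    rintro rfl
    apply hp
    simpa using hP 0
  -- One minor is nonzero at $x$, the other at $y$. Removing only their common zeros keeps both
  -- endpoints; these zeros are among the roots of $P\neq0$, and the complement of a countable set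
  -- in $\mathbb{C}$ is connected.
  let Z : Set ℂ := {t | P.eval t = 0 ∧ R.eval t = 0}
  have hZ : Z.Countable := by
    refine Set.Countable.mono (fun t ht => ?_) (P.roots.toFinset.finite_toSet.countable)
    simpa [hP0] using ht.1
  have hconn : IsPreconnected Zᶜ :=
    (hZ.isConnected_compl_of_one_lt_rank (by simp)).isPreconnected
  have hreg : ∀ t ∈ Zᶜ, IsRegular β (x + t • (y - x)) := by
    intro t ht
    rw [isRegular_iff_minor β b]
    by_cases h : P.eval t = 0
    · refine ⟨q, fun h' => ht ⟨h, ?_⟩⟩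
      rwa [hR] at h'
    · exact ⟨p, by rwa [hP]⟩
  have h0 : (0 : ℂ) ∈ Zᶜ := by
    rintro ⟨h, -⟩
    rw [← hP] at h
    exact hp (by simpa using h)
  have h1 : (1 : ℂ) ∈ Zᶜ := by
    rintro ⟨-, h⟩
    rw [← hR] at h
    exact hq (by simpa using h)
  have := hconn.induction₂ (fun s t => SameOrbit ρ (x + s • (y - x)) (x + t • (y - x)))
    (fun s hs => ?_) (fun _ _ _ _ _ _ h h' => h.trans h') (fun _ _ _ _ h => h.symm) h0 h1
  · simpa using this
  · refine mem_nhdsWithin_of_mem_nhds ?_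
    have h2 := eventually_sameOrbit hQ hρ (hreg s hs) (y - x)
    have h3 : Tendsto (fun t : ℂ => t - s) (𝓝 s) (𝓝 0) := by
      have : Continuous fun t : ℂ => t - s := by fun_prop
      simpa using this.tendsto s
    filter_upwards [h3 h2] with t ht
    have ht' : SameOrbit ρ (x + s • (y - x)) (x + s • (y - x) + (t - s) • (y - x)) := ht
    rwa [add_assoc, ← add_smul, add_sub_cancel] at ht'

/-- The points of `ℙ(S)` represented by regular vectors. -/
def regularLocus (β : CliffordAlgebra.even Q →ₐ[ℂ] Module.End ℂ S) : Set (ℙ ℂ S) :=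
  {p | IsRegular β p.rep}

theorem mk_mem_regularLocus {v : S} (hv : v ≠ 0) :
    Projectivization.mk ℂ v hv ∈ regularLocus β ↔ IsRegular β v := by
  obtain ⟨a, ha⟩ := Projectivization.exists_smul_eq_mk_rep ℂ v hv
  rw [regularLocus, Set.mem_ofPred_eq, ← ha]
  refine ⟨fun h => ?_, fun h => h.smul a.ne_zero⟩
  have := h.smul (c := (a : ℂ)⁻¹) (inv_ne_zero a.ne_zero)
  rwa [Units.smul_def, smul_smul, inv_mul_cancel₀ a.ne_zero, one_smul] at this

theorem isZariskiOpen_regularLocus [Module.Finite ℂ S] : IsZariskiOpen (regularLocus β) := by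
  let b := Module.finBasis ℂ S
  refine ⟨Set.range (minor β b), ?_, fun v hv => ?_⟩
  · rintro _ ⟨p, rfl⟩
    exact ⟨_, isHomogeneousPolynomial_minor β b p⟩
  · rw [mk_mem_regularLocus, isRegular_iff_minor β b]
    simp

theorem IsRegular.projOrbit_eq [Module.Finite ℂ S] (hQ : Q ≠ 0)
    (hρ : ∀ g, ρ g = β (spinToEven g)) {x : S} (hx : IsRegular β x) :
    projOrbit ρ x = regularLocus β := by
  ext p
  induction p using Projectivization.ind with
  | h v hv =>
    rw [mk_mem_regularLocus]
    constructor
    · rintro ⟨g, h, hg⟩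
      rw [← mk_mem_regularLocus hv, hg, mk_mem_regularLocus]
      exact hx.map ρ hρ g
    · intro h
      obtain ⟨c, hc, g, rfl⟩ := hx.sameOrbit hQ hρ h
      have hg : ρ g x ≠ 0 := fun h => hv (by rw [h, smul_zero])
      refine ⟨g, hg, ?_⟩
      rw [Projectivization.mk_eq_mk_iff']
      exact ⟨c, rfl⟩

end Regular

/-! ### Uniqueness of the Clifford module structure on the exterior algebra -/

section Fock

variable {E : Type*} [AddCommGroup E] [Module ℂ E]

theorem polar_evenForm (v w : Module.Dual ℂ E × E) :
    QuadraticMap.polar (evenForm E) v w = 2 * (v.1 w.2 + w.1 v.2) := by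
  simp only [QuadraticMap.polar, evenForm, _root_.smul_apply, QuadraticForm.dualProd_apply,
    Prod.fst_add, Prod.snd_add, LinearMap.add_apply, map_add, smul_eq_mul]
  ring

theorem polar_oddForm (v w : (Module.Dual ℂ E × E) × ℂ) :
    QuadraticMap.polar (oddForm E) v w = 2 * (v.1.1 w.1.2 + w.1.1 v.1.2 + v.2 * w.2) := by
  have := polar_evenForm v.1 w.1
  simp only [QuadraticMap.polar, oddForm, QuadraticMap.prod_apply, Prod.fst_add, Prod.snd_add,
    QuadraticMap.sq_apply] at this ⊢
  linear_combination this

theorem wedgeContractParity_apply (v : Module.Dual ℂ E × E) (t : ℂ) (x : ExteriorAlgebra ℂ E) :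
    wedgeContractParity (v, t) x = wedgeContract v x + t • parity x := by
  simp [wedgeContractParity]

theorem parity_parity (x : ExteriorAlgebra ℂ E) : parity (parity x) = x :=
  CliffordAlgebra.involute_involute x

theorem parity_wedgeContract (v : Module.Dual ℂ E × E) (x : ExteriorAlgebra ℂ E) :
    parity (wedgeContract v x) = -wedgeContract v (parity x) :=
  wedgeContract_involute v x

theorem finrank_exteriorAlgebra [Module.Finite ℂ E] :
    Module.finrank ℂ (ExteriorAlgebra ℂ E) = 2 ^ Module.finrank ℂ E := by
  rw [Module.finrank_eq_card_basis (Module.finBasis ℂ E).ExteriorAlgebra]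
  simp

instance [Module.Finite ℂ E] : Module.Finite ℂ (ExteriorAlgebra ℂ E) :=
  Module.Finite.of_basis (Module.finBasis ℂ E).ExteriorAlgebra

/-- The Euler operator `∑ eᵢ ∧ (eᵢ* ⌟ x)`. -/
def euler {ι : Type*} [Fintype ι] (b : Module.Basis ι ℂ E) : Module.End ℂ (ExteriorAlgebra ℂ E) :=
  ∑ i, LinearMap.mulLeft ℂ (ExteriorAlgebra.ι ℂ (b i)) ∘ₗ
    CliffordAlgebra.contractLeft (Q := (0 : QuadraticForm ℂ E)) (b.coord i)

theorem euler_ι_mul {ι : Type*} [Fintype ι] (b : Module.Basis ι ℂ E) (e : E)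
    (x : ExteriorAlgebra ℂ E) :
    euler b (ExteriorAlgebra.ι ℂ e * x) =
      ExteriorAlgebra.ι ℂ e * x + ExteriorAlgebra.ι ℂ e * euler b x := by
  have h1 : ∀ i, CliffordAlgebra.contractLeft (Q := (0 : QuadraticForm ℂ E)) (b.coord i)
      (ExteriorAlgebra.ι ℂ e * x) = b.coord i e • x - ExteriorAlgebra.ι ℂ e *
        CliffordAlgebra.contractLeft (Q := (0 : QuadraticForm ℂ E)) (b.coord i) x := fun i =>
    CliffordAlgebra.contractLeft_ι_mul (Q := (0 : QuadraticForm ℂ E)) (d := b.coord i) e x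
  have h2 : ∀ i, ExteriorAlgebra.ι ℂ (b i) * ExteriorAlgebra.ι ℂ e =
      -(ExteriorAlgebra.ι ℂ e * ExteriorAlgebra.ι ℂ (b i)) := fun i =>
    eq_neg_of_add_eq_zero_left (ExteriorAlgebra.ι_add_mul_swap _ _)
  have h3 : ExteriorAlgebra.ι ℂ e * x =
      ∑ i, b.coord i e • (ExteriorAlgebra.ι ℂ (b i) * x) := by
    conv_lhs => rw [← b.sum_repr e, map_sum, Finset.sum_mul]
    simp
  simp only [euler, LinearMap.sum_apply, LinearMap.comp_apply, LinearMap.mulLeft_apply, h1, mul_sub,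
    ← mul_assoc, h2, Finset.mul_sum, neg_mul, sub_neg_eq_add, mul_smul_comm,
    Finset.sum_add_distrib]
  rw [h3]

/-- Wedging with a vector raises the eigenvalue by one, so this operator counts the degree. -/
theorem euler_of_mem {ι : Type*} [Fintype ι] (b : Module.Basis ι ℂ E) {n : ℕ}
    {x : ExteriorAlgebra ℂ E} (hx : x ∈ ⋀[ℂ]^n E) : euler b x = (n : ℂ) • x := by
  induction hx using Submodule.pow_induction_on_left' with
  | algebraMap r =>
    have := fun i => CliffordAlgebra.contractLeft_algebraMap (Q := (0 : QuadraticForm ℂ E))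
      (b.coord i) r
    simp only [euler, LinearMap.sum_apply, LinearMap.comp_apply, Nat.cast_zero, zero_smul]
    exact Finset.sum_eq_zero fun i _ => (congrArg _ (this i)).trans (map_zero _)
  | add x y n _ _ hx hy => rw [map_add, hx, hy, smul_add]
  | mem_mul m hm n x _ hx =>
    obtain ⟨e, rfl⟩ := hm
    rw [euler_ι_mul, hx, mul_smul_comm]
    push_cast
    module

/-- The Euler operator kills such an element and multiplies its degree $n$ component by $n$, so only
the degree 0 component can survive. -/
theorem exists_algebraMap_of_contractLeft_eq_zero [Module.Finite ℂ E] {x : ExteriorAlgebra ℂ E}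
    (h : ∀ f, CliffordAlgebra.contractLeft (Q := (0 : QuadraticForm ℂ E)) f x = 0) :
    ∃ c : ℂ, x = algebraMap ℂ _ c := by
  classical
  let b := Module.finBasis ℂ E
  let 𝒜 := fun n : ℕ => ⋀[ℂ]^n E
  have hN : euler b x = 0 := by
    simp only [euler, LinearMap.sum_apply, LinearMap.comp_apply]
    exact Finset.sum_eq_zero fun i _ => (congrArg _ (h _)).trans (map_zero _)
  have key : ∀ (k : ℕ) (y : ExteriorAlgebra ℂ E),
      (DirectSum.decompose 𝒜 (euler b y) k : ExteriorAlgebra ℂ E) =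
        (k : ℂ) • (DirectSum.decompose 𝒜 y k : ExteriorAlgebra ℂ E) := by
    intro k y
    induction y using DirectSum.Decomposition.inductionOn 𝒜 with
    | zero => simp
    | @homogeneous i m =>
      rw [euler_of_mem b m.2, DirectSum.decompose_smul]
      by_cases hik : i = k
      · subst hik; rfl
      · have : (DirectSum.decompose 𝒜 (m : ExteriorAlgebra ℂ E) k : ExteriorAlgebra ℂ E) = 0 :=
          DirectSum.decompose_of_mem_ne 𝒜 m.2 hik
        rw [DirectSum.smul_apply, Submodule.coe_smul, this, smul_zero, smul_zero]
    | add y z hy hz =>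
      rw [map_add, DirectSum.decompose_add, DirectSum.decompose_add, DirectSum.add_apply,
        DirectSum.add_apply, Submodule.coe_add, Submodule.coe_add, hy, hz, smul_add]
  have hx : x = (DirectSum.decompose 𝒜 x 0 : ExteriorAlgebra ℂ E) := by
    conv_lhs => rw [← DirectSum.sum_support_decompose 𝒜 x]
    refine Finset.sum_eq_single 0 (fun k _ hk => ?_) (fun h0 => ?_)
    · have := key k x
      rw [hN, DirectSum.decompose_zero] at this
      refine (smul_eq_zero.1 this.symm).resolve_left ?_
      exact_mod_cast hk
    · rw [DFinsupp.notMem_support_iff] at h0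
      rw [h0]; rfl
  have h0 : (DirectSum.decompose 𝒜 x 0 : ExteriorAlgebra ℂ E) ∈ ⋀[ℂ]^0 E :=
    (DirectSum.decompose 𝒜 x 0).2
  rw [← hx] at h0
  change x ∈ LinearMap.range (ExteriorAlgebra.ι ℂ (M := E)) ^ 0 at h0
  rw [pow_zero] at h0
  obtain ⟨c, hc⟩ := Submodule.mem_one.1 h0
  exact ⟨c, hc.symm⟩

variable {S : Type*} [AddCommGroup S] [Module ℂ S]
  {γ : (Module.Dual ℂ E × E) →ₗ[ℂ] Module.End ℂ S}

theorem clifford_swap (hγ : ∀ v, γ v * γ v = algebraMap ℂ _ (evenForm E v))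
    (v w : Module.Dual ℂ E × E) (x : S) :
    γ v (γ w x) = (2 * (v.1 w.2 + w.1 v.2)) • x - γ w (γ v x) := by
  have := LinearMap.congr_fun
    (CliffordAlgebra.mul_add_swap_eq_polar_of_forall_mul_self_eq (Q := evenForm E) γ hγ v w) x
  rw [polar_evenForm] at this
  exact eq_sub_of_add_eq this

/-- The operators $\gamma(f,0)$ anticommute and square to zero. Run through a basis of $F$: apply an
operator when it does not kill the current vector. The result is killed by it, and stays killed by
the earlier ones. -/
theorem exists_vacuum [Module.Finite ℂ E]
    (hγ : ∀ v, γ v * γ v = algebraMap ℂ _ (evenForm E v)) (K : Submodule ℂ S) (hK : K ≠ ⊥)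
    (hst : ∀ f : Module.Dual ℂ E, ∀ x ∈ K, γ (f, 0) x ∈ K) :
    ∃ x ∈ K, x ≠ 0 ∧ ∀ f : Module.Dual ℂ E, γ (f, 0) x = 0 := by
  classical
  let b := Module.finBasis ℂ (Module.Dual ℂ E)
  have : ∀ s : Finset (Fin (Module.finrank ℂ (Module.Dual ℂ E))),
      ∃ x ∈ K, x ≠ 0 ∧ ∀ i ∈ s, γ (b i, 0) x = 0 := by
    intro s
    induction s using Finset.induction with
    | empty =>
      obtain ⟨x, hx, h0⟩ := (Submodule.ne_bot_iff K).1 hK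
      exact ⟨x, hx, h0, by simp⟩
    | insert i s _ ih =>
      obtain ⟨x, hx, h0, hs⟩ := ih
      by_cases h : γ (b i, 0) x = 0
      · refine ⟨x, hx, h0, fun j hj => ?_⟩
        rcases Finset.mem_insert.1 hj with rfl | hj
        exacts [h, hs j hj]
      · refine ⟨γ (b i, 0) x, hst _ _ hx, h, fun j hj => ?_⟩
        rcases Finset.mem_insert.1 hj with rfl | hj
        · have := LinearMap.congr_fun (hγ (b j, 0)) x
          refine this.trans ?_
          simp [evenForm]
        · rw [clifford_swap hγ, hs j hj]
          simp
  obtain ⟨x, hx, h0, hs⟩ := this Finset.univ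
  refine ⟨x, hx, h0, fun f => ?_⟩
  let L : Module.Dual ℂ E →ₗ[ℂ] S := LinearMap.applyₗ x ∘ₗ γ ∘ₗ LinearMap.inl ℂ _ _
  have : L = 0 := b.ext fun i => hs i (Finset.mem_univ _)
  exact LinearMap.congr_fun this f

theorem creation_sq (hγ : ∀ v, γ v * γ v = algebraMap ℂ _ (evenForm E v)) (e : E) :
    (γ ∘ₗ LinearMap.inr ℂ _ _) e * (γ ∘ₗ LinearMap.inr ℂ _ _) e = 0 := by
  have := hγ (0, e)
  simpa [evenForm] using this

/-- The map from the exterior algebra to a Clifford module determined by a vector. -/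
def fockMap (hγ : ∀ v, γ v * γ v = algebraMap ℂ _ (evenForm E v)) (x₀ : S) :
    ExteriorAlgebra ℂ E →ₗ[ℂ] S :=
  LinearMap.applyₗ x₀ ∘ₗ
    (ExteriorAlgebra.lift ℂ ⟨γ ∘ₗ LinearMap.inr ℂ _ _, creation_sq hγ⟩).toLinearMap

theorem fockMap_algebraMap (hγ : ∀ v, γ v * γ v = algebraMap ℂ _ (evenForm E v)) (x₀ : S) (r : ℂ) :
    fockMap hγ x₀ (algebraMap ℂ _ r) = r • x₀ := by
  simp [fockMap, Module.algebraMap_end_apply]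

theorem fockMap_ι_mul (hγ : ∀ v, γ v * γ v = algebraMap ℂ _ (evenForm E v)) (x₀ : S) (e : E)
    (x : ExteriorAlgebra ℂ E) :
    fockMap hγ x₀ (ExteriorAlgebra.ι ℂ e * x) = γ (0, e) (fockMap hγ x₀ x) := by
  simp [fockMap]

/-- Both sides pass through a wedge factor by the same Clifford relation, which reduces the claim to
scalars; there it is the vacuum condition on $x_0$. -/
theorem fockMap_contractLeft (hγ : ∀ v, γ v * γ v = algebraMap ℂ _ (evenForm E v)) {x₀ : S}
    (h₀ : ∀ f, γ (f, 0) x₀ = 0) (f : Module.Dual ℂ E) (x : ExteriorAlgebra ℂ E) :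
    fockMap hγ x₀ ((2 : ℂ) • CliffordAlgebra.contractLeft (Q := (0 : QuadraticForm ℂ E)) f x) =
      γ (f, 0) (fockMap hγ x₀ x) := by
  induction x using CliffordAlgebra.left_induction with
  | algebraMap r =>
    rw [CliffordAlgebra.contractLeft_algebraMap, smul_zero, map_zero]
    refine Eq.symm ((congrArg _ (fockMap_algebraMap hγ x₀ r)).trans ?_)
    rw [map_smul, h₀, smul_zero]
  | add x y hx hy => rw [map_add, smul_add, map_add, hx, hy, map_add, map_add]
  | ι_mul x e hx =>
    have h1 := fockMap_ι_mul hγ x₀ e x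
    change fockMap hγ x₀ (CliffordAlgebra.ι (0 : QuadraticForm ℂ E) e * x) = _ at h1
    have h2 := fockMap_ι_mul hγ x₀ e
      ((2 : ℂ) • CliffordAlgebra.contractLeft (Q := (0 : QuadraticForm ℂ E)) f x)
    change fockMap hγ x₀ (CliffordAlgebra.ι (0 : QuadraticForm ℂ E) e * _) = _ at h2
    rw [CliffordAlgebra.contractLeft_ι_mul, smul_sub, map_sub, h1, clifford_swap hγ, ← mul_smul_comm,
      h2, hx, ← mul_smul, map_smul]
    simp

theorem fockMap_wedgeContract (hγ : ∀ v, γ v * γ v = algebraMap ℂ _ (evenForm E v)) {x₀ : S}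
    (h₀ : ∀ f, γ (f, 0) x₀ = 0) (v : Module.Dual ℂ E × E) (x : ExteriorAlgebra ℂ E) :
    fockMap hγ x₀ (wedgeContract v x) = γ v (fockMap hγ x₀ x) := by
  rw [wedgeContract_apply, map_add, fockMap_contractLeft hγ h₀, fockMap_ι_mul, ← LinearMap.add_apply,
    ← map_add]
  simp

/-- The kernel is stable under contractions, so if nonzero it contains a nonzero vector killed by
all of them. Such a vector is a scalar, and scalars are sent to multiples of $x_0\neq0$. -/
theorem fockMap_injective [Module.Finite ℂ E]
    (hγ : ∀ v, γ v * γ v = algebraMap ℂ _ (evenForm E v)) {x₀ : S} (hx₀ : x₀ ≠ 0)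
    (h₀ : ∀ f, γ (f, 0) x₀ = 0) : Function.Injective (fockMap hγ x₀) := by
  rw [← LinearMap.ker_eq_bot]
  by_contra hK
  obtain ⟨x, hx, hne, hf⟩ := exists_vacuum (γ := wedgeContract) wedgeContract_sq _ hK
    fun f x hx => by
      rw [LinearMap.mem_ker] at hx ⊢
      rw [fockMap_wedgeContract hγ h₀, hx, map_zero]
  obtain ⟨c, rfl⟩ := exists_algebraMap_of_contractLeft_eq_zero (x := x) fun f => by
    have := hf f
    rw [wedgeContract_apply] at this
    simpa using this
  rw [LinearMap.mem_ker, fockMap_algebraMap] at hx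
  rcases smul_eq_zero.1 hx with rfl | h
  · simp at hne
  · exact hx₀ h

theorem fockMap_parity (hγ : ∀ v, γ v * γ v = algebraMap ℂ _ (evenForm E v)) {x₀ : S}
    {σ : Module.End ℂ S} (hσ : ∀ v x, σ (γ v x) = -γ v (σ x)) {ε : ℂ} (h₀ : σ x₀ = ε • x₀)
    (x : ExteriorAlgebra ℂ E) :
    σ (fockMap hγ x₀ x) = ε • fockMap hγ x₀ (parity x) := by
  induction x using CliffordAlgebra.left_induction with
  | algebraMap r =>
    have h1 : parity (algebraMap ℂ (ExteriorAlgebra ℂ E) r) = algebraMap ℂ _ r :=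
      AlgHom.commutes _ r
    refine (congrArg _ (fockMap_algebraMap hγ x₀ r)).trans ?_
    refine Eq.trans ?_ (congrArg (fun y => ε • fockMap hγ x₀ y) h1.symm)
    simp only [fockMap_algebraMap]
    rw [map_smul, h₀, smul_comm]
  | add x y hx hy => rw [map_add, map_add, hx, hy, map_add, map_add, smul_add]
  | ι_mul x e hx =>
    have h1 := fockMap_ι_mul hγ x₀ e x
    change fockMap hγ x₀ (CliffordAlgebra.ι (0 : QuadraticForm ℂ E) e * x) = _ at h1
    have h2 : parity (CliffordAlgebra.ι (0 : QuadraticForm ℂ E) e * x) =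
        -(ExteriorAlgebra.ι ℂ e * parity x) := by
      refine (map_mul (CliffordAlgebra.involute (Q := (0 : QuadraticForm ℂ E))) _ _).trans ?_
      rw [CliffordAlgebra.involute_ι, neg_mul]
      rfl
    rw [h1, h2, hσ, hx, map_neg, fockMap_ι_mul, map_smul, smul_neg]

/-- A Clifford module with parity, of the dimension of the exterior algebra, is isomorphic to it up
to the sign of the parity. -/
theorem exists_fock_equiv [Module.Finite ℂ E] [Nontrivial S]
    (hγ : ∀ v, γ v * γ v = algebraMap ℂ _ (evenForm E v)) {σ : Module.End ℂ S}
    (hσ₂ : ∀ x, σ (σ x) = x) (hσ : ∀ v x, σ (γ v x) = -γ v (σ x))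
    (hdim : Module.finrank ℂ S = 2 ^ Module.finrank ℂ E) :
    ∃ (J : ExteriorAlgebra ℂ E ≃ₗ[ℂ] S) (ε : ℂ), (ε = 1 ∨ ε = -1) ∧
      (∀ v x, J (wedgeContract v x) = γ v (J x)) ∧ ∀ x, J (parity x) = ε • σ (J x) := by
  obtain ⟨y, -, hy, hf⟩ := exists_vacuum hγ ⊤ top_ne_bot (by simp)
  obtain ⟨x₀, ε, hε, hx₀, h₀, hσ₀⟩ : ∃ (x₀ : S) (ε : ℂ), (ε = 1 ∨ ε = -1) ∧ x₀ ≠ 0 ∧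
      (∀ f, γ (f, 0) x₀ = 0) ∧ σ x₀ = ε • x₀ := by
    -- The parity preserves the space of vacuum vectors, so a vacuum that is an eigenvector of
    -- $\sigma$ can be extracted from $y$. Its eigenvalue is not under control, whence the sign
    -- $\varepsilon$.
    by_cases h : y + σ y = 0
    · exact ⟨y, -1, Or.inr rfl, hy, hf, by rw [eq_neg_of_add_eq_zero_right h]; simp⟩
    · refine ⟨y + σ y, 1, Or.inl rfl, h, fun f => ?_, ?_⟩
      · rw [map_add, hf, zero_add, ← neg_eq_zero, ← hσ, hf, map_zero]
      · rw [map_add, hσ₂, one_smul, add_comm]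
  have : Module.Finite ℂ S := Module.finite_of_finrank_pos (by rw [hdim]; positivity)
  let J := LinearEquiv.ofInjectiveOfFinrankEq (fockMap hγ x₀) (fockMap_injective hγ hx₀ h₀)
    (by rw [finrank_exteriorAlgebra, hdim])
  have hJ : ∀ x, J x = fockMap hγ x₀ x := fun x => rfl
  refine ⟨J, ε, hε, fun v x => ?_, fun x => ?_⟩
  · rw [hJ, hJ, fockMap_wedgeContract hγ h₀]
  · rw [hJ, hJ, fockMap_parity hγ hσ hσ₀, smul_smul]
    rcases hε with rfl | rfl <;> simp

/-- Isometries of the odd quadratic space act projectively on its spin representation. -/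
theorem exists_intertwiner [Module.Finite ℂ E] (τ : (oddForm E).IsometryEquiv (oddForm E)) :
    ∃ (A : ExteriorAlgebra ℂ E ≃ₗ[ℂ] ExteriorAlgebra ℂ E) (ε : ℂ), (ε = 1 ∨ ε = -1) ∧
      ∀ w x, A (wedgeContractParity w x) = ε • wedgeContractParity (τ w) (A x) := by
  let Γ : ((Module.Dual ℂ E × E) × ℂ) →ₗ[ℂ] Module.End ℂ (ExteriorAlgebra ℂ E) :=
    wedgeContractParity ∘ₗ τ.toLinearEquiv.toLinearMap
  have hΓ : ∀ w, Γ w * Γ w = algebraMap ℂ _ (oddForm E w) := fun w => by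
    refine (wedgeContractParity_sq (τ w)).trans ?_
    rw [τ.map_app]
  let γ := Γ ∘ₗ LinearMap.inl ℂ _ _
  have hγ : ∀ v, γ v * γ v = algebraMap ℂ _ (evenForm E v) := fun v => by
    refine (hΓ (v, 0)).trans ?_
    simp [oddForm]
  have hσ₂ : ∀ x, Γ (0, 1) (Γ (0, 1) x) = x := fun x => by
    refine (LinearMap.congr_fun (hΓ (0, 1)) x).trans ?_
    simp [oddForm]
  have hσ : ∀ v x, Γ (0, 1) (γ v x) = -γ v (Γ (0, 1) x) := fun v x => by
    have := LinearMap.congr_fun (CliffordAlgebra.mul_add_swap_eq_polar_of_forall_mul_self_eq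
      (Q := oddForm E) Γ hΓ (0, 1) (v, 0)) x
    rw [polar_oddForm] at this
    refine eq_neg_of_add_eq_zero_left (this.trans ?_)
    simp
  obtain ⟨J, ε, hε, hJ, hJp⟩ := exists_fock_equiv hγ hσ₂ hσ finrank_exteriorAlgebra
  have hΓw : ∀ (v : Module.Dual ℂ E × E) (t : ℂ) x, Γ (v, t) x = γ v x + t • Γ (0, 1) x := by
    intro v t x
    have : (v, t) = (v, 0) + t • ((0 : Module.Dual ℂ E × E), (1 : ℂ)) := by simp
    conv_lhs => rw [this, map_add, map_smul]
    rfl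
  rcases hε with rfl | rfl
  · refine ⟨J, 1, Or.inl rfl, fun w x => ?_⟩
    obtain ⟨v, t⟩ := w
    rw [wedgeContractParity_apply, map_add, map_smul, hJ, hJp, one_smul, one_smul]
    exact (hΓw v t _).symm
  -- Here $J$ has the right sign on $F\oplus E$ and the wrong one on $L$. Parity anticommutes with
  -- $F\oplus E$ and commutes with itself, so precomposing with it makes the sign $-1$ throughout.
  · let P : ExteriorAlgebra ℂ E ≃ₗ[ℂ] ExteriorAlgebra ℂ E :=
      LinearEquiv.ofInvolutive parity parity_parity
    refine ⟨P.trans J, -1, Or.inr rfl, fun w x => ?_⟩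
    obtain ⟨v, t⟩ := w
    have hA : ∀ y, (P.trans J) y = J (parity y) := fun y => rfl
    rw [hA, hA, wedgeContractParity_apply, map_add, map_smul, map_add, map_smul,
      parity_wedgeContract, map_neg, hJ, hJp (parity x), neg_smul, one_smul, neg_smul, one_smul]
    refine Eq.trans ?_ (congrArg _ (hΓw v t _).symm)
    rw [smul_neg, neg_add]

end Fock

/-! ### The spin representation in dimension seven -/

section Seven

/-- The standard seven-dimensional quadratic space. -/
abbrev O7 : Type := (Module.Dual ℂ (Fin 3 → ℂ) × (Fin 3 → ℂ)) × ℂ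

/-- The standard eight-dimensional spin representation. -/
abbrev D7 : Type := ExteriorAlgebra ℂ (Fin 3 → ℂ)

/-- The standard basis vectors of `E₃`. -/
def ve (i : Fin 3) : O7 := ((0, Pi.single i 1), 0)

/-- The standard basis vectors of `F₃`. -/
def vf (i : Fin 3) : O7 := ((LinearMap.proj i, 0), 0)

/-- The unit vector of `L`. -/
def vu : O7 := (0, 1)

/-- The Clifford action on the spin representation. -/
abbrev cl : O7 →ₗ[ℂ] Module.End ℂ D7 := wedgeContractParity

/-- Monomials of degree one. -/
def m1 (i : Fin 3) : D7 := ExteriorAlgebra.ι ℂ (Pi.single i 1)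

/-- Monomials of degree two. -/
def m2 (i : Fin 3) : D7 := m1 (i + 1) * m1 (i + 2)

/-- The monomial of degree three. -/
def m3 : D7 := m1 0 * (m1 1 * m1 2)

/-! ### Explicit Clifford calculus on the monomials of $\wedge^*E_3$ -/

theorem m1_sq (i : Fin 3) : m1 i * m1 i = 0 := ExteriorAlgebra.ι_sq_zero _

theorem m1_sq_mul (i : Fin 3) (x : D7) : m1 i * (m1 i * x) = 0 := by
  rw [← mul_assoc, m1_sq, zero_mul]

theorem m1_swap (i j : Fin 3) : m1 i * m1 j = -(m1 j * m1 i) :=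
  eq_neg_of_add_eq_zero_left (ExteriorAlgebra.ι_add_mul_swap _ _)

theorem m1_swap_mul (i j : Fin 3) (x : D7) : m1 i * (m1 j * x) = -(m1 j * (m1 i * x)) := by
  rw [← mul_assoc, m1_swap, neg_mul, mul_assoc]

theorem cl_ve (i : Fin 3) (x : D7) : cl (ve i) x = m1 i * x := by
  rw [ve, cl, wedgeContractParity_apply, wedgeContract_apply]
  simp [m1]

theorem cl_vf (i : Fin 3) (x : D7) : cl (vf i) x = (2 : ℂ) •
    CliffordAlgebra.contractLeft (Q := (0 : QuadraticForm ℂ (Fin 3 → ℂ))) (LinearMap.proj i) x := by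
  rw [vf, cl, wedgeContractParity_apply, wedgeContract_apply]
  simp

theorem cl_vu (x : D7) : cl vu x = parity x := by
  rw [vu, cl, wedgeContractParity_apply]
  simp

theorem cl_vf_one (i : Fin 3) : cl (vf i) 1 = 0 := by
  rw [cl_vf]
  exact (congrArg _ (CliffordAlgebra.contractLeft_one (Q := (0 : QuadraticForm ℂ (Fin 3 → ℂ))) _)).trans (smul_zero _)

theorem cl_vf_m1_mul (i j : Fin 3) (x : D7) :
    cl (vf i) (m1 j * x) = (if j = i then (2 : ℂ) • x else 0) - m1 j * cl (vf i) x := by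
  have h : CliffordAlgebra.contractLeft (Q := (0 : QuadraticForm ℂ (Fin 3 → ℂ)))
      (LinearMap.proj i) (m1 j * x) = (Pi.single j 1 : Fin 3 → ℂ) i • x -
      m1 j * CliffordAlgebra.contractLeft (Q := (0 : QuadraticForm ℂ (Fin 3 → ℂ)))
        (LinearMap.proj i) x :=
    CliffordAlgebra.contractLeft_ι_mul (Q := (0 : QuadraticForm ℂ (Fin 3 → ℂ)))
      (d := LinearMap.proj i) _ x
  rw [cl_vf, cl_vf, h, smul_sub, mul_smul_comm]
  congr 1
  simp only [Pi.single_apply, eq_comm (a := i)]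
  split_ifs <;> simp

theorem cl_vf_m1 (i j : Fin 3) :
    cl (vf i) (m1 j) = (if j = i then (2 : ℂ) • (1 : D7) else 0) := by
  have := cl_vf_m1_mul i j 1
  rwa [mul_one, cl_vf_one, mul_zero, sub_zero] at this

theorem cl_vu_one : cl vu 1 = 1 := by
  rw [cl_vu]
  exact map_one (CliffordAlgebra.involute (Q := (0 : QuadraticForm ℂ (Fin 3 → ℂ))))

theorem cl_vu_m1_mul (j : Fin 3) (x : D7) : cl vu (m1 j * x) = -(m1 j * cl vu x) := by
  have := parity_wedgeContract ((0 : Module.Dual ℂ (Fin 3 → ℂ)), (Pi.single j 1 : Fin 3 → ℂ)) x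
  rw [wedgeContract_apply, wedgeContract_apply] at this
  rw [cl_vu, cl_vu]
  simpa [m1] using this

theorem cl_vu_m1 (j : Fin 3) : cl vu (m1 j) = -m1 j := by
  have := cl_vu_m1_mul j 1
  rwa [mul_one, cl_vu_one, mul_one] at this

theorem cl_ve_m2 (i j : Fin 3) : cl (ve i) (m2 j) = if i = j then m3 else 0 := by
  rw [cl_ve, m2, m3]
  fin_cases i <;> fin_cases j <;>
    simp [m1_sq, m1_sq_mul, m1_swap 2 0, m1_swap 2 1, m1_swap_mul 2 0, m1_swap_mul 2 1,
      m1_swap_mul 1 0]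

theorem cl_ve_m3 (i : Fin 3) : cl (ve i) m3 = 0 := by
  rw [cl_ve, m3]
  fin_cases i <;>
    simp [m1_sq, m1_sq_mul, m1_swap_mul 2 0, m1_swap_mul 2 1, m1_swap_mul 1 0]

theorem cl_vf_m2_add_one (i : Fin 3) : cl (vf i) (m2 (i + 1)) = -(2 : ℂ) • m1 (i + 2) := by
  rw [m2, cl_vf_m1_mul, cl_vf_m1]
  fin_cases i <;> simp

theorem cl_vf_m3 (i : Fin 3) : cl (vf i) m3 = (2 : ℂ) • m2 i := by
  rw [m3, m2, cl_vf_m1_mul, cl_vf_m1_mul, cl_vf_m1]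
  fin_cases i <;> simp [m1_swap 2 0]

theorem cl_vu_m3 : cl vu m3 = -m3 := by
  rw [m3, cl_vu_m1_mul, cl_vu_m1_mul, cl_vu_m1]
  simp

/-- The span of the eight monomials contains 1 and is stable under wedging with each basis vector,
hence is everything. -/
theorem monomials_induction {K : Submodule ℂ D7} (h0 : 1 ∈ K) (h1 : ∀ i, m1 i ∈ K)
    (h2 : ∀ i, m2 i ∈ K) (h3 : m3 ∈ K) : K = ⊤ := by
  let L : Submodule ℂ D7 := Submodule.span ℂ ({1, m3} ∪ (Set.range m1 ∪ Set.range m2))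
  have hLK : L ≤ K := by
    refine Submodule.span_le.2 ?_
    rintro x ((rfl | rfl) | (⟨i, rfl⟩ | ⟨i, rfl⟩))
    exacts [h0, h3, h1 i, h2 i]
  have l0 : (1 : D7) ∈ L := Submodule.subset_span (Or.inl (Or.inl rfl))
  have l3 : m3 ∈ L := Submodule.subset_span (Or.inl (Or.inr rfl))
  have l1 : ∀ i, m1 i ∈ L := fun i => Submodule.subset_span (Or.inr (Or.inl ⟨i, rfl⟩))
  have l2 : ∀ i, m2 i ∈ L := fun i => Submodule.subset_span (Or.inr (Or.inr ⟨i, rfl⟩))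
  have l11 : ∀ i j, m1 i * m1 j ∈ L := by
    intro i j
    have h01 : m1 0 * m1 1 ∈ L := l2 2
    have h12 : m1 1 * m1 2 ∈ L := l2 0
    have h20 : m1 2 * m1 0 ∈ L := l2 1
    fin_cases i <;> fin_cases j
    exacts [(m1_sq 0).symm ▸ zero_mem L, h01, (m1_swap 0 2).symm ▸ neg_mem h20,
      (m1_swap 1 0).symm ▸ neg_mem h01, (m1_sq 1).symm ▸ zero_mem L, h12, h20,
      (m1_swap 2 1).symm ▸ neg_mem h12, (m1_sq 2).symm ▸ zero_mem L]
  have hmul : ∀ i, ∀ x ∈ L, m1 i * x ∈ L := by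
    intro i x hx
    induction hx using Submodule.span_induction with
    | mem x hx =>
      rcases hx with (rfl | rfl) | (⟨j, rfl⟩ | ⟨j, rfl⟩)
      · rw [mul_one]; exact l1 i
      · rw [← cl_ve, cl_ve_m3]; exact zero_mem _
      · exact l11 i j
      · rw [← cl_ve, cl_ve_m2]
        split_ifs
        exacts [l3, zero_mem _]
    | zero => rw [mul_zero]; exact zero_mem _
    | add x y _ _ hx hy => rw [mul_add]; exact add_mem hx hy
    | smul c x _ hx => rw [mul_smul_comm]; exact Submodule.smul_mem _ _ hx
  suffices hall : ∀ x, x ∈ L from eq_top_iff.2 fun x _ => hLK (hall x)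
  intro x
  induction x using CliffordAlgebra.left_induction with
  | algebraMap r =>
    rw [Algebra.algebraMap_eq_smul_one]
    exact Submodule.smul_mem _ _ l0
  | add x y hx hy => exact add_mem hx hy
  | ι_mul x e hx =>
    have : CliffordAlgebra.ι (0 : QuadraticForm ℂ (Fin 3 → ℂ)) e * x = ∑ i, e i • (m1 i * x) := by
      conv_lhs => rw [pi_eq_sum_univ' e, map_sum, Finset.sum_mul]
      refine Finset.sum_congr rfl fun i _ => ?_
      rw [map_smul, smul_mul_assoc]
      congr 3
    rw [this]
    exact sum_mem fun i _ => Submodule.smul_mem _ _ (hmul i x hx)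

/-- The standard generic spinor. -/
def chi : D7 := 1 + m3

theorem cl_ve_chi (i : Fin 3) : cl (ve i) chi = m1 i := by
  rw [chi, map_add, cl_ve_m3, add_zero, cl_ve, mul_one]

theorem cl_vf_chi (i : Fin 3) : cl (vf i) chi = (2 : ℂ) • m2 i := by
  rw [chi, map_add, cl_vf_m3, cl_vf_one, zero_add]

theorem cl_vu_chi : cl vu chi = 1 - m3 := by
  rw [chi, map_add, cl_vu_m3, cl_vu_one, sub_eq_add_neg]

theorem cl_ve_vu_chi (i : Fin 3) : cl (ve i) (cl vu chi) = m1 i := by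
  rw [cl_vu_chi, map_sub, cl_ve_m3, sub_zero, cl_ve, mul_one]

theorem cl_vf_vu_chi (i : Fin 3) : cl (vf i) (cl vu chi) = -(2 : ℂ) • m2 i := by
  rw [cl_vu_chi, map_sub, cl_vf_m3, cl_vf_one, zero_sub, neg_smul]

/-- Here $e_iu\chi=e_i$ and $f_{i+1}f_{i+2}\chi=-4e_i$, which fixes the coefficient $1/4$. Together
with `short_root_f_chi` this gives short root vectors of the $\mathfrak{g}_2$ annihilating $\chi$.
-/
theorem short_root_e_chi (i : Fin 3) :
    cl (ve i) (cl vu chi) + (1 / 4 : ℂ) • cl (vf (i + 1)) (cl (vf (i + 2)) chi) = 0 := by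
  have h := cl_vf_m2_add_one (i + 1)
  rw [show i + 1 + 1 = i + 2 by rw [add_assoc]; rfl,
    show i + 1 + 2 = i by rw [add_assoc]; exact add_zero i] at h
  rw [cl_ve_vu_chi, cl_vf_chi, map_smul, h]
  module

theorem short_root_f_chi (i : Fin 3) :
    cl (vf i) (cl vu chi) + (2 : ℂ) • cl (ve (i + 1)) (cl (ve (i + 2)) chi) = 0 := by
  rw [cl_vf_vu_chi, cl_ve_chi, cl_ve, ← m2]
  module

/-- This is the regularity of $\chi$ in dimension seven: $u^2$ and $e_0f_0$ give the degrees 0 and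
3, $e_iu$ gives degree 1 and $f_iu$ gives degree 2. -/
theorem span_cl_cl_chi :
    Submodule.span ℂ (Set.range fun p : O7 × O7 => cl p.1 (cl p.2 chi)) = ⊤ := by
  set K := Submodule.span ℂ (Set.range fun p : O7 × O7 => cl p.1 (cl p.2 chi))
  have hK : ∀ v w, cl v (cl w chi) ∈ K := fun v w => Submodule.subset_span ⟨(v, w), rfl⟩
  have hs : (1 : D7) + m3 ∈ K := by
    have := hK vu vu
    rw [cl_vu_chi, map_sub, cl_vu_one, cl_vu_m3] at this
    simpa using this
  have h3 : m3 ∈ K := by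
    have := Submodule.smul_mem K (1 / 2 : ℂ) (hK (ve 0) (vf 0))
    rwa [cl_vf_chi, map_smul, cl_ve_m2, if_pos rfl, smul_smul, show (1 / 2 : ℂ) * 2 = 1 by norm_num,
      one_smul] at this
  refine monomials_induction ?_ (fun i => ?_) (fun i => ?_) h3
  · simpa using sub_mem hs h3
  · rw [← cl_ve_vu_chi]; exact hK _ _
  · have := Submodule.smul_mem K (-1 / 2 : ℂ) (hK (vf i) vu)
    rwa [cl_vf_vu_chi, smul_smul, show (-1 / 2 : ℂ) * -2 = 1 by norm_num, one_smul] at this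

/-- The map `(c, w) ↦ c χ + w χ`. -/
def chiMap : ℂ × O7 →ₗ[ℂ] D7 :=
  (LinearMap.toSpanSingleton ℂ D7 chi).coprod (LinearMap.applyₗ chi ∘ₗ cl)

theorem chiMap_apply (c : ℂ) (w : O7) : chiMap (c, w) = c • chi + cl w chi := by
  simp [chiMap]

/-- The vectors $\chi=1+e_1e_2e_3$ and $u\chi=1-e_1e_2e_3$ give the extreme degrees, $e_i\chi$ and
$f_i\chi$ the middle ones. Since $1+7=8$ the map is bijective, which is what separates the mixed
bivectors from the others later. -/
theorem chiMap_surjective : Function.Surjective chiMap := by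
  rw [← LinearMap.range_eq_top]
  have hc : chi ∈ LinearMap.range chiMap := ⟨(1, 0), by simp [chiMap_apply]⟩
  have hw : ∀ w, cl w chi ∈ LinearMap.range chiMap := fun w => ⟨(0, w), by simp [chiMap_apply]⟩
  have hu := hw vu
  rw [cl_vu_chi] at hu
  refine monomials_induction ?_ (fun i => ?_) (fun i => ?_) ?_
  · have : (1 : D7) = (1 / 2 : ℂ) • (chi + (1 - m3)) := by rw [chi]; module
    rw [this]
    exact Submodule.smul_mem _ _ (add_mem hc hu)
  · rw [← cl_ve_chi]; exact hw _
  · have : m2 i = (1 / 2 : ℂ) • cl (vf i) chi := by rw [cl_vf_chi]; module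
    rw [this]
    exact Submodule.smul_mem _ _ (hw _)
  · have : (m3 : D7) = (1 / 2 : ℂ) • (chi - (1 - m3)) := by rw [chi]; module
    rw [this]
    exact Submodule.smul_mem _ _ (sub_mem hc hu)

theorem finrank_D7 : Module.finrank ℂ D7 = 8 := by
  rw [finrank_exteriorAlgebra]; simp

theorem finrank_O7 : Module.finrank ℂ O7 = 7 := by
  simp [Module.finrank_prod]

/-- The isomorphism `(c, w) ↦ c χ + w χ`. -/
def chiEquiv : (ℂ × O7) ≃ₗ[ℂ] D7 :=
  LinearEquiv.ofBijective chiMap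
    ⟨(LinearMap.injective_iff_surjective_of_finrank_eq_finrank (by
      rw [finrank_D7, Module.finrank_prod, finrank_O7]; simp)).2 chiMap_surjective,
      chiMap_surjective⟩

/-- The projection `c χ + w χ ↦ w`. -/
def chiProj : D7 →ₗ[ℂ] O7 := LinearMap.snd ℂ _ _ ∘ₗ chiEquiv.symm.toLinearMap

theorem chiProj_chi : chiProj chi = 0 := by
  have : chi = chiEquiv (1, 0) := by
    change _ = chiMap _
    simp [chiMap_apply]
  rw [chiProj, LinearMap.comp_apply, LinearEquiv.coe_coe]
  conv_lhs => rw [this]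
  rw [LinearEquiv.symm_apply_apply]
  rfl

theorem chiProj_cl (w : O7) : chiProj (cl w chi) = w := by
  have : cl w chi = chiEquiv (0, w) := by
    change _ = chiMap _
    simp [chiMap_apply]
  rw [chiProj, LinearMap.comp_apply, LinearEquiv.coe_coe, this, LinearEquiv.symm_apply_apply]
  rfl

theorem chi_ne_zero : chi ≠ 0 := by
  intro h
  have h2 := chiProj_cl vu
  rw [h, map_zero, map_zero] at h2
  simpa [vu] using congrArg Prod.snd h2

/-- The coefficient of a spinor on the scalars. -/
def coeffOne : D7 →ₗ[ℂ] ℂ := (ExteriorAlgebra.algebraMapInv (R := ℂ) (M := Fin 3 → ℂ)).toLinearMap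

theorem coeffOne_one : coeffOne 1 = 1 := map_one ExteriorAlgebra.algebraMapInv

theorem coeffOne_m1_mul (i : Fin 3) (x : D7) : coeffOne (m1 i * x) = 0 := by
  simp [coeffOne, ExteriorAlgebra.algebraMapInv, m1]

theorem cl_vf_ve (i : Fin 3) (x : D7) :
    cl (vf i) (cl (ve i) x) = (2 : ℂ) • x - m1 i * cl (vf i) x := by
  rw [cl_ve, cl_vf_m1_mul, if_pos rfl]

/-- Each $\tfrac12f_ie_i$ is the projection onto the monomials without $e_i$; the product of the
three keeps only the scalars. -/
theorem vacuumProjection :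
    (1 / 8 : ℂ) • ((cl (vf 0) * cl (ve 0)) * (cl (vf 1) * cl (ve 1)) * (cl (vf 2) * cl (ve 2))) =
      coeffOne.smulRight (1 : D7) := by
  have h := monomials_induction (K := LinearMap.eqLocus
    ((1 / 8 : ℂ) • ((cl (vf 0) * cl (ve 0)) * (cl (vf 1) * cl (ve 1)) * (cl (vf 2) * cl (ve 2))))
    (coeffOne.smulRight (1 : D7))) ?_ (fun i => ?_) (fun i => ?_) ?_
  · exact LinearMap.ext fun x => by
      have : x ∈ (⊤ : Submodule ℂ D7) := trivial
      rw [← h] at this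
      exact this
  · rw [LinearMap.mem_eqLocus]
    simp only [LinearMap.smul_apply, Module.End.mul_apply, LinearMap.smulRight_apply, coeffOne_one,
      cl_vf_ve, cl_vf_one, mul_zero, sub_zero, map_smul]
    module
  · rw [LinearMap.mem_eqLocus, LinearMap.smulRight_apply, show coeffOne (m1 i) = 0 by
      rw [← mul_one (m1 i), coeffOne_m1_mul]]
    simp only [LinearMap.smul_apply, Module.End.mul_apply]
    fin_cases i <;> simp [cl_vf_m1, cl_ve, cl_vf_m1_mul, m1_sq]
  · rw [LinearMap.mem_eqLocus, LinearMap.smulRight_apply, m2, coeffOne_m1_mul]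
    simp only [LinearMap.smul_apply, Module.End.mul_apply]
    fin_cases i <;> simp [cl_vf_m1, cl_ve, cl_vf_m1_mul, m1_sq, m1_swap 2 0,
      m1_swap_mul 2 0, m1_swap_mul 1 0, m1_swap_mul 2 1]
  · rw [LinearMap.mem_eqLocus, LinearMap.smulRight_apply, m3, coeffOne_m1_mul]
    simp only [LinearMap.smul_apply, Module.End.mul_apply]
    simp [cl_ve, m1_sq, m1_swap_mul 2 0, m1_swap_mul 2 1]

/-- An element $A$ of $B$ composed with the vacuum projection is the rank one operator with value
$A1$, so it suffices that even products applied to 1 reach every monomial. -/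
theorem rankOne_mem {B : Subalgebra ℂ (Module.End ℂ D7)} (hB : ∀ v w, cl v * cl w ∈ B) (y : D7) :
    coeffOne.smulRight y ∈ B := by
  have hp : coeffOne.smulRight (1 : D7) ∈ B := by
    rw [← vacuumProjection]
    exact B.smul_mem (B.mul_mem (B.mul_mem (hB _ _) (hB _ _)) (hB _ _)) _
  have hmul : ∀ A ∈ B, coeffOne.smulRight (A 1) ∈ B := by
    intro A hA
    convert B.mul_mem hA hp using 1
    ext x
    simp
  have h := monomials_induction (K := (Subalgebra.toSubmodule B).comap
    (LinearMap.smulRightₗ coeffOne : D7 →ₗ[ℂ] D7 →ₗ[ℂ] D7)) hp (fun i => ?_) (fun i => ?_) ?_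
  · have : y ∈ (⊤ : Submodule ℂ D7) := trivial
    rw [← h] at this
    exact this
  -- Since $u$ fixes 1, appending it turns an odd product into an even one with the same value at 1.
  · have := hmul _ (hB (ve i) vu)
    rwa [Module.End.mul_apply, cl_vu_one, cl_ve, mul_one] at this
  · have := hmul _ (hB (ve (i + 1)) (ve (i + 2)))
    rwa [Module.End.mul_apply, cl_ve, cl_ve, mul_one] at this
  · have := hmul _ (B.mul_mem (hB (ve 0) (ve 1)) (hB (ve 2) vu))
    rwa [Module.End.mul_apply, Module.End.mul_apply, Module.End.mul_apply, cl_vu_one, cl_ve, cl_ve,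
      cl_ve, mul_one] at this

/-- Endomorphisms of `Δ₇ ⊗ Δ₇` commuting with both even Clifford algebras are scalar. -/
theorem exists_eq_smul_of_commute {M : Module.End ℂ (D7 ⊗[ℂ] D7)}
    (h : ∀ v w t, M ((cl v * cl w).rTensor D7 t) = (cl v * cl w).rTensor D7 (M t))
    (h' : ∀ v w t, M ((cl v * cl w).lTensor D7 t) = (cl v * cl w).lTensor D7 (M t)) :
    ∃ c : ℂ, ∀ t, M t = c • t := by
  let C := Subalgebra.centralizer ℂ {M}
  have hC : ∀ A ∈ C, ∀ t, M (A t) = A (M t) := fun A hA t =>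
    LinearMap.congr_fun (Subalgebra.mem_centralizer_iff ℂ |>.1 hA M rfl) t
  have hr := fun y t => hC _ (rankOne_mem (B := C.comap (Module.End.rTensorAlgHom ℂ D7 D7))
    (fun v w => Subalgebra.mem_centralizer_iff ℂ |>.2 fun _ hM => by
      rw [Set.mem_singleton_iff] at hM
      subst hM
      exact LinearMap.ext (h v w)) y) t
  have hl := fun y t => hC _ (rankOne_mem (B := C.comap (Module.End.lTensorAlgHom ℂ D7 D7))
    (fun v w => Subalgebra.mem_centralizer_iff ℂ |>.2 fun _ hM => by
      rw [Set.mem_singleton_iff] at hM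
      subst hM
      exact LinearMap.ext (h' v w)) y) t
  refine ⟨TensorProduct.lid ℂ ℂ (TensorProduct.map coeffOne coeffOne (M (1 ⊗ₜ 1))), fun t => ?_⟩
  induction t using TensorProduct.induction_on with
  | zero => simp
  | add x y hx hy => rw [map_add, hx, hy, smul_add]
  | tmul x y =>
    -- Every decomposable tensor is obtained from $1\otimes1$ by rank one operators, which commute
    -- with $M$. So $M$ multiplies it by the coefficient of $M(1\otimes1)$ on $1\otimes1$.
    have h1 : x ⊗ₜ[ℂ] y = (coeffOne.smulRight x).rTensor D7
        ((coeffOne.smulRight y).lTensor D7 ((1 : D7) ⊗ₜ[ℂ] (1 : D7))) := by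
      simp [coeffOne_one]
    have h2 : ∀ s : D7 ⊗[ℂ] D7, (coeffOne.smulRight x).rTensor D7
        ((coeffOne.smulRight y).lTensor D7 s) =
        TensorProduct.lid ℂ ℂ (TensorProduct.map coeffOne coeffOne s) • x ⊗ₜ[ℂ] y := by
      intro s
      induction s using TensorProduct.induction_on with
      | zero => simp
      | add s s' hs hs' => simp only [map_add, hs, hs', add_smul]
      | tmul a b => simp [TensorProduct.smul_tmul', TensorProduct.tmul_smul, smul_smul, mul_comm]
    rw [← h2]
    conv_lhs => rw [h1]
    exact (hr x _).trans (congrArg _ (hl y _))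

end Seven

/-! ### The action of the spin group and of bivectors on vectors -/

section Vectors

variable {V : Type*} [AddCommGroup V] [Module ℂ V] {Q : QuadraticForm ℂ V}

open CliffordAlgebra

theorem cliffordι_injective : Function.Injective (ι Q) := by
  have : Invertible (2 : ℂ) := invertibleOfNonzero two_ne_zero
  intro v w h
  have key : ∀ u, equivExterior Q (ι Q u) = ExteriorAlgebra.ι ℂ u := fun u =>
    changeForm_ι changeForm.associated_neg_proof u
  have h2 := congrArg (equivExterior Q) h
  rw [key, key] at h2
  exact ExteriorAlgebra.ι_leftInverse.injective h2

theorem cliffordAlgebraMap_injective : Function.Injective (algebraMap ℂ (CliffordAlgebra Q)) := by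
  have : Invertible (2 : ℂ) := invertibleOfNonzero two_ne_zero
  have : Nontrivial (CliffordAlgebra Q) := (equivExterior Q).symm.injective.nontrivial
  exact (algebraMap ℂ (CliffordAlgebra Q)).injective

/-- The action of an element of the spin group on vectors. -/
def spinConjFun (g : spinGroup Q) (v : V) : V := (spinGroup_conj_mem g v).choose

theorem ι_spinConjFun (g : spinGroup Q) (v : V) :
    ι Q (spinConjFun g v) =
      (g : CliffordAlgebra Q) * ι Q v * ((g⁻¹ : spinGroup Q) : CliffordAlgebra Q) :=
  (spinGroup_conj_mem g v).choose_spec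

theorem spinConjFun_inv (g : spinGroup Q) (v : V) : spinConjFun g⁻¹ (spinConjFun g v) = v := by
  apply cliffordι_injective (Q := Q)
  rw [ι_spinConjFun, ι_spinConjFun, inv_inv, ← mul_assoc, ← mul_assoc, coe_inv_mul_coe, one_mul,
    mul_assoc, coe_inv_mul_coe, mul_one]

/-- The action of the spin group on vectors. -/
def spinConj (g : spinGroup Q) : V ≃ₗ[ℂ] V where
  toFun := spinConjFun g
  map_add' v w := cliffordι_injective (Q := Q) <| by
    simp only [map_add, ι_spinConjFun, mul_add, add_mul]
  map_smul' c v := cliffordι_injective (Q := Q) <| by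
    simp only [map_smul, ι_spinConjFun, mul_smul_comm, smul_mul_assoc, RingHom.id_apply]
  invFun := spinConjFun g⁻¹
  left_inv := spinConjFun_inv g
  right_inv v := by
    have := spinConjFun_inv g⁻¹ v
    rwa [inv_inv] at this

theorem ι_spinConj (g : spinGroup Q) (v : V) :
    ι Q (spinConj g v) = (g : CliffordAlgebra Q) * ι Q v * ((g⁻¹ : spinGroup Q) : CliffordAlgebra Q) :=
  ι_spinConjFun g v

theorem spinConj_mul (g h : spinGroup Q) (v : V) :
    spinConj (g * h) v = spinConj g (spinConj h v) := by
  apply cliffordι_injective (Q := Q)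
  rw [ι_spinConj, ι_spinConj, ι_spinConj, mul_inv_rev, Submonoid.coe_mul, Submonoid.coe_mul]
  noncomm_ring

theorem spinConj_inv_apply (g : spinGroup Q) (v : V) : spinConj g⁻¹ (spinConj g v) = v :=
  spinConjFun_inv g v

theorem quadraticForm_spinConj (g : spinGroup Q) (v : V) : Q (spinConj g v) = Q v := by
  apply cliffordAlgebraMap_injective (Q := Q)
  rw [← ι_sq_scalar, ι_spinConj]
  calc _ = (g : CliffordAlgebra Q) * ι Q v * (((g⁻¹ : spinGroup Q) : CliffordAlgebra Q) * g) *
        ι Q v * ((g⁻¹ : spinGroup Q) : CliffordAlgebra Q) := by noncomm_ring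
    _ = (g : CliffordAlgebra Q) * (ι Q v * ι Q v) * ((g⁻¹ : spinGroup Q) : CliffordAlgebra Q) := by
      rw [coe_inv_mul_coe]; noncomm_ring
    _ = _ := by
      rw [ι_sq_scalar, ← Algebra.commutes, mul_assoc, coe_mul_coe_inv, mul_one]

theorem spinTranslate_eq_map (g : spinGroup Q) (W : Submodule ℂ V) :
    spinTranslate g W = W.map (spinConj g : V →ₗ[ℂ] V) := by
  ext x
  constructor
  · rintro ⟨_, ⟨w, hw, rfl⟩, h⟩
    refine ⟨w, hw, cliffordι_injective (Q := Q) ?_⟩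
    rw [← h]
    exact ι_spinConj g w
  · rintro ⟨w, hw, rfl⟩
    exact ⟨_, ⟨w, hw, rfl⟩, (ι_spinConj g w).symm⟩

/-- The action on vectors of the bivector `x ∧ y`. -/
def bivec (Q : QuadraticForm ℂ V) (x y v : V) : V :=
  QuadraticMap.polar Q y v • x - QuadraticMap.polar Q x v • y

/-- This identifies `bivec` with the commutator in the Clifford algebra, so that statements about
the annihilator of a spinor become statements about vectors. -/
theorem ι_bivec (x y v : V) :
    ι Q (bivec Q x y v) = ι Q x * ι Q y * ι Q v - ι Q v * (ι Q x * ι Q y) := by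
  have h1 := ι_mul_ι_add_swap (Q := Q) y v
  have h2 := ι_mul_ι_add_swap (Q := Q) x v
  rw [Algebra.algebraMap_eq_smul_one] at h1 h2
  have e1 : ι Q x * (ι Q y * ι Q v + ι Q v * ι Q y) = QuadraticMap.polar Q y v • ι Q x := by
    rw [h1, mul_smul_comm, mul_one]
  have e2 : (ι Q x * ι Q v + ι Q v * ι Q x) * ι Q y = QuadraticMap.polar Q x v • ι Q y := by
    rw [h2, smul_mul_assoc, one_mul]
  rw [bivec, map_sub, map_smul, map_smul, ← e1, ← e2]
  noncomm_ring

/-- The element factors as $(Q(y)^{-1}y+x)\,y$, and the first factor has norm $Q(y)^{-1}$. -/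
theorem one_add_mem_spinGroup {x y : V} (hx : Q x = 0) (hxy : QuadraticMap.polar Q x y = 0)
    (hy : Q y ≠ 0) : 1 + ι Q x * ι Q y ∈ spinGroup Q := by
  have h : ι Q ((Q y)⁻¹ • y + x) * ι Q y = 1 + ι Q x * ι Q y := by
    rw [map_add, add_mul, map_smul, smul_mul_assoc, ι_sq_scalar, Algebra.algebraMap_eq_smul_one,
      smul_smul, inv_mul_cancel₀ hy, one_smul]
  rw [← h]
  refine ι_mul_ι_mem_spinGroup ?_
  rw [QuadraticMap.map_add Q, QuadraticMap.map_smul, QuadraticMap.polar_smul_left,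
    QuadraticMap.polar_comm, hxy, hx]
  have : (Q y)⁻¹ * Q y = 1 := inv_mul_cancel₀ hy
  simp only [smul_eq_mul, add_zero]
  linear_combination ((Q y)⁻¹ * Q y + 1) * this

/-- Two commuting orthogonal nilpotent bivectors `x₁ ∧ y₁` and `x₂ ∧ y₂`. -/
structure NilPair (Q : QuadraticForm ℂ V) (x₁ y₁ x₂ y₂ : V) : Prop where
  hx₁ : Q x₁ = 0
  hy₁ : Q y₁ ≠ 0
  hx₂ : Q x₂ = 0
  hy₂ : Q y₂ = 0
  h₁ : QuadraticMap.polar Q x₁ y₁ = 0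
  h₂ : QuadraticMap.polar Q x₂ y₂ = 0
  hxx : QuadraticMap.polar Q x₁ x₂ = 0
  hxy : QuadraticMap.polar Q x₁ y₂ = 0
  hyx : QuadraticMap.polar Q y₁ x₂ = 0
  hyy : QuadraticMap.polar Q y₁ y₂ = 0

namespace NilPair

variable {x₁ y₁ x₂ y₂ : V} (h : NilPair Q x₁ y₁ x₂ y₂)
include h

theorem exp_mem : (1 + ι Q x₁ * ι Q y₁) * (1 + ι Q x₂ * ι Q y₂) ∈ spinGroup Q := by
  refine mul_mem (one_add_mem_spinGroup h.hx₁ h.h₁ h.hy₁) ?_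
  -- Since $y_2$ is isotropic, the anisotropic $y_1$ is borrowed:
  -- $1+x_2y_2=(1+x_2(y_1+y_2))(1-x_2y_1)$, whose quadratic term vanishes because $x_2^2=0$ and
  -- $x_2$ anticommutes with $y_1+y_2$.
  have hq : Q (y₁ + y₂) ≠ 0 := by
    rw [QuadraticMap.map_add Q, h.hy₂, h.hyy]
    simpa using h.hy₁
  have e1 := one_add_mem_spinGroup (Q := Q) (x := x₂) (y := y₁ + y₂) h.hx₂
    (by rw [QuadraticMap.polar_add_right, h.h₂, QuadraticMap.polar_comm, h.hyx, add_zero]) hq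
  have e2 := one_add_mem_spinGroup (Q := Q) (x := -x₂) (y := y₁) (by simp [h.hx₂])
    (by rw [QuadraticMap.polar_neg_left, QuadraticMap.polar_comm, h.hyx, neg_zero]) h.hy₁
  have hxx : ι Q x₂ * (ι Q y₁ + ι Q y₂) * (ι Q x₂ * ι Q y₁) = 0 := by
    have a1 : (ι Q y₁ + ι Q y₂) * ι Q x₂ = -(ι Q x₂ * (ι Q y₁ + ι Q y₂)) := by
      rw [← map_add]
      refine eq_neg_of_add_eq_zero_left ?_
      rw [ι_mul_ι_add_swap, QuadraticMap.polar_add_left, h.hyx, QuadraticMap.polar_comm, h.h₂]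
      simp
    calc _ = ι Q x₂ * ((ι Q y₁ + ι Q y₂) * ι Q x₂) * ι Q y₁ := by noncomm_ring
      _ = -((ι Q x₂ * ι Q x₂) * (ι Q y₁ + ι Q y₂) * ι Q y₁) := by rw [a1]; noncomm_ring
      _ = 0 := by rw [ι_sq_scalar, h.hx₂]; simp
  have e3 := mul_mem e1 e2
  convert e3 using 1
  rw [map_add, map_neg]
  calc _ = 1 + ι Q x₂ * ι Q y₂ - ι Q x₂ * (ι Q y₁ + ι Q y₂) * (ι Q x₂ * ι Q y₁) := by
        rw [hxx, sub_zero]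
    _ = _ := by noncomm_ring

theorem sq_left : ι Q x₁ * ι Q y₁ * (ι Q x₁ * ι Q y₁) = 0 := by
  have a1 : ι Q y₁ * ι Q x₁ = -(ι Q x₁ * ι Q y₁) :=
    eq_neg_of_add_eq_zero_right (by rw [ι_mul_ι_add_swap, h.h₁, map_zero])
  calc _ = ι Q x₁ * (ι Q y₁ * ι Q x₁) * ι Q y₁ := by noncomm_ring
    _ = -((ι Q x₁ * ι Q x₁) * ι Q y₁ * ι Q y₁) := by rw [a1]; noncomm_ring
    _ = 0 := by rw [ι_sq_scalar, h.hx₁]; simp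

theorem sq_right : ι Q x₂ * ι Q y₂ * (ι Q x₂ * ι Q y₂) = 0 := by
  have a1 : ι Q y₂ * ι Q x₂ = -(ι Q x₂ * ι Q y₂) :=
    eq_neg_of_add_eq_zero_right (by rw [ι_mul_ι_add_swap, h.h₂, map_zero])
  calc _ = ι Q x₂ * (ι Q y₂ * ι Q x₂) * ι Q y₂ := by noncomm_ring
    _ = -((ι Q x₂ * ι Q x₂) * ι Q y₂ * ι Q y₂) := by rw [a1]; noncomm_ring
    _ = 0 := by rw [ι_sq_scalar, h.hx₂]; simp

theorem swap_x₁ : ι Q x₁ * (ι Q x₂ * ι Q y₂) = ι Q x₂ * ι Q y₂ * ι Q x₁ := by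
  have a1 : ι Q x₁ * ι Q x₂ = -(ι Q x₂ * ι Q x₁) :=
    eq_neg_of_add_eq_zero_left (by rw [ι_mul_ι_add_swap, h.hxx, map_zero])
  have a2 : ι Q x₁ * ι Q y₂ = -(ι Q y₂ * ι Q x₁) :=
    eq_neg_of_add_eq_zero_left (by rw [ι_mul_ι_add_swap, h.hxy, map_zero])
  rw [← mul_assoc, a1, neg_mul, mul_assoc, a2, mul_neg, neg_neg, mul_assoc]

theorem swap_y₁ : ι Q y₁ * (ι Q x₂ * ι Q y₂) = ι Q x₂ * ι Q y₂ * ι Q y₁ := by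
  have a1 : ι Q y₁ * ι Q x₂ = -(ι Q x₂ * ι Q y₁) :=
    eq_neg_of_add_eq_zero_left (by rw [ι_mul_ι_add_swap, h.hyx, map_zero])
  have a2 : ι Q y₁ * ι Q y₂ = -(ι Q y₂ * ι Q y₁) :=
    eq_neg_of_add_eq_zero_left (by rw [ι_mul_ι_add_swap, h.hyy, map_zero])
  rw [← mul_assoc, a1, neg_mul, mul_assoc, a2, mul_neg, neg_neg, mul_assoc]

theorem comm : ι Q x₁ * ι Q y₁ * (ι Q x₂ * ι Q y₂) = ι Q x₂ * ι Q y₂ * (ι Q x₁ * ι Q y₁) := by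
  rw [mul_assoc, h.swap_y₁, ← mul_assoc, h.swap_x₁, mul_assoc]

/-- The sandwich is a multiple of $x_1$, which commutes with $x_2y_2$; this makes the cubic terms of
the conjugation cancel in `bivec_mem`. -/
theorem sandwich_left (v : V) : ι Q x₁ * ι Q y₁ * ι Q v * (ι Q x₁ * ι Q y₁) =
    (QuadraticMap.polar Q v x₁ * Q y₁) • ι Q x₁ := by
  have a1 : ι Q y₁ * ι Q x₁ = -(ι Q x₁ * ι Q y₁) :=
    eq_neg_of_add_eq_zero_right (by rw [ι_mul_ι_add_swap, h.h₁, map_zero])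
  have a2 := ι_mul_ι_comm (Q := Q) v x₁
  calc _ = ι Q x₁ * ι Q y₁ * (ι Q v * ι Q x₁) * ι Q y₁ := by noncomm_ring
    _ = QuadraticMap.polar Q v x₁ • (ι Q x₁ * (ι Q y₁ * ι Q y₁)) -
        ι Q x₁ * (ι Q y₁ * ι Q x₁) * (ι Q v * ι Q y₁) := by
      rw [a2, Algebra.algebraMap_eq_smul_one, mul_sub, sub_mul]
      simp only [mul_smul_comm, smul_mul_assoc, mul_one, mul_assoc]
    _ = QuadraticMap.polar Q v x₁ • (ι Q x₁ * (ι Q y₁ * ι Q y₁)) +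
        (ι Q x₁ * ι Q x₁) * ι Q y₁ * (ι Q v * ι Q y₁) := by
      rw [a1]; noncomm_ring
    _ = _ := by
      rw [ι_sq_scalar, ι_sq_scalar, h.hx₁, map_zero, zero_mul, zero_mul, add_zero,
        Algebra.algebraMap_eq_smul_one, mul_smul_comm, mul_one, smul_smul]

theorem sandwich_right (v : V) : ι Q x₂ * ι Q y₂ * ι Q v * (ι Q x₂ * ι Q y₂) = 0 := by
  have a1 : ι Q y₂ * ι Q x₂ = -(ι Q x₂ * ι Q y₂) :=
    eq_neg_of_add_eq_zero_right (by rw [ι_mul_ι_add_swap, h.h₂, map_zero])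
  have a2 := ι_mul_ι_comm (Q := Q) v x₂
  calc _ = ι Q x₂ * ι Q y₂ * (ι Q v * ι Q x₂) * ι Q y₂ := by noncomm_ring
    _ = QuadraticMap.polar Q v x₂ • (ι Q x₂ * (ι Q y₂ * ι Q y₂)) -
        ι Q x₂ * (ι Q y₂ * ι Q x₂) * (ι Q v * ι Q y₂) := by
      rw [a2, Algebra.algebraMap_eq_smul_one, mul_sub, sub_mul]
      simp only [mul_smul_comm, smul_mul_assoc, mul_one, mul_assoc]
    _ = QuadraticMap.polar Q v x₂ • (ι Q x₂ * (ι Q y₂ * ι Q y₂)) +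
        (ι Q x₂ * ι Q x₂) * ι Q y₂ * (ι Q v * ι Q y₂) := by
      rw [a1]; noncomm_ring
    _ = _ := by
      rw [ι_sq_scalar, ι_sq_scalar, h.hx₂, h.hy₂]; simp

/-- The unipotent element of the spin group with logarithm `x₁ ∧ y₁ + x₂ ∧ y₂`. -/
def exp : spinGroup Q := ⟨_, h.exp_mem⟩

theorem exp_sq : ((h.exp * h.exp : spinGroup Q) : CliffordAlgebra Q) =
    1 + 2 * (ι Q x₁ * ι Q y₁ + ι Q x₂ * ι Q y₂) +
      4 * (ι Q x₁ * ι Q y₁ * (ι Q x₂ * ι Q y₂)) := by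
  change (1 + ι Q x₁ * ι Q y₁) * (1 + ι Q x₂ * ι Q y₂) *
    ((1 + ι Q x₁ * ι Q y₁) * (1 + ι Q x₂ * ι Q y₂)) = _
  have h1 := h.sq_left
  have h2 := h.sq_right
  have h3 := h.comm
  generalize ι Q x₁ * ι Q y₁ = a at h1 h3 ⊢
  generalize ι Q x₂ * ι Q y₂ = b at h2 h3 ⊢
  calc _ = (1 + a) * ((1 + b) * (1 + a)) * (1 + b) := by noncomm_ring
    _ = (1 + a) * ((1 + a) * (1 + b)) * (1 + b) := by
      congr 2
      calc _ = 1 + a + b + b * a := by noncomm_ring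
        _ = _ := by rw [← h3]; noncomm_ring
    _ = (1 + 2 * a + a * a) * (1 + 2 * b + b * b) := by noncomm_ring
    _ = _ := by rw [h1, h2]; noncomm_ring

theorem exp_sq_inv : (((h.exp * h.exp)⁻¹ : spinGroup Q) : CliffordAlgebra Q) =
    1 - 2 * (ι Q x₁ * ι Q y₁ + ι Q x₂ * ι Q y₂) +
      4 * (ι Q x₁ * ι Q y₁ * (ι Q x₂ * ι Q y₂)) := by
  have h4 := coe_inv_mul_coe (h.exp * h.exp)
  have h5 : ((h.exp * h.exp : spinGroup Q) : CliffordAlgebra Q) *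
      (1 - 2 * (ι Q x₁ * ι Q y₁ + ι Q x₂ * ι Q y₂) +
      4 * (ι Q x₁ * ι Q y₁ * (ι Q x₂ * ι Q y₂))) = 1 := by
    rw [h.exp_sq]
    have h1 := h.sq_left
    have h2 := h.sq_right
    have h3 := h.comm
    generalize ι Q x₁ * ι Q y₁ = a at h1 h3 ⊢
    generalize ι Q x₂ * ι Q y₂ = b at h2 h3 ⊢
    have e1 : a * (a * b) = 0 := by rw [← mul_assoc, h1, zero_mul]
    have e2 : b * (a * b) = 0 := by rw [h3, ← mul_assoc, h2, zero_mul]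
    have e3 : a * b * a = 0 := by rw [h3, mul_assoc, h1, mul_zero]
    have e4 : a * b * b = 0 := by rw [mul_assoc, h2, mul_zero]
    calc _ = 1 - 4 * (a * a) - 4 * (b * b) + 4 * (a * b) - 4 * (b * a) + 8 * (a * (a * b)) +
          8 * (b * (a * b)) - 8 * (a * b * a) - 8 * (a * b * b) + 16 * (a * b * a * b) := by
          noncomm_ring
      _ = 1 := by rw [e1, e2, e3, e4, h1, h2, h3]; noncomm_ring
  calc _ = (((h.exp * h.exp)⁻¹ : spinGroup Q) : CliffordAlgebra Q) *
        (((h.exp * h.exp : spinGroup Q) : CliffordAlgebra Q) *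
      (1 - 2 * (ι Q x₁ * ι Q y₁ + ι Q x₂ * ι Q y₂) +
      4 * (ι Q x₁ * ι Q y₁ * (ι Q x₂ * ι Q y₂)))) := by rw [h5, mul_one]
    _ = _ := by rw [← mul_assoc, h4, one_mul]

/-- A subspace preserved by the unipotent element is preserved by its logarithm. -/
theorem bivec_mem {X : Submodule ℂ V}
    (hX : X.map (spinConj (h.exp * h.exp) : V →ₗ[ℂ] V) = X) {v : V} (hv : v ∈ X) :
    bivec Q x₁ y₁ v + bivec Q x₂ y₂ v ∈ X := by
  have m1 : spinConj (h.exp * h.exp) v ∈ X := by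
    rw [← hX]; exact ⟨v, hv, rfl⟩
  have m2 : spinConj (h.exp * h.exp)⁻¹ v ∈ X := by
    rw [← hX] at hv
    obtain ⟨w, hw, rfl⟩ := hv
    have := spinConj_inv_apply (h.exp * h.exp) w
    rwa [LinearEquiv.coe_coe, this]
  -- With $N=x_1y_1+x_2y_2$ these are the conjugations by $e^{2N}$ and $e^{-2N}$. In the difference
  -- the terms of even order drop out, the linear term is $4[N,v]$, and the cubic terms cancel or
  -- vanish by the sandwich identities.
  have key : spinConj (h.exp * h.exp) v - spinConj (h.exp * h.exp)⁻¹ v =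
      (4 : ℂ) • (bivec Q x₁ y₁ v + bivec Q x₂ y₂ v) := by
    apply cliffordι_injective (Q := Q)
    have hs : ∀ z : CliffordAlgebra Q, (4 : ℂ) • z = 4 * z := fun z => by
      rw [Algebra.smul_def, map_ofNat]
    rw [map_sub, ι_spinConj, ι_spinConj, inv_inv, h.exp_sq_inv, h.exp_sq, map_smul, map_add,
      ι_bivec, ι_bivec, hs]
    have h3 := h.comm
    have h4 : ι Q x₁ * ι Q y₁ * ι Q v * (ι Q x₁ * ι Q y₁ * (ι Q x₂ * ι Q y₂)) =
        ι Q x₁ * ι Q y₁ * (ι Q x₂ * ι Q y₂) * ι Q v * (ι Q x₁ * ι Q y₁) := by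
      calc _ = ι Q x₁ * ι Q y₁ * ι Q v * (ι Q x₁ * ι Q y₁) * (ι Q x₂ * ι Q y₂) := by noncomm_ring
        _ = ι Q x₂ * ι Q y₂ * (ι Q x₁ * ι Q y₁ * ι Q v * (ι Q x₁ * ι Q y₁)) := by
          rw [h.sandwich_left, smul_mul_assoc, h.swap_x₁, mul_smul_comm]
        _ = _ := by rw [h3]; noncomm_ring
    have h5 : ι Q x₂ * ι Q y₂ * ι Q v * (ι Q x₁ * ι Q y₁ * (ι Q x₂ * ι Q y₂)) = 0 := by
      rw [h3, ← mul_assoc, h.sandwich_right, zero_mul]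
    have h6 : ι Q x₁ * ι Q y₁ * (ι Q x₂ * ι Q y₂) * ι Q v * (ι Q x₂ * ι Q y₂) = 0 := by
      rw [mul_assoc (ι Q x₁ * ι Q y₁), mul_assoc (ι Q x₁ * ι Q y₁), h.sandwich_right, mul_zero]
    generalize ι Q x₁ * ι Q y₁ = a at h3 h4 h5 h6 ⊢
    generalize ι Q x₂ * ι Q y₂ = b at h3 h4 h5 h6 ⊢
    generalize ι Q v = w at h4 h5 h6 ⊢
    calc _ = 4 * (a * w - w * a + (b * w - w * b)) + 16 * (a * w * (a * b)) +
          16 * (b * w * (a * b)) - 16 * (a * b * w * a) - 16 * (a * b * w * b) := by noncomm_ring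
      _ = _ := by rw [h4, h5, h6]; noncomm_ring
  have m3 := X.smul_mem (1 / 4 : ℂ) (sub_mem m1 m2)
  rwa [key, smul_smul, show (1 / 4 : ℂ) * 4 = 1 by norm_num, one_smul] at m3

end NilPair

end Vectors

/-! ### Tensor product models of the half-spin representation -/

section Model

open CliffordAlgebra

variable {E : Type*} [AddCommGroup E] [Module ℂ E]

/-- The action of the even Clifford algebra on the half-spin representation. -/
def evenAction : even (evenForm E) →ₐ[ℂ] Module.End ℂ (evenExterior E) where
  toFun a := (evenCliffordAction E a).restrict
    fun _ hx => evenCliffordAction_mem (involute_eq_of_mem_even a.2) hx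
  map_one' := by ext x; simp
  map_mul' a b := by ext x; simp
  map_zero' := by ext x; simp
  map_add' a b := by ext x; simp
  commutes' r := by
    ext x
    simp [Module.algebraMap_end_apply]

theorem halfSpin_eq (g : spinGroup (evenForm E)) : halfSpin E g = evenAction (spinToEven g) := rfl

/-- The product of two vectors in the even Clifford algebra. -/
abbrev pr (v w : Module.Dual ℂ E × E) : even (evenForm E) := (even.ι (evenForm E)).bilin v w

/-- The orthogonal sum of two copies of the standard seven-dimensional quadratic space. -/
abbrev form77 : QuadraticForm ℂ (O7 × O7) :=
  (oddForm (Fin 3 → ℂ)).prod (oddForm (Fin 3 → ℂ))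

/-- The action on `Δ₇ ⊗ Δ₇` of a product of two vectors of the orthogonal sum. -/
def pairAction (ε : ℂ) (v w : O7 × O7) : Module.End ℂ (D7 ⊗[ℂ] D7) :=
  (cl v.1 * cl w.1).rTensor D7 + (cl v.2 * cl w.2).lTensor D7 +
    ε • (TensorProduct.map (cl v.1) (cl w.2) - TensorProduct.map (cl w.1) (cl v.2))

variable (E) in
/-- An orthogonal decomposition into two copies of the standard seven-dimensional space, with an
isomorphism of the half-spin representation with the tensor product of spin representations. -/
structure Model where
  /-- The isometry with the orthogonal sum. -/
  σ : form77.IsometryEquiv (evenForm E)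
  /-- The sign with which mixed products act. -/
  ε : ℂ
  hε : ε ≠ 0
  /-- The isomorphism of spin representations. -/
  Φ : evenExterior E ≃ₗ[ℂ] D7 ⊗[ℂ] D7
  map_pr : ∀ v w x, Φ (evenAction (pr (σ v) (σ w)) x) = pairAction ε v w (Φ x)

namespace Model

variable (m : Model E)

theorem polar_σ (v w : O7 × O7) :
    QuadraticMap.polar (evenForm E) (m.σ v) (m.σ w) =
      QuadraticMap.polar (oddForm _) v.1 w.1 + QuadraticMap.polar (oddForm _) v.2 w.2 := by
  rw [← QuadraticMap.polar_prod]
  simp only [QuadraticMap.polar, ← map_add, m.σ.map_app]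

/-- Exchanging the two factors. -/
def swap : Model E where
  σ := (QuadraticMap.IsometryEquiv.prodComm _ _).trans m.σ
  -- Vectors of different summands anticommute, so exchanging the summands changes the sign of a
  -- mixed product.
  ε := -m.ε
  hε := neg_ne_zero.2 m.hε
  Φ := m.Φ.trans (TensorProduct.comm ℂ D7 D7)
  map_pr v w x := by
    have := m.map_pr v.swap w.swap x
    refine (congrArg (TensorProduct.comm ℂ D7 D7) this).trans ?_
    change _ = pairAction _ v w (TensorProduct.comm ℂ D7 D7 (m.Φ x))
    generalize m.Φ x = t
    induction t using TensorProduct.induction_on with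
    | zero => simp
    | add a b ha hb => simp only [map_add, ha, hb]
    | tmul a b =>
      simp only [pairAction, LinearMap.add_apply, LinearMap.smul_apply, LinearMap.sub_apply,
        LinearMap.rTensor_tmul, LinearMap.lTensor_tmul, TensorProduct.map_tmul, map_add, map_smul,
        map_sub, TensorProduct.comm_tmul, Prod.fst_swap, Prod.snd_swap]
      module

/-- Transport of a model by an element of the spin group. -/
def translate (g : spinGroup (evenForm E)) : Model E where
  σ := m.σ.trans ⟨spinConj g, quadraticForm_spinConj g⟩
  ε := m.ε
  hε := m.hε
  Φ := (LinearEquiv.ofBijective (halfSpin E g⁻¹)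
    ⟨Function.LeftInverse.injective (g := halfSpin E g) (fun x => by simp),
      Function.RightInverse.surjective (g := halfSpin E g) (fun x => by simp)⟩).trans m.Φ
  map_pr v w x := by
    refine Eq.trans (congrArg m.Φ ?_) (m.map_pr v w (halfSpin E g⁻¹ x))
    change halfSpin E g⁻¹ _ = _
    rw [halfSpin_eq, ← Module.End.mul_apply, ← map_mul, ← Module.End.mul_apply, ← map_mul]
    congr 2
    apply Subtype.ext
    change ((g⁻¹ : spinGroup (evenForm E)) : CliffordAlgebra (evenForm E)) *
      (ι _ (spinConj g (m.σ v)) * ι _ (spinConj g (m.σ w))) = ι _ (m.σ v) * ι _ (m.σ w) *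
        ((g⁻¹ : spinGroup (evenForm E)) : CliffordAlgebra (evenForm E))
    rw [ι_spinConj, ι_spinConj]
    have h := coe_inv_mul_coe g
    generalize (g : CliffordAlgebra (evenForm E)) = a at h ⊢
    generalize ((g⁻¹ : spinGroup (evenForm E)) : CliffordAlgebra (evenForm E)) = b at h ⊢
    generalize ι (evenForm E) (m.σ v) = v
    generalize ι (evenForm E) (m.σ w) = w
    calc _ = b * a * v * (b * a) * w * b := by noncomm_ring
      _ = _ := by rw [h]; noncomm_ring

/-- The first summand of the orthogonal decomposition. -/
def left : Submodule ℂ (Module.Dual ℂ E × E) :=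
  LinearMap.range (m.σ.toLinearEquiv.toLinearMap ∘ₗ LinearMap.inl ℂ O7 O7)

theorem σ_mem_left (w : O7) : m.σ (w, 0) ∈ m.left := ⟨w, rfl⟩

theorem σ_mem_swap_left (w : O7) : m.σ (0, w) ∈ m.swap.left := ⟨w, rfl⟩

theorem swap_swap_left : m.swap.swap.left = m.left := rfl

theorem finrank_left : Module.finrank ℂ m.left = 7 := by
  rw [left, LinearMap.finrank_range_of_inj, finrank_O7]
  exact m.σ.toLinearEquiv.injective.comp LinearMap.inl_injective

theorem isCompl_left : IsCompl m.left m.swap.left := by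
  constructor
  · rw [Submodule.disjoint_def]
    rintro _ ⟨w, rfl⟩ ⟨w', h⟩
    have h' : ((0 : O7), w') = (w, 0) := m.σ.toLinearEquiv.injective h
    obtain ⟨rfl, -⟩ := Prod.ext_iff.1 h'
    exact (m.σ.toLinearEquiv.toLinearMap ∘ₗ LinearMap.inl ℂ O7 O7).map_zero
  · rw [codisjoint_iff, eq_top_iff]
    intro x _
    obtain ⟨⟨w, w'⟩, rfl⟩ := m.σ.toLinearEquiv.surjective x
    have : ((w, w') : O7 × O7) = (w, 0) + (0, w') := by simp
    rw [this, map_add]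
    exact Submodule.add_mem_sup (m.σ_mem_left w) (m.σ_mem_swap_left w')

theorem isOrthogonalDecomposition :
    IsOrthogonalDecomposition (evenForm E) m.left m.swap.left where
  finrank_left := m.finrank_left
  finrank_right := m.swap.finrank_left
  isCompl := m.isCompl_left
  orthogonal := by
    rintro _ ⟨w, rfl⟩ _ ⟨w', rfl⟩
    refine (m.polar_σ (w, 0) (0, w')).trans ?_
    simp

/-- The isometry of the first summand with the standard space. -/
def leftIsometry : ((evenForm E).restrict m.left).IsometryEquiv (oddForm (Fin 3 → ℂ)) :=
  QuadraticMap.IsometryEquiv.symm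
    ⟨LinearEquiv.ofInjective (m.σ.toLinearEquiv.toLinearMap ∘ₗ LinearMap.inl ℂ O7 O7)
      (m.σ.toLinearEquiv.injective.comp LinearMap.inl_injective), fun w => by
        refine (m.σ.map_app (w, 0)).trans ?_
        simp⟩

theorem leftIsometry_symm_apply (w : O7) :
    ((m.leftIsometry.symm w : m.left) : Module.Dual ℂ E × E) = m.σ (w, 0) := rfl

theorem σ_leftIsometry (v : m.left) : m.σ (m.leftIsometry v, 0) = v := by
  rw [← m.leftIsometry_symm_apply, QuadraticMap.IsometryEquiv.symm_apply_apply]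

end Model

/-- A model in which a given spinor is the standard decomposable spinor. -/
def Model.IsAdapted (m : Model E) (ψ : evenExterior E) : Prop := m.Φ ψ = chi ⊗ₜ[ℂ] chi

theorem Model.IsAdapted.swap {m : Model E} {ψ : evenExterior E} (h : m.IsAdapted ψ) :
    m.swap.IsAdapted ψ := by
  change TensorProduct.comm ℂ D7 D7 (m.Φ ψ) = _
  rw [h, TensorProduct.comm_tmul]

/-- Adapted models are transported along orbits. -/
theorem exists_isAdapted_of_sameOrbit {m : Model E} {ψ ψ' : evenExterior E} (h : m.IsAdapted ψ)
    (ho : SameOrbit (halfSpin E) ψ ψ') : ∃ m' : Model E, m'.IsAdapted ψ' := by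
  obtain ⟨c, hc, g, rfl⟩ := ho
  refine ⟨{ m.translate g with
    Φ := (LinearEquiv.smulOfNeZero ℂ _ c⁻¹ (inv_ne_zero hc)).trans (m.translate g).Φ
    map_pr := fun v w x => ?_ }, ?_⟩
  · have h2 : ∀ y, ((LinearEquiv.smulOfNeZero ℂ (evenExterior E) c⁻¹ (inv_ne_zero hc)).trans
        (m.translate g).Φ) y = c⁻¹ • (m.translate g).Φ y := fun y =>
      (m.translate g).Φ.map_smul c⁻¹ y
    rw [h2, h2, map_smul, ← (m.translate g).map_pr]
  · change m.Φ (halfSpin E g⁻¹ (c⁻¹ • c • halfSpin E g ψ)) = _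
    rw [smul_smul, inv_mul_cancel₀ hc, one_smul, Representation.inv_self_apply]
    exact h

theorem pairAction_chi (ε : ℂ) (v w : O7 × O7) :
    pairAction ε v w (chi ⊗ₜ chi) = cl v.1 (cl w.1 chi) ⊗ₜ chi + chi ⊗ₜ cl v.2 (cl w.2 chi) +
      ε • (cl v.1 chi ⊗ₜ cl w.2 chi - cl w.1 chi ⊗ₜ cl v.2 chi) := by
  simp [pairAction]

/-- A spinor with an adapted model is regular. -/
theorem Model.IsAdapted.isRegular {m : Model E} {ψ : evenExterior E} (h : m.IsAdapted ψ) :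
    IsRegular evenAction ψ := by
  set K := Submodule.span ℂ (Set.range fun p : (Module.Dual ℂ E × E) × (Module.Dual ℂ E × E) =>
    evenAction (pr p.1 p.2) ψ)
  have hK : ∀ v w, pairAction m.ε v w (chi ⊗ₜ chi) ∈ K.map m.Φ.toLinearMap := fun v w =>
    ⟨_, Submodule.subset_span ⟨(m.σ v, m.σ w), rfl⟩, by
      rw [← h]; exact m.map_pr v w ψ⟩
  set L := K.map m.Φ.toLinearMap
  -- Products inside one summand reach all of $\Delta_7\otimes\chi$, and symmetrically
  -- $\chi\otimes\Delta_7$.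
  have hl : ∀ x : D7, x ⊗ₜ[ℂ] chi ∈ L := by
    intro x
    have hx : x ∈ Submodule.span ℂ (Set.range fun p : O7 × O7 => cl p.1 (cl p.2 chi)) := by
      rw [span_cl_cl_chi]; trivial
    induction hx using Submodule.span_induction with
    | mem x hx =>
      obtain ⟨⟨v, w⟩, rfl⟩ := hx
      have := hK (v, 0) (w, 0)
      rw [pairAction_chi] at this
      simpa using this
    | zero => rw [TensorProduct.zero_tmul]; exact zero_mem _
    | add x y _ _ hx hy => rw [TensorProduct.add_tmul]; exact add_mem hx hy
    | smul c x _ hx => rw [← TensorProduct.smul_tmul']; exact L.smul_mem _ hx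
  have hr : ∀ x : D7, chi ⊗ₜ[ℂ] x ∈ L := by
    intro x
    have hx : x ∈ Submodule.span ℂ (Set.range fun p : O7 × O7 => cl p.1 (cl p.2 chi)) := by
      rw [span_cl_cl_chi]; trivial
    induction hx using Submodule.span_induction with
    | mem x hx =>
      obtain ⟨⟨v, w⟩, rfl⟩ := hx
      have := hK (0, v) (0, w)
      rw [pairAction_chi] at this
      simpa using this
    | zero => rw [TensorProduct.tmul_zero]; exact zero_mem _
    | add x y _ _ hx hy => rw [TensorProduct.tmul_add]; exact add_mem hx hy
    | smul c x _ hx => rw [TensorProduct.tmul_smul]; exact L.smul_mem _ hx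
  have hm : ∀ v w, cl v chi ⊗ₜ[ℂ] cl w chi ∈ L := by
    intro v w
    have := L.smul_mem m.ε⁻¹ (hK (v, 0) (0, w))
    rw [pairAction_chi] at this
    simpa [smul_smul, m.hε] using this
  have hL : L = ⊤ := by
    refine eq_top_iff.2 fun t _ => ?_
    induction t using TensorProduct.induction_on with
    | zero => exact zero_mem _
    | add x y hx hy => exact add_mem (hx trivial) (hy trivial)
    | tmul x y =>
      -- Expanding both factors along $\Delta_7=\mathbb{C}\chi\oplus V_7\chi$, the only terms
      -- without a factor $\chi$ are those produced by mixed products.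
      obtain ⟨⟨c, w⟩, rfl⟩ := chiMap_surjective x
      obtain ⟨⟨c', w'⟩, rfl⟩ := chiMap_surjective y
      have hs : chiMap (c, w) ⊗ₜ[ℂ] chiMap (c', w') = c • (chi ⊗ₜ[ℂ] chiMap (c', w')) +
          c' • (cl w chi ⊗ₜ[ℂ] chi) + cl w chi ⊗ₜ[ℂ] cl w' chi := by
        have h1 : cl w chi ⊗ₜ[ℂ] chiMap (c', w') =
            c' • (cl w chi ⊗ₜ[ℂ] chi) + cl w chi ⊗ₜ[ℂ] cl w' chi := by
          rw [chiMap_apply, TensorProduct.tmul_add, TensorProduct.tmul_smul]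
        rw [add_assoc, ← h1, chiMap_apply c w, TensorProduct.add_tmul, TensorProduct.smul_tmul']
      rw [hs]
      exact add_mem (add_mem (L.smul_mem _ (hr _)) (L.smul_mem _ (hl _))) (hm w w')
  change K = ⊤
  have := congrArg (Submodule.map m.Φ.symm.toLinearMap) hL
  rw [← Submodule.map_comp, Submodule.map_top] at this
  simpa using this

end Model

/-! ### The short root vectors of the exceptional Lie algebra -/

section ShortRoots

/-- The action of `eᵢ ∧ u + ¼ fᵢ₊₁ ∧ fᵢ₊₂`. -/
def rootE (i : Fin 3) (w : O7) : O7 :=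
  bivec (oddForm _) (ve i) vu w + bivec (oddForm _) ((1 / 4 : ℂ) • vf (i + 1)) (vf (i + 2)) w

/-- The action of `fᵢ ∧ u + 2 eᵢ₊₁ ∧ eᵢ₊₂`. -/
def rootF (i : Fin 3) (w : O7) : O7 :=
  bivec (oddForm _) (vf i) vu w + bivec (oddForm _) ((2 : ℂ) • ve (i + 1)) (ve (i + 2)) w

theorem polar_ve (i : Fin 3) (w : O7) :
    QuadraticMap.polar (oddForm _) (ve i) w = 2 * w.1.1 (Pi.single i 1) := by
  rw [polar_oddForm]; simp [ve]

theorem polar_vf (i : Fin 3) (w : O7) :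
    QuadraticMap.polar (oddForm _) (vf i) w = 2 * w.1.2 i := by
  rw [polar_oddForm]; simp [vf]

theorem polar_vu (w : O7) : QuadraticMap.polar (oddForm _) vu w = 2 * w.2 := by
  rw [polar_oddForm]; simp [vu]

theorem rootE_apply (i : Fin 3) (w : O7) : rootE i w =
    (2 * w.2) • ve i - (2 * w.1.1 (Pi.single i 1)) • vu +
      ((1 / 2 * w.1.2 (i + 2)) • vf (i + 1) - (1 / 2 * w.1.2 (i + 1)) • vf (i + 2)) := by
  simp only [rootE, bivec, QuadraticMap.polar_smul_left, polar_ve, polar_vf, polar_vu, smul_eq_mul]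
  module

theorem rootF_apply (i : Fin 3) (w : O7) : rootF i w =
    (2 * w.2) • vf i - (2 * w.1.2 i) • vu +
      ((4 * w.1.1 (Pi.single (i + 2) 1)) • ve (i + 1) -
        (4 * w.1.1 (Pi.single (i + 1) 1)) • ve (i + 2)) := by
  simp only [rootF, bivec, QuadraticMap.polar_smul_left, polar_ve, polar_vf, polar_vu, smul_eq_mul]
  module

theorem rootE_vu (i : Fin 3) : rootE i vu = (2 : ℂ) • ve i := by
  rw [rootE_apply]; simp [vu]

theorem rootF_vu (i : Fin 3) : rootF i vu = (2 : ℂ) • vf i := by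
  rw [rootF_apply]; simp [vu]

theorem rootE_vf (i : Fin 3) : rootE i (vf i) = -(2 : ℂ) • vu := by
  rw [rootE_apply]; simp [vf]

theorem rootF_ve (i : Fin 3) : rootF i (ve i) = -(2 : ℂ) • vu := by
  rw [rootF_apply]; simp [ve]

/-- The square has rank one, so applied twice the root vector isolates a single coordinate. -/
theorem rootE_rootE (i : Fin 3) (w : O7) :
    rootE i (rootE i w) = (-4 * w.1.1 (Pi.single i 1)) • ve i := by
  rw [rootE_apply, rootE_apply]
  fin_cases i <;> simp [ve, vf, vu] <;> ring_nf

theorem rootF_rootF (i : Fin 3) (w : O7) :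
    rootF i (rootF i w) = (-4 * w.1.2 i) • vf i := by
  rw [rootF_apply, rootF_apply]
  fin_cases i <;> simp [ve, vf, vu] <;> ring_nf

theorem O7_eq_sum (w : O7) : w = ∑ i, w.1.2 i • ve i +
    ∑ i, w.1.1 (Pi.single i 1) • vf i + w.2 • vu := by
  obtain ⟨⟨f, e⟩, t⟩ := w
  simp only [ve, vf, vu, Fin.sum_univ_three]
  refine Prod.ext (Prod.ext (LinearMap.pi_ext' fun i => LinearMap.ext_ring ?_) ?_) ?_
  · fin_cases i <;> simp
  · funext i
    fin_cases i <;> simp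
  · simp

/-- The short root vectors generate the standard representation from any nonzero vector. -/
theorem eq_top_of_rootE_rootF {K : Submodule ℂ O7} (hE : ∀ i, ∀ w ∈ K, rootE i w ∈ K)
    (hF : ∀ i, ∀ w ∈ K, rootF i w ∈ K) {w : O7} (hw : w ≠ 0) (hEw : ∀ i, rootE i w ∈ K)
    (hFw : ∀ i, rootF i w ∈ K) : K = ⊤ := by
  have cancel : ∀ {c : ℂ} {x : O7}, c ≠ 0 → c • x ∈ K → x ∈ K := fun hc h =>
    (K.smul_mem_iff hc).1 h
  have hu : vu ∈ K := by
    -- A nonzero coordinate on $F_3$ or $E_3$ is isolated by a square of root vectors, giving some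
    -- $e_i$ or $f_i$, and one opposite root vector then gives $u$. Otherwise $w$ is a multiple of
    -- $u$, and two steps return to $u$.
    by_cases h1 : ∃ i, w.1.1 (Pi.single i 1) ≠ 0
    · obtain ⟨i, hi⟩ := h1
      have h2 := hE i _ (hEw i)
      rw [rootE_rootE] at h2
      have h3 := hF i _ (cancel (mul_ne_zero (by norm_num) hi) h2)
      rw [rootF_ve] at h3
      exact cancel (by norm_num) h3
    · by_cases h1' : ∃ i, w.1.2 i ≠ 0
      · obtain ⟨i, hi⟩ := h1'
        have h2 := hF i _ (hFw i)
        rw [rootF_rootF] at h2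
        have h3 := hE i _ (cancel (mul_ne_zero (by norm_num) hi) h2)
        rw [rootE_vf] at h3
        exact cancel (by norm_num) h3
      · push Not at h1 h1'
        have h2 : w = w.2 • vu := by
          conv_lhs => rw [O7_eq_sum w]
          simp [h1, h1']
        have h3 : w.2 ≠ 0 := by
          intro h
          rw [h, zero_smul] at h2
          exact hw h2
        have h4 := hEw 0
        rw [rootE_apply, h1, h1', h1'] at h4
        have h5 := hF 0 _ (cancel (c := 2 * w.2) (x := ve 0) (mul_ne_zero two_ne_zero h3)
          (by simpa using h4))
        rw [rootF_ve] at h5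
        exact cancel (by norm_num) h5
  have he : ∀ i, ve i ∈ K := fun i => by
    have := hE i _ hu
    rw [rootE_vu] at this
    exact cancel two_ne_zero this
  have hf : ∀ i, vf i ∈ K := fun i => by
    have := hF i _ hu
    rw [rootF_vu] at this
    exact cancel two_ne_zero this
  refine eq_top_iff.2 fun x _ => ?_
  rw [O7_eq_sum x]
  exact add_mem (add_mem (sum_mem fun i _ => K.smul_mem _ (he i))
    (sum_mem fun i _ => K.smul_mem _ (hf i))) (K.smul_mem _ hu)

theorem oddForm_ve (i : Fin 3) : oddForm _ (ve i) = 0 := by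
  simp [ve, oddForm, evenForm]

theorem oddForm_vf (i : Fin 3) : oddForm _ (vf i) = 0 := by
  simp [vf, oddForm, evenForm]

theorem oddForm_vu : oddForm (Fin 3 → ℂ) vu = 1 := by
  simp [vu, oddForm]

theorem nilPair_rootE (i : Fin 3) :
    NilPair (oddForm _) (ve i) vu ((1 / 4 : ℂ) • vf (i + 1)) (vf (i + 2)) where
  hx₁ := oddForm_ve i
  hy₁ := by rw [oddForm_vu]; exact one_ne_zero
  hx₂ := by rw [QuadraticMap.map_smul, oddForm_vf, smul_zero]
  hy₂ := oddForm_vf _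
  h₁ := by rw [polar_ve]; simp [vu]
  h₂ := by rw [QuadraticMap.polar_smul_left, polar_vf]; simp [vf]
  hxx := by rw [QuadraticMap.polar_smul_right, polar_ve]; fin_cases i <;> simp [vf]
  hxy := by rw [polar_ve]; fin_cases i <;> simp [vf]
  hyx := by rw [QuadraticMap.polar_smul_right, polar_vu]; simp [vf]
  hyy := by rw [polar_vu]; simp [vf]

theorem nilPair_rootF (i : Fin 3) :
    NilPair (oddForm _) (vf i) vu ((2 : ℂ) • ve (i + 1)) (ve (i + 2)) where
  hx₁ := oddForm_vf i
  hy₁ := by rw [oddForm_vu]; exact one_ne_zero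
  hx₂ := by rw [QuadraticMap.map_smul, oddForm_ve, smul_zero]
  hy₂ := oddForm_ve _
  h₁ := by rw [polar_vf]; simp [vu]
  h₂ := by rw [QuadraticMap.polar_smul_left, polar_ve]; simp [ve]
  hxx := by rw [QuadraticMap.polar_smul_right, polar_vf]; fin_cases i <;> simp [ve]
  hxy := by rw [polar_vf]; fin_cases i <;> simp [ve]
  hyx := by rw [QuadraticMap.polar_smul_right, polar_vu]; simp [ve]
  hyy := by rw [polar_vu]; simp [ve]

/-- A pair of bivectors of the standard space with nilpotent sum annihilating the spinor `χ`. -/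
structure ChiPair (x₁ y₁ x₂ y₂ : O7) : Prop extends NilPair (oddForm _) x₁ y₁ x₂ y₂ where
  chi_eq : cl x₁ (cl y₁ chi) + cl x₂ (cl y₂ chi) = 0

theorem chiPair_rootE (i : Fin 3) : ChiPair (ve i) vu ((1 / 4 : ℂ) • vf (i + 1)) (vf (i + 2)) :=
  { nilPair_rootE i with
    chi_eq := by rw [map_smul, LinearMap.smul_apply]; exact short_root_e_chi i }

theorem chiPair_rootF (i : Fin 3) : ChiPair (vf i) vu ((2 : ℂ) • ve (i + 1)) (ve (i + 2)) :=
  { nilPair_rootF i with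
    chi_eq := by rw [map_smul, LinearMap.smul_apply]; exact short_root_f_chi i }

end ShortRoots

/-! ### The stabilizer of an adapted spinor -/

section Stabilizer

open CliffordAlgebra

variable {E : Type*} [AddCommGroup E] [Module ℂ E] {m : Model E} {ψ : evenExterior E}

theorem Model.bivec_σ_left (m : Model E) (x y w w' : O7) :
    bivec (evenForm E) (m.σ (x, 0)) (m.σ (y, 0)) (m.σ (w, w')) =
      m.σ (bivec (oddForm _) x y w, 0) := by
  have h : ((bivec (oddForm _) x y w, 0) : O7 × O7) =
      QuadraticMap.polar (oddForm _) y w • (x, 0) - QuadraticMap.polar (oddForm _) x w • (y, 0) := by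
    simp [bivec]
  rw [h]
  change _ = m.σ.toLinearEquiv _
  rw [map_sub, map_smul, map_smul, bivec, m.polar_σ, m.polar_σ]
  simp

theorem Model.evenAction_left (m : Model E) (x y : O7) (φ : evenExterior E) :
    m.Φ (evenAction (pr (m.σ (x, 0)) (m.σ (y, 0))) φ) = (cl x * cl y).rTensor D7 (m.Φ φ) := by
  rw [m.map_pr]
  simp [pairAction]

theorem Model.evenAction_right (m : Model E) (x y : O7) (φ : evenExterior E) :
    m.Φ (evenAction (pr (m.σ (0, x)) (m.σ (0, y))) φ) = (cl x * cl y).lTensor D7 (m.Φ φ) := by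
  rw [m.map_pr]
  simp [pairAction]

theorem ChiPair.evenAction_eq_zero {x₁ y₁ x₂ y₂ : O7} (h : ChiPair x₁ y₁ x₂ y₂)
    (hψ : m.IsAdapted ψ) :
    evenAction (pr (m.σ (x₁, 0)) (m.σ (y₁, 0)) + pr (m.σ (x₂, 0)) (m.σ (y₂, 0))) ψ = 0 := by
  apply m.Φ.injective
  rw [map_add, LinearMap.add_apply, map_add, m.evenAction_left, m.evenAction_left, hψ,
    LinearMap.rTensor_tmul, LinearMap.rTensor_tmul, ← TensorProduct.add_tmul,
    Module.End.mul_apply, Module.End.mul_apply, h.chi_eq, TensorProduct.zero_tmul, map_zero]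

theorem ChiPair.nilPair {x₁ y₁ x₂ y₂ : O7} (h : ChiPair x₁ y₁ x₂ y₂) (m : Model E) :
    NilPair (evenForm E) (m.σ (x₁, 0)) (m.σ (y₁, 0)) (m.σ (x₂, 0)) (m.σ (y₂, 0)) where
  hx₁ := by rw [m.σ.map_app]; simpa using h.hx₁
  hy₁ := by rw [m.σ.map_app]; simpa using h.hy₁
  hx₂ := by rw [m.σ.map_app]; simpa using h.hx₂
  hy₂ := by rw [m.σ.map_app]; simpa using h.hy₂
  h₁ := by rw [m.polar_σ]; simpa using h.h₁
  h₂ := by rw [m.polar_σ]; simpa using h.h₂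
  hxx := by rw [m.polar_σ]; simpa using h.hxx
  hxy := by rw [m.polar_σ]; simpa using h.hxy
  hyx := by rw [m.polar_σ]; simpa using h.hyx
  hyy := by rw [m.polar_σ]; simpa using h.hyy

/-- A subspace of the ambient space is closed if it is preserved by the nilpotent pairs of the
first summand. -/
def Model.IsLeftClosed (m : Model E) (X : Submodule ℂ (Module.Dual ℂ E × E)) : Prop :=
  ∀ x₁ y₁ x₂ y₂ : O7, ChiPair x₁ y₁ x₂ y₂ → ∀ v ∈ X,
    bivec (evenForm E) (m.σ (x₁, 0)) (m.σ (y₁, 0)) v +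
      bivec (evenForm E) (m.σ (x₂, 0)) (m.σ (y₂, 0)) v ∈ X

/-- Bivectors of the first summand kill the second component, so one application of a root vector
lands in the first summand; there the $\mathfrak{g}_2$ roots generate everything. -/
theorem Model.left_le_of_isLeftClosed {X : Submodule ℂ (Module.Dual ℂ E × E)}
    (hX : m.IsLeftClosed X) {w w' : O7} (hw : w ≠ 0) (hmem : m.σ (w, w') ∈ X) : m.left ≤ X := by
  let K : Submodule ℂ O7 := X.comap (m.σ.toLinearEquiv.toLinearMap ∘ₗ LinearMap.inl ℂ O7 O7)
  have hadd : ∀ a b : O7, m.σ (a, 0) + m.σ (b, 0) = m.σ (a + b, 0) := fun a b =>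
    ((m.σ.toLinearEquiv.toLinearMap ∘ₗ LinearMap.inl ℂ O7 O7).map_add a b).symm
  have hE : ∀ i (w w' : O7), m.σ (w, w') ∈ X → rootE i w ∈ K := by
    intro i w w' h
    have := hX _ _ _ _ (chiPair_rootE i) _ h
    rwa [m.bivec_σ_left, m.bivec_σ_left, hadd] at this
  have hF : ∀ i (w w' : O7), m.σ (w, w') ∈ X → rootF i w ∈ K := by
    intro i w w' h
    have := hX _ _ _ _ (chiPair_rootF i) _ h
    rwa [m.bivec_σ_left, m.bivec_σ_left, hadd] at this
  have hK := eq_top_of_rootE_rootF (fun i w hw => hE i w 0 hw) (fun i w hw => hF i w 0 hw) hw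
    (fun i => hE i w w' hmem) (fun i => hF i w w' hmem)
  rintro _ ⟨x, rfl⟩
  have : x ∈ K := by rw [hK]; trivial
  exact this

theorem Model.eq_left_or_eq_right [Module.Finite ℂ E] {X : Submodule ℂ (Module.Dual ℂ E × E)}
    (hX : m.IsLeftClosed X) (hX' : m.swap.IsLeftClosed X) (hdim : Module.finrank ℂ X = 7) :
    X = m.left ∨ X = m.swap.left := by
  have hne : X ≠ ⊥ := by
    rintro rfl
    simp at hdim
  obtain ⟨x, hx, h0⟩ := (Submodule.ne_bot_iff X).1 hne
  obtain ⟨⟨w, w'⟩, rfl⟩ := m.σ.toLinearEquiv.surjective x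
  by_cases hw : w = 0
  · right
    have hw' : w' ≠ 0 := by
      rintro rfl
      subst hw
      exact h0 (map_zero m.σ.toLinearEquiv)
    refine (Submodule.eq_of_le_of_finrank_eq
      (m.swap.left_le_of_isLeftClosed hX' (w := w') (w' := w) hw' hx) ?_).symm
    rw [m.swap.finrank_left, hdim]
  · left
    refine (Submodule.eq_of_le_of_finrank_eq (m.left_le_of_isLeftClosed hX hw hx) ?_).symm
    rw [m.finrank_left, hdim]

/-- The bivectors of the first summand. -/
def Model.leftBivectors (m : Model E) : Submodule ℂ (even (evenForm E)) :=
  Submodule.span ℂ (Set.range fun p : O7 × O7 => pr (m.σ (p.1, 0)) (m.σ (p.2, 0)))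

/-- The products of a vector of each summand. -/
def Model.mixed (m : Model E) : O7 ⊗[ℂ] O7 →ₗ[ℂ] even (evenForm E) :=
  TensorProduct.lift (((even.ι (evenForm E)).bilin.compl₁₂
    (m.σ.toLinearEquiv.toLinearMap ∘ₗ LinearMap.inl ℂ O7 O7)
    (m.σ.toLinearEquiv.toLinearMap ∘ₗ LinearMap.inr ℂ O7 O7)))

theorem Model.mixed_tmul (v w : O7) : m.mixed (v ⊗ₜ w) = pr (m.σ (v, 0)) (m.σ (0, w)) := rfl

theorem Model.pr_eq (m : Model E) (v w : O7 × O7) : pr (m.σ v) (m.σ w) =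
    pr (m.σ (v.1, 0)) (m.σ (w.1, 0)) + pr (m.σ (0, v.2)) (m.σ (0, w.2)) +
      m.mixed (v.1 ⊗ₜ w.2 - w.1 ⊗ₜ v.2) := by
  apply Subtype.ext
  have hs : ∀ v : O7 × O7, m.σ v = m.σ (v.1, 0) + m.σ (0, v.2) := fun v => by
    have : v = (v.1, 0) + (0, v.2) := by simp
    conv_lhs => rw [this]
    exact map_add m.σ.toLinearEquiv _ _
  have hc : ι (evenForm E) (m.σ (0, v.2)) * ι _ (m.σ (w.1, 0)) =
      -(ι (evenForm E) (m.σ (w.1, 0)) * ι _ (m.σ (0, v.2))) := by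
    refine eq_neg_of_add_eq_zero_left ?_
    rw [ι_mul_ι_add_swap, m.polar_σ]
    simp
  rw [map_sub, m.mixed_tmul, m.mixed_tmul]
  change ι _ (m.σ v) * ι _ (m.σ w) = ι _ (m.σ (v.1, 0)) * ι _ (m.σ (w.1, 0)) +
    ι _ (m.σ (0, v.2)) * ι _ (m.σ (0, w.2)) +
    (ι _ (m.σ (v.1, 0)) * ι _ (m.σ (0, w.2)) - ι _ (m.σ (w.1, 0)) * ι _ (m.σ (0, v.2)))
  rw [hs v, hs w, map_add, map_add, add_mul, mul_add, mul_add, hc]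
  abel

theorem Model.evenAction_leftBivectors {a : even (evenForm E)} (ha : a ∈ m.leftBivectors) :
    ∃ A : Module.End ℂ D7, ∀ φ, m.Φ (evenAction a φ) = A.rTensor D7 (m.Φ φ) := by
  induction ha using Submodule.span_induction with
  | mem a ha =>
    obtain ⟨p, rfl⟩ := ha
    exact ⟨_, fun φ => m.evenAction_left p.1 p.2 φ⟩
  | zero => exact ⟨0, fun φ => by simp⟩
  | add a b _ _ ha hb =>
    obtain ⟨A, hA⟩ := ha
    obtain ⟨B, hB⟩ := hb
    exact ⟨A + B, fun φ => by
      rw [map_add, LinearMap.add_apply, map_add, hA, hB, LinearMap.rTensor_add,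
        LinearMap.add_apply]⟩
  | smul c a _ ha =>
    obtain ⟨A, hA⟩ := ha
    exact ⟨c • A, fun φ => by
      rw [map_smul, LinearMap.smul_apply, map_smul, hA, LinearMap.rTensor_smul,
        LinearMap.smul_apply]⟩

theorem Model.bracket_leftBivectors {a : even (evenForm E)} (ha : a ∈ m.leftBivectors) (w : O7) :
    ∃ w₂ : O7, ι (evenForm E) (m.σ (w₂, 0)) =
      (a : CliffordAlgebra (evenForm E)) * ι _ (m.σ (w, 0)) - ι _ (m.σ (w, 0)) * (a : CliffordAlgebra (evenForm E)) := by
  let L := (ι (evenForm E)) ∘ₗ m.σ.toLinearEquiv.toLinearMap ∘ₗ LinearMap.inl ℂ O7 O7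
  change ∃ w₂, L w₂ = _
  induction ha using Submodule.span_induction with
  | mem a ha =>
    obtain ⟨p, rfl⟩ := ha
    refine ⟨bivec (oddForm _) p.1 p.2 w, ?_⟩
    have := m.bivec_σ_left p.1 p.2 w 0
    refine Eq.trans (b := ι (evenForm E) (m.σ (bivec (oddForm _) p.1 p.2 w, 0))) rfl ?_
    rw [← this, ι_bivec]
    rfl
  | zero => exact ⟨0, by simp⟩
  | add a b _ _ ha hb =>
    obtain ⟨v, hv⟩ := ha
    obtain ⟨v', hv'⟩ := hb
    refine ⟨v + v', ?_⟩
    rw [map_add, hv, hv', AddMemClass.coe_add]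
    noncomm_ring
  | smul c a _ ha =>
    obtain ⟨v, hv⟩ := ha
    refine ⟨c • v, ?_⟩
    rw [map_smul, hv, SetLike.val_smul, smul_sub, smul_mul_assoc, mul_smul_comm]

theorem Model.commute_rightBivectors {a : even (evenForm E)} (ha : a ∈ m.swap.leftBivectors)
    (w : O7) : (a : CliffordAlgebra (evenForm E)) * ι _ (m.σ (w, 0)) =
      ι _ (m.σ (w, 0)) * (a : CliffordAlgebra (evenForm E)) := by
  induction ha using Submodule.span_induction with
  | mem a ha =>
    obtain ⟨p, rfl⟩ := ha
    have h : bivec (evenForm E) (m.σ (0, p.1)) (m.σ (0, p.2)) (m.σ (w, 0)) = 0 := by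
      rw [bivec, m.polar_σ, m.polar_σ]
      simp
    have := ι_bivec (Q := evenForm E) (m.σ (0, p.1)) (m.σ (0, p.2)) (m.σ (w, 0))
    rw [h, map_zero] at this
    exact sub_eq_zero.1 this.symm
  | zero => simp
  | add a b _ _ ha hb => rw [AddMemClass.coe_add, add_mul, mul_add, ha, hb]
  | smul c a _ ha => rw [SetLike.val_smul, smul_mul_assoc, mul_smul_comm, ha]

theorem Model.evenAction_mixed (hψ : m.IsAdapted ψ) (t : O7 ⊗[ℂ] O7) :
    m.Φ (evenAction (m.mixed t) ψ) = m.ε • TensorProduct.map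
      (LinearMap.applyₗ chi ∘ₗ cl) (LinearMap.applyₗ chi ∘ₗ cl) t := by
  induction t using TensorProduct.induction_on with
  | zero => simp
  | add a b ha hb => simp only [map_add, LinearMap.add_apply, ha, hb, smul_add]
  | tmul v w =>
    rw [m.mixed_tmul, m.map_pr, hψ, pairAction_chi]
    simp

/-- This is the splitting of $\wedge^2(V_7\oplus V_7')$ into two diagonal parts and $V_7\otimes
V_7'$, with scalars included. -/
theorem span_pr_le (m : Model E) : Submodule.span ℂ (Set.range fun p :
    (Module.Dual ℂ E × E) × (Module.Dual ℂ E × E) => pr p.1 p.2) ≤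
      m.leftBivectors ⊔ m.swap.leftBivectors ⊔ LinearMap.range m.mixed := by
  refine Submodule.span_le.2 ?_
  rintro _ ⟨⟨v, w⟩, rfl⟩
  obtain ⟨v, rfl⟩ := m.σ.toLinearEquiv.surjective v
  obtain ⟨w, rfl⟩ := m.σ.toLinearEquiv.surjective w
  have := m.pr_eq v w
  change pr (m.σ v) (m.σ w) ∈ _
  rw [this]
  exact Submodule.add_mem_sup (Submodule.add_mem_sup (Submodule.subset_span ⟨(v.1, w.1), rfl⟩)
    (Submodule.subset_span ⟨(v.2, w.2), rfl⟩)) ⟨_, rfl⟩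

/-- The infinitesimal stabilizer of an adapted spinor preserves the first summand. -/
theorem Model.IsAdapted.bracket_left (hψ : m.IsAdapted ψ) {a : even (evenForm E)}
    (ha : a ∈ Submodule.span ℂ (Set.range fun p :
      (Module.Dual ℂ E × E) × (Module.Dual ℂ E × E) => pr p.1 p.2))
    (haψ : evenAction a ψ = 0) {v : Module.Dual ℂ E × E} (hv : v ∈ m.left) :
    ∃ v₂ ∈ m.left, ι (evenForm E) v₂ = (a : CliffordAlgebra (evenForm E)) * ι _ v -
      ι _ v * (a : CliffordAlgebra (evenForm E)) := by
  obtain ⟨b, hb, _, ⟨t, rfl⟩, rfl⟩ := Submodule.mem_sup.1 (span_pr_le m ha)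
  obtain ⟨α, hα, α', hα', rfl⟩ := Submodule.mem_sup.1 hb
  obtain ⟨A, hA⟩ := m.evenAction_leftBivectors hα
  obtain ⟨A', hA'⟩ := m.swap.evenAction_leftBivectors hα'
  have hA'' : m.Φ (evenAction α' ψ) = chi ⊗ₜ[ℂ] A' chi := by
    have h1 : TensorProduct.comm ℂ D7 D7 (m.Φ (evenAction α' ψ)) = _ := hA' ψ
    rw [show m.swap.Φ ψ = chi ⊗ₜ chi from hψ.swap, LinearMap.rTensor_tmul] at h1
    have h2 := congrArg (TensorProduct.comm ℂ D7 D7) h1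
    rw [TensorProduct.comm_tmul] at h2
    refine Eq.trans ?_ h2
    exact ((TensorProduct.comm ℂ D7 D7).symm_apply_apply _).symm
  have h1 := congrArg m.Φ haψ
  rw [map_add, map_add, LinearMap.add_apply, LinearMap.add_apply, map_add, map_add, hA, hA'',
    m.evenAction_mixed hψ, hψ, LinearMap.rTensor_tmul, map_zero] at h1
  -- The projection along $\chi$ in both factors kills the contributions of the two summands, each
  -- having a factor $\chi$, and recovers $\varepsilon t$ from the mixed part.
  have h2 := congrArg (TensorProduct.map chiProj chiProj) h1
  have hid : (chiProj ∘ₗ LinearMap.applyₗ chi ∘ₗ cl : O7 →ₗ[ℂ] O7) = LinearMap.id :=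
    LinearMap.ext chiProj_cl
  rw [map_add, map_add, TensorProduct.map_tmul, TensorProduct.map_tmul, chiProj_chi,
    TensorProduct.tmul_zero, TensorProduct.zero_tmul, map_smul, ← LinearMap.comp_apply,
    ← TensorProduct.map_comp, hid, TensorProduct.map_id, map_zero, zero_add, zero_add,
    LinearMap.id_apply] at h2
  have ht : t = 0 := (smul_eq_zero.1 h2).resolve_left m.hε
  obtain ⟨w, rfl⟩ := hv
  obtain ⟨w₂, hw₂⟩ := m.bracket_leftBivectors hα w
  refine ⟨_, m.σ_mem_left w₂, ?_⟩
  have h3 := m.commute_rightBivectors hα' w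
  change _ = _ * ι _ (m.σ (w, 0)) - ι _ (m.σ (w, 0)) * _
  rw [hw₂, ht, map_zero, add_zero, AddMemClass.coe_add, add_mul, mul_add, h3]
  abel

/-- Stabilizing elements move the first summand to a closed subspace. -/
theorem Model.IsAdapted.map_left_mem (hψ : m.IsAdapted ψ) {g : spinGroup (evenForm E)} {c : ℂ}
    (hg : halfSpin E g ψ = c • ψ) {x₁ y₁ x₂ y₂ : Module.Dual ℂ E × E}
    (h : evenAction (pr x₁ y₁ + pr x₂ y₂) ψ = 0) {v : Module.Dual ℂ E × E}
    (hv : v ∈ m.left.map (spinConj g).toLinearMap) :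
    bivec (evenForm E) x₁ y₁ v + bivec (evenForm E) x₂ y₂ v ∈
      m.left.map (spinConj g).toLinearMap := by
  obtain ⟨w, hw, rfl⟩ := hv
  -- The conjugate of the given bivectors by $g^{-1}$ still annihilates $\psi$, since $g$ only
  -- rescales $\psi$. Its bracket preserves the first summand, and conjugating back by $g$ gives the
  -- claim.
  let a : even (evenForm E) := pr (spinConj g⁻¹ x₁) (spinConj g⁻¹ y₁) +
    pr (spinConj g⁻¹ x₂) (spinConj g⁻¹ y₂)
  have ha : a = spinToEven g⁻¹ * (pr x₁ y₁ + pr x₂ y₂) * spinToEven g := by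
    apply Subtype.ext
    change ι (evenForm E) (spinConj g⁻¹ x₁) * ι _ (spinConj g⁻¹ y₁) + ι _ (spinConj g⁻¹ x₂) *
      ι _ (spinConj g⁻¹ y₂) = ((g⁻¹ : spinGroup (evenForm E)) : CliffordAlgebra (evenForm E)) *
      (ι _ x₁ * ι _ y₁ + ι _ x₂ * ι _ y₂) * (g : CliffordAlgebra (evenForm E))
    simp only [ι_spinConj, inv_inv]
    have h := coe_mul_coe_inv g
    generalize (g : CliffordAlgebra (evenForm E)) = p at h ⊢
    generalize ((g⁻¹ : spinGroup (evenForm E)) : CliffordAlgebra (evenForm E)) = q at h ⊢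
    calc _ = q * ι _ x₁ * (p * q) * ι _ y₁ * p + q * ι _ x₂ * (p * q) * ι _ y₂ * p := by
          noncomm_ring
      _ = _ := by rw [h]; noncomm_ring
  have ha0 : evenAction a ψ = 0 := by
    rw [ha, map_mul, map_mul, Module.End.mul_apply, Module.End.mul_apply, ← halfSpin_eq g, hg,
      map_smul, h, smul_zero, map_zero]
  obtain ⟨w₂, hw₂, hb⟩ := hψ.bracket_left
    (add_mem (Submodule.subset_span ⟨(_, _), rfl⟩) (Submodule.subset_span ⟨(_, _), rfl⟩)) ha0 hw
  refine ⟨w₂, hw₂, cliffordι_injective (Q := evenForm E) ?_⟩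
  have hb' : ι (evenForm E) w₂ = (a : CliffordAlgebra (evenForm E)) * ι _ w -
      ι _ w * (a : CliffordAlgebra (evenForm E)) := hb
  rw [LinearEquiv.coe_coe, ι_spinConj, hb', map_add, ι_bivec, ι_bivec, ι_spinConj, ha]
  change (g : CliffordAlgebra (evenForm E)) *
    ((((g⁻¹ : spinGroup (evenForm E)) : CliffordAlgebra (evenForm E)) *
      (ι _ x₁ * ι _ y₁ + ι _ x₂ * ι _ y₂) * (g : CliffordAlgebra (evenForm E))) * ι _ w - ι _ w *
      (((g⁻¹ : spinGroup (evenForm E)) : CliffordAlgebra (evenForm E)) *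
      (ι _ x₁ * ι _ y₁ + ι _ x₂ * ι _ y₂) * (g : CliffordAlgebra (evenForm E)))) *
      ((g⁻¹ : spinGroup (evenForm E)) : CliffordAlgebra (evenForm E)) = _
  have h1 := coe_mul_coe_inv g
  generalize (g : CliffordAlgebra (evenForm E)) = p at h1 ⊢
  generalize ((g⁻¹ : spinGroup (evenForm E)) : CliffordAlgebra (evenForm E)) = q at h1 ⊢
  generalize ι (evenForm E) x₁ * ι (evenForm E) y₁ = b
  generalize ι (evenForm E) x₂ * ι (evenForm E) y₂ = c
  generalize ι (evenForm E) w = w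
  calc _ = (p * q) * (b + c) * p * w * q - p * w * q * (b + c) * (p * q) := by noncomm_ring
    _ = _ := by rw [h1]; noncomm_ring

theorem Model.IsAdapted.map_left (hψ : m.IsAdapted ψ) [Module.Finite ℂ E]
    {g : spinGroup (evenForm E)} {c : ℂ} (hg : halfSpin E g ψ = c • ψ) :
    m.left.map (spinConj g).toLinearMap = m.left ∨
      m.left.map (spinConj g).toLinearMap = m.swap.left := by
  refine m.eq_left_or_eq_right (fun x₁ y₁ x₂ y₂ h v hv => ?_) (fun x₁ y₁ x₂ y₂ h v hv => ?_) ?_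
  · exact hψ.map_left_mem hg (h.evenAction_eq_zero hψ) hv
  · exact hψ.map_left_mem hg (h.evenAction_eq_zero hψ.swap) hv
  · rw [LinearEquiv.finrank_map_eq, m.finrank_left]

theorem Model.left_ne_right (m : Model E) : m.left ≠ m.swap.left := by
  intro h
  have h1 := m.isCompl_left.disjoint
  rw [← h, disjoint_self] at h1
  have := m.finrank_left
  rw [h1] at this
  simp at this

/-- The stabilizer of an adapted spinor preserves the decomposition. -/
theorem Model.IsAdapted.stabilizerPreserves (hψ : m.IsAdapted ψ) [Module.Finite ℂ E] :
    StabilizerPreserves ψ m.left m.swap.left := by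
  rintro g ⟨c, hg⟩
  have hne : m.left.map (spinConj g).toLinearMap ≠ m.swap.left.map (spinConj g).toLinearMap :=
    fun h => m.left_ne_right (Submodule.map_injective_of_injective (spinConj g).injective h)
  simp only [spinTranslate_eq_map]
  have h1 := hψ.map_left hg
  have h2 := hψ.swap.map_left hg
  rw [m.swap_swap_left] at h2
  rcases h1 with h1 | h1 <;> rcases h2 with h2 | h2
  · exact Or.inl ⟨h1, h2⟩
  · exact absurd (h1.trans h2.symm) hne
  · exact absurd (h1.trans h2.symm) hne
  · exact Or.inr ⟨h1, h2⟩

theorem StabilizerPreserves.symm {X X' : Submodule ℂ (Module.Dual ℂ E × E)}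
    (h : StabilizerPreserves ψ X X') : StabilizerPreserves ψ X' X := fun g hg =>
  (h g hg).imp And.symm And.symm

/-- An element of the stabilizer may exchange the two subspaces, but its square fixes each. This is
why squares of unipotents are used. -/
theorem StabilizerPreserves.map_mul_self {X X' : Submodule ℂ (Module.Dual ℂ E × E)}
    (h : StabilizerPreserves ψ X X') {g : spinGroup (evenForm E)} {c : ℂ}
    (hg : halfSpin E g ψ = c • ψ) : X.map (spinConj (g * g)).toLinearMap = X := by
  have h1 : ∀ Y : Submodule ℂ (Module.Dual ℂ E × E), Y.map (spinConj (g * g)).toLinearMap =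
      (Y.map (spinConj g).toLinearMap).map (spinConj g).toLinearMap := fun Y => by
    rw [← Submodule.map_comp]
    congr 1
    exact LinearMap.ext (spinConj_mul g g)
  have h2 := h g ⟨c, hg⟩
  simp only [spinTranslate_eq_map] at h2
  rw [h1]
  rcases h2 with ⟨h3, -⟩ | ⟨h3, h4⟩
  · rw [h3, h3]
  · rw [h3, h4]

/-- The exponential of a nilpotent pair annihilating $\chi$ fixes $\psi$, so its square preserves
$X$, and hence so does its logarithm. -/
theorem StabilizerPreserves.isLeftClosed {X X' : Submodule ℂ (Module.Dual ℂ E × E)}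
    (h : StabilizerPreserves ψ X X') (hψ : m.IsAdapted ψ) : m.IsLeftClosed X := by
  intro x₁ y₁ x₂ y₂ hp v hv
  have hn := hp.nilPair m
  refine hn.bivec_mem (h.map_mul_self (c := 1) ?_) hv
  have h0 := hp.evenAction_eq_zero hψ
  let a := pr (m.σ (x₁, 0)) (m.σ (y₁, 0))
  let b := pr (m.σ (x₂, 0)) (m.σ (y₂, 0))
  -- Using $a^2=0$, the product $(1+a)(1+b)$ is written with $a+b$ on the right, where it meets
  -- $\psi$ and gives zero.
  have hexp : spinToEven hn.exp = 1 + (a + b) + a * (a + b) := by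
    apply Subtype.ext
    have h1 := hn.sq_left
    change (1 + (a : CliffordAlgebra (evenForm E))) * (1 + (b : CliffordAlgebra (evenForm E))) =
      1 + ((a : CliffordAlgebra (evenForm E)) + b) + a * (a + b)
    have h2 : (a : CliffordAlgebra (evenForm E)) * a = 0 := h1
    rw [mul_add (a : CliffordAlgebra (evenForm E)) a b, h2]
    noncomm_ring
  rw [halfSpin_eq, hexp, map_add, map_add, map_mul, LinearMap.add_apply, LinearMap.add_apply,
    Module.End.mul_apply, h0, map_zero, map_one, Module.End.one_apply, one_smul, add_zero, add_zero]

/-- Uniqueness of the decomposition preserved by the stabilizer. -/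
theorem Model.IsAdapted.unique (hψ : m.IsAdapted ψ) [Module.Finite ℂ E]
    {X X' : Submodule ℂ (Module.Dual ℂ E × E)} (hX : IsOrthogonalDecomposition (evenForm E) X X')
    (h : StabilizerPreserves ψ X X') :
    (X = m.left ∧ X' = m.swap.left) ∨ (X = m.swap.left ∧ X' = m.left) := by
  have h1 := m.eq_left_or_eq_right (h.isLeftClosed hψ) (h.isLeftClosed hψ.swap) hX.finrank_left
  have h2 := m.eq_left_or_eq_right (h.symm.isLeftClosed hψ) (h.symm.isLeftClosed hψ.swap)
    hX.finrank_right
  have hne : X ≠ X' := by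
    rintro rfl
    have h3 := hX.isCompl.disjoint
    rw [disjoint_self] at h3
    have := hX.finrank_left
    rw [h3] at this
    simp at this
  rcases h1 with h1 | h1 <;> rcases h2 with h2 | h2
  · exact absurd (h1.trans h2.symm) hne
  · exact Or.inl ⟨h1, h2⟩
  · exact Or.inr ⟨h1, h2⟩
  · exact absurd (h1.trans h2.symm) hne

end Stabilizer

/-! ### Existence of a tensor product model -/

section Existence

open CliffordAlgebra

variable {E : Type*} [AddCommGroup E] [Module ℂ E]

theorem eq_zero_of_polar_oddForm {x : O7}
    (h : ∀ w, QuadraticMap.polar (oddForm (Fin 3 → ℂ)) w x = 0) : x = 0 := by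
  have h1 : ∀ i, x.1.1 (Pi.single i 1) = 0 := fun i => by simpa [polar_ve] using h (ve i)
  have h2 : ∀ i, x.1.2 i = 0 := fun i => by simpa [polar_vf] using h (vf i)
  have h3 : x.2 = 0 := by simpa [polar_vu] using h vu
  rw [O7_eq_sum x]
  simp [h1, h2, h3]

/-- A linear map from the sum of two standard seven-dimensional spaces. -/
def sumMap (θ : E ≃ₗ[ℂ] ((Fin 3 → ℂ) × (Fin 3 → ℂ)) × ℂ) : O7 × O7 →ₗ[ℂ] Module.Dual ℂ E × E where
  toFun x := ((x.1.1.1 ∘ₗ LinearMap.fst ℂ _ _ ∘ₗ LinearMap.fst ℂ _ _ +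
      x.2.1.1 ∘ₗ LinearMap.snd ℂ _ _ ∘ₗ LinearMap.fst ℂ _ _ +
      ((x.1.2 - Complex.I * x.2.2) / 2) • LinearMap.snd ℂ _ _) ∘ₗ θ.toLinearMap,
    θ.symm ((x.1.1.2, x.2.1.2), x.1.2 + Complex.I * x.2.2))
  map_add' x y := by
    refine Prod.ext (LinearMap.ext fun e => ?_) (θ.injective ?_)
    · simp; ring
    · simp; ring
  map_smul' c x := by
    refine Prod.ext (LinearMap.ext fun e => ?_) (θ.injective ?_)
    · simp; ring
    · simp; ring

/-- The two lines $L$, $L'$ span a hyperbolic plane over $\mathbb{C}$: $t^2+t'^2=(t+it')(t-it')$,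
and the half in `sumMap` absorbs the factor 2 of the form. -/
theorem evenForm_sumMap (θ : E ≃ₗ[ℂ] ((Fin 3 → ℂ) × (Fin 3 → ℂ)) × ℂ) (x : O7 × O7) :
    evenForm E (sumMap θ x) = form77 x := by
  simp only [evenForm, sumMap, oddForm, LinearMap.coe_mk, AddHom.coe_mk, _root_.smul_apply,
    QuadraticForm.dualProd_apply, QuadraticMap.prod_apply, QuadraticMap.sq_apply,
    LinearMap.comp_apply, LinearMap.add_apply, LinearMap.smul_apply, LinearEquiv.coe_coe,
    LinearEquiv.apply_symm_apply, LinearMap.fst_apply, LinearMap.snd_apply, smul_eq_mul]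
  linear_combination (-(x.2.2 ^ 2)) * Complex.I_sq

theorem exists_isometry (hE : Module.finrank ℂ E = 7) :
    Nonempty (form77.IsometryEquiv (evenForm E)) := by
  have : Module.Finite ℂ E := Module.finite_of_finrank_pos (by omega)
  let θ : E ≃ₗ[ℂ] ((Fin 3 → ℂ) × (Fin 3 → ℂ)) × ℂ :=
    LinearEquiv.ofFinrankEq _ _ (by rw [hE]; simp [Module.finrank_prod])
  have hpolar : ∀ x y, QuadraticMap.polar form77 x y =
      QuadraticMap.polar (evenForm E) (sumMap θ x) (sumMap θ y) := fun x y => by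
    simp only [QuadraticMap.polar, ← map_add, evenForm_sumMap]
  have hinj : Function.Injective (sumMap θ) := by
    rw [← LinearMap.ker_eq_bot, LinearMap.ker_eq_bot']
    intro x hx
    have h0 : ∀ y, QuadraticMap.polar form77 y x = 0 := fun y => by
      rw [hpolar, hx, QuadraticMap.polar_zero_right]
    refine Prod.ext (eq_zero_of_polar_oddForm fun w => ?_) (eq_zero_of_polar_oddForm fun w => ?_)
    · simpa using h0 (w, 0)
    · simpa using h0 (0, w)
  have hdim : Module.finrank ℂ (O7 × O7) = Module.finrank ℂ (Module.Dual ℂ E × E) := by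
    have h14 : Module.finrank ℂ (O7 × O7) = 14 := by
      rw [Module.finrank_prod (M := O7) (M' := O7), finrank_O7]
    rw [h14, Module.finrank_prod, Subspace.dual_finrank_eq, hE]
  exact ⟨⟨LinearEquiv.ofInjectiveOfFinrankEq (sumMap θ) hinj hdim, evenForm_sumMap θ⟩⟩

/-- The action of the orthogonal sum on the even part of the doubled tensor product. -/
def mixedAction (c : ℂ) : O7 × O7 →ₗ[ℂ] Module.End ℂ (D7 ⊗[ℂ] D7) :=
  LinearMap.rTensorHom D7 ∘ₗ cl ∘ₗ LinearMap.fst ℂ O7 O7 +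
    c • (LinearMap.lTensorHom D7 ∘ₗ cl ∘ₗ LinearMap.snd ℂ O7 O7)

/-- The product $(v\otimes1-c\,1\otimes v')(w\otimes1+c\,1\otimes w')$ has $-c^2=1$ as coefficient
of $1\otimes v'w'$, while the mixed terms acquire opposite signs. -/
theorem mixedAction_mixedAction {c : ℂ} (hc : c * c = -1) (v w : O7 × O7) (t : D7 ⊗[ℂ] D7) :
    mixedAction (-c) v (mixedAction c w t) = pairAction c v w t := by
  induction t using TensorProduct.induction_on with
  | zero => simp only [map_zero]
  | add x y hx hy => simp only [map_add, hx, hy]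
  | tmul x y =>
    have h : ∀ (c : ℂ) (v : O7 × O7) (x y : D7), mixedAction c v (x ⊗ₜ y) =
        cl v.1 x ⊗ₜ y + c • x ⊗ₜ cl v.2 y := fun c v x y => rfl
    rw [h, map_add, map_smul, h, h]
    simp only [pairAction, LinearMap.add_apply, LinearMap.smul_apply, LinearMap.sub_apply,
      LinearMap.rTensor_tmul, LinearMap.lTensor_tmul, TensorProduct.map_tmul, Module.End.mul_apply,
      smul_add, smul_smul, mul_neg, hc, neg_neg, one_smul]
    module

/-- The Clifford action of the orthogonal sum on the doubled tensor product. -/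
def doubleAction : O7 × O7 →ₗ[ℂ] Module.End ℂ ((D7 ⊗[ℂ] D7) × (D7 ⊗[ℂ] D7)) where
  toFun v := (mixedAction (-Complex.I) v ∘ₗ LinearMap.snd ℂ _ _).prod
    (mixedAction Complex.I v ∘ₗ LinearMap.fst ℂ _ _)
  map_add' v w := by
    refine LinearMap.ext fun x => ?_
    simp only [map_add]
    rfl
  map_smul' c v := by
    refine LinearMap.ext fun x => ?_
    simp only [map_smul]
    rfl

theorem doubleAction_apply (v : O7 × O7) (x : (D7 ⊗[ℂ] D7) × (D7 ⊗[ℂ] D7)) :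
    doubleAction v x = (mixedAction (-Complex.I) v x.2, mixedAction Complex.I v x.1) := rfl

theorem cl_sq (w : O7) : cl w * cl w = algebraMap ℂ _ (oddForm _ w) := wedgeContractParity_sq w

theorem pairAction_self (c : ℂ) (v : O7 × O7) (t : D7 ⊗[ℂ] D7) :
    pairAction c v v t = form77 v • t := by
  rw [pairAction, sub_self, smul_zero, add_zero, cl_sq, cl_sq, LinearMap.add_apply,
    QuadraticMap.prod_apply, add_smul]
  simp only [Algebra.algebraMap_eq_smul_one, LinearMap.rTensor_smul, LinearMap.lTensor_smul,
    LinearMap.smul_apply]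
  congr 2
  · exact LinearMap.congr_fun (LinearMap.rTensor_id D7 D7) t
  · exact LinearMap.congr_fun (LinearMap.lTensor_id D7 D7) t

/-- The operators $v\otimes1$ and $1\otimes v'$ commute, whereas orthogonal vectors must
anticommute. Doubling the space and using $\mp i$ in the two off-diagonal blocks makes the mixed
terms of a square cancel. -/
theorem doubleAction_sq (v : O7 × O7) :
    doubleAction v * doubleAction v = algebraMap ℂ _ (form77 v) := by
  refine LinearMap.ext fun x => ?_
  have hneg : ∀ t : D7 ⊗[ℂ] D7, -t = t → t = 0 := fun t ht => by
    rw [neg_eq_iff_add_eq_zero, ← two_smul ℂ t] at ht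
    exact (smul_eq_zero.1 ht).resolve_left two_ne_zero
  have h1 : Complex.I * Complex.I = -1 := Complex.I_mul_I
  have h2 : -Complex.I * -Complex.I = -1 := by rw [neg_mul_neg, h1]
  have h3 := fun t => mixedAction_mixedAction h1 v v t
  have h4 := fun t => mixedAction_mixedAction h2 v v t
  rw [neg_neg] at h4
  rw [Module.End.mul_apply, doubleAction_apply, doubleAction_apply, h3, h4, pairAction_self,
    pairAction_self, Module.algebraMap_end_apply]
  rfl

/-- The parity of the doubled tensor product. -/
def doubleParity : Module.End ℂ ((D7 ⊗[ℂ] D7) × (D7 ⊗[ℂ] D7)) :=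
  (LinearMap.fst ℂ _ _).prod (-LinearMap.snd ℂ _ _)

theorem doubleParity_apply (x : (D7 ⊗[ℂ] D7) × (D7 ⊗[ℂ] D7)) : doubleParity x = (x.1, -x.2) := rfl

/-- Even forms correspond to the first or the second copy of $\Delta_7\otimes\Delta_7$ according to
$\varepsilon$; $j$ and $\pi$ are the inclusion and projection of that copy, so that both cases share
one argument. -/
theorem exists_model_of_fock {σ : form77.IsometryEquiv (evenForm E)}
    {J : ExteriorAlgebra ℂ E ≃ₗ[ℂ] (D7 ⊗[ℂ] D7) × (D7 ⊗[ℂ] D7)} {ε c : ℂ} (hc : c ≠ 0)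
    (hJ : ∀ v x, J (wedgeContract v x) = doubleAction (σ.symm v) (J x))
    (hJp : ∀ x, J (parity x) = ε • doubleParity (J x))
    (π : (D7 ⊗[ℂ] D7) × (D7 ⊗[ℂ] D7) →ₗ[ℂ] D7 ⊗[ℂ] D7)
    (j : D7 ⊗[ℂ] D7 → (D7 ⊗[ℂ] D7) × (D7 ⊗[ℂ] D7)) (hπj : ∀ t, π (j t) = t)
    (hj0 : j 0 = 0)
    (hj : ∀ t, ε • doubleParity (j t) = j t) (hjπ : ∀ s, ε • doubleParity s = s → s = j (π s))
    (hact : ∀ v w t, π (doubleAction v (doubleAction w (j t))) = pairAction c v w t) :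
    Nonempty (Model E) := by
  have heven : ∀ x : evenExterior E, J x = j (π (J x)) := fun x => by
    refine hjπ _ ?_
    rw [← hJp]
    congr 1
    exact (mem_evenExterior_iff _).1 x.2
  refine ⟨⟨σ, c, hc, LinearEquiv.ofBijective (π ∘ₗ J.toLinearMap ∘ₗ (evenExterior E).subtype)
    ⟨?_, ?_⟩, ?_⟩⟩
  · rw [← LinearMap.ker_eq_bot, LinearMap.ker_eq_bot']
    intro x hx
    have h1 := heven x
    have h2 : π (J x) = 0 := hx
    rw [h2, hj0] at h1
    exact Subtype.ext (J.map_eq_zero_iff.1 h1)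
  · intro t
    refine ⟨⟨J.symm (j t), (mem_evenExterior_iff _).2 (J.injective ?_)⟩, ?_⟩
    · refine (hJp _).trans ?_
      rw [J.apply_symm_apply, hj]
    · change π (J (J.symm (j t))) = t
      rw [J.apply_symm_apply, hπj]
  · intro v w x
    change π (J (evenCliffordAction E (ι _ (σ v) * ι _ (σ w)) x)) = pairAction c v w (π (J x))
    rw [map_mul, Module.End.mul_apply, evenCliffordAction, lift_ι_apply, lift_ι_apply, hJ, hJ,
      σ.symm_apply_apply, σ.symm_apply_apply, ← hact, ← heven]

theorem exists_model (hE : Module.finrank ℂ E = 7) : Nonempty (Model E) := by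
  have : Module.Finite ℂ E := Module.finite_of_finrank_pos (by omega)
  obtain ⟨σ⟩ := exists_isometry hE
  have : Nontrivial D7 := ⟨⟨chi, 0, chi_ne_zero⟩⟩
  have hT : Module.finrank ℂ (D7 ⊗[ℂ] D7) = 64 := by
    rw [Module.finrank_tensorProduct, finrank_D7]
  have : Nontrivial (D7 ⊗[ℂ] D7) := Module.nontrivial_of_finrank_pos (R := ℂ) (by omega)
  let γ := doubleAction ∘ₗ σ.symm.toLinearEquiv.toLinearMap
  obtain ⟨J, ε, hε, hJ, hJp⟩ := exists_fock_equiv (E := E) (γ := γ) (σ := doubleParity)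
    (fun v => by
      refine (doubleAction_sq _).trans ?_
      congr 1
      exact σ.symm.map_app v)
    (fun x => by rw [doubleParity_apply, doubleParity_apply, neg_neg])
    (fun v x => by
      change doubleParity (doubleAction (σ.symm v) x) = -doubleAction (σ.symm v) (doubleParity x)
      simp only [doubleParity_apply, doubleAction_apply, map_neg, Prod.neg_mk, neg_neg])
    (by rw [Module.finrank_prod, hT, hE]; norm_num)
  have hneg : ∀ t : D7 ⊗[ℂ] D7, -t = t → t = 0 := fun t ht => by
    rw [neg_eq_iff_add_eq_zero, ← two_smul ℂ t] at ht
    exact (smul_eq_zero.1 ht).resolve_left two_ne_zero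
  have h1 : Complex.I * Complex.I = -1 := Complex.I_mul_I
  have h2 : -Complex.I * -Complex.I = -1 := by rw [neg_mul_neg, h1]
  rcases hε with rfl | rfl
  · refine exists_model_of_fock Complex.I_ne_zero hJ hJp (LinearMap.fst ℂ _ _) (fun t => (t, 0))
      (fun t => rfl) rfl (fun t => ?_) (fun s hs => ?_) (fun v w t => ?_)
    · rw [doubleParity_apply, one_smul, neg_zero]
    · rw [doubleParity_apply, one_smul] at hs
      exact Prod.ext rfl (hneg _ (congrArg Prod.snd hs))
    · exact mixedAction_mixedAction h1 v w t
  · refine exists_model_of_fock (neg_ne_zero.2 Complex.I_ne_zero) hJ hJp (LinearMap.snd ℂ _ _)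
      (fun t => (0, t)) (fun t => rfl) rfl (fun t => ?_) (fun s hs => ?_) (fun v w t => ?_)
    · rw [doubleParity_apply, neg_smul, one_smul, Prod.neg_mk, neg_neg, neg_zero]
    · rw [doubleParity_apply, neg_smul, one_smul] at hs
      exact Prod.ext (hneg _ (congrArg Prod.fst hs)) rfl
    · have := mixedAction_mixedAction h2 v w t
      rw [neg_neg] at this
      exact this

end Existence

/-! ### Equivariance under the spin groups and under products of two vectors -/

section Equivariance

open CliffordAlgebra

variable {E : Type*} [AddCommGroup E] [Module ℂ E]
  {W W' : Submodule ℂ (Module.Dual ℂ E × E)}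

theorem ne_zero_of_isometryEquiv {V V' : Type*} [AddCommGroup V] [Module ℂ V] [AddCommGroup V']
    [Module ℂ V'] {Q : QuadraticForm ℂ V} {Q' : QuadraticForm ℂ V'} (e : Q.IsometryEquiv Q')
    {v : V'} (hv : Q' v ≠ 0) : Q ≠ 0 := by
  rintro rfl
  exact hv ((e.symm.map_app v).symm)

theorem SevenSplitting.ne_zero {V : Type*} [AddCommGroup V] [Module ℂ V] {Q : QuadraticForm ℂ V}
    {W : Submodule ℂ V} (s : SevenSplitting Q W) : Q.restrict W ≠ 0 :=
  ne_zero_of_isometryEquiv s (v := vu) (by rw [oddForm_vu]; exact one_ne_zero)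

/-- Equivariance under products of two vectors of a subspace. -/
def IsPairEquivariant (s : SevenSplitting (evenForm E) W)
    (R : Module.End ℂ D7 →ₐ[ℂ] Module.End ℂ (D7 ⊗[ℂ] D7)) (Φ : evenExterior E ≃ₗ[ℂ] D7 ⊗[ℂ] D7) :
    Prop :=
  ∀ (v w : W) (x : evenExterior E), Φ (evenAction (pr v w) x) = R (cl (s v) * cl (s w)) (Φ x)

variable {s : SevenSplitting (evenForm E) W} {s' : SevenSplitting (evenForm E) W'}
  {R : Module.End ℂ D7 →ₐ[ℂ] Module.End ℂ (D7 ⊗[ℂ] D7)} {Φ : evenExterior E ≃ₗ[ℂ] D7 ⊗[ℂ] D7}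

theorem IsPairEquivariant.exists_even (h : IsPairEquivariant s R Φ)
    {a : CliffordAlgebra ((evenForm E).restrict W)} (ha : a ∈ evenOdd ((evenForm E).restrict W) 0) :
    ∃ b : even (evenForm E), (b : CliffordAlgebra (evenForm E)) = map (subspaceIsometry _ W) a ∧
      ∀ x, Φ (evenAction b x) = R (oddCliffordAction _ (map s.toIsometry a)) (Φ x) := by
  induction a, ha using even_induction with
  | algebraMap r =>
    refine ⟨algebraMap ℂ _ r, by simp, fun x => ?_⟩
    simp only [AlgHom.commutes, Module.algebraMap_end_apply, map_smul]
  | add a a' _ _ ha ha' =>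
    obtain ⟨b, hb, hbx⟩ := ha
    obtain ⟨b', hb', hbx'⟩ := ha'
    refine ⟨b + b', by simp [hb, hb'], fun x => ?_⟩
    simp only [map_add, LinearMap.add_apply, hbx, hbx']
  | ι_mul_ι_mul v w a _ ha =>
    obtain ⟨b, hb, hbx⟩ := ha
    refine ⟨pr v w * b, ?_, fun x => ?_⟩
    · rw [map_mul, map_mul, map_apply_ι, map_apply_ι, ← hb]
      rfl
    · rw [map_mul, Module.End.mul_apply, h, hbx, ← Module.End.mul_apply, ← map_mul]
      congr 2
      rw [map_mul, map_mul, map_mul, map_mul, map_apply_ι, map_apply_ι, oddCliffordAction,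
        lift_ι_apply, lift_ι_apply]
      rfl

/-- Spin elements are sums of even products of vectors. Conversely a product of two anisotropic
vectors is a multiple of a spin element, and anisotropic vectors span, so group equivariance becomes
a bilinear condition. -/
theorem isPairEquivariant_iff : IsPairEquivariant s R Φ ↔
    ∀ (g : spinGroup ((evenForm E).restrict W)) (x : evenExterior E),
      Φ (halfSpin E (spinMap (subspaceIsometry _ W) g) x) = R (sevenSpin _ s g) (Φ x) := by
  constructor
  · intro h g x
    obtain ⟨b, hb, hbx⟩ := h.exists_even (spinGroup.mem_even g.2)
    refine Eq.trans ?_ (hbx x)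
    rw [halfSpin_eq]
    congr 3
    exact Subtype.ext hb.symm
  · intro h
    have key : ∀ v w : W, (evenForm E).restrict W v ≠ 0 → (evenForm E).restrict W w ≠ 0 →
        ∀ x, Φ (evenAction (pr v w) x) = R (cl (s v) * cl (s w)) (Φ x) := by
      intro v w hv hw x
      obtain ⟨c, hc, g, hg⟩ := exists_spinGroup_eq_smul hv hw
      have h1 : spinToEven (spinMap (subspaceIsometry _ W) g) = c • pr v w := by
        apply Subtype.ext
        change map (subspaceIsometry _ W) (g : CliffordAlgebra ((evenForm E).restrict W)) =
          c • (ι _ (v : Module.Dual ℂ E × E) * ι _ (w : Module.Dual ℂ E × E))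
        rw [hg, map_smul, map_mul, map_apply_ι, map_apply_ι]
        rfl
      have h2 : sevenSpin _ s g = c • (cl (s v) * cl (s w)) := by
        change oddCliffordAction _ (map s.toIsometry
          (g : CliffordAlgebra ((evenForm E).restrict W))) = _
        rw [hg, map_smul, map_mul, map_apply_ι, map_apply_ι, map_smul, map_mul, oddCliffordAction,
          lift_ι_apply, lift_ι_apply]
        rfl
      have h3 := h g x
      rw [halfSpin_eq, h1, h2, map_smul, map_smul, LinearMap.smul_apply, LinearMap.smul_apply,
        map_smul] at h3
      exact smul_right_injective _ hc h3
    intro v w x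
    have hspan := span_anisotropic (SevenSplitting.ne_zero s)
    have hv : v ∈ Submodule.span ℂ {v : W | (evenForm E).restrict W v ≠ 0} := hspan ▸ trivial
    have hw : w ∈ Submodule.span ℂ {v : W | (evenForm E).restrict W v ≠ 0} := hspan ▸ trivial
    induction hv using Submodule.span_induction with
    | zero =>
      simp only [Submodule.coe_zero, map_zero, LinearMap.map_zero₂, LinearMap.zero_apply, zero_mul]
    | add v v' _ _ hv hv' =>
      simp only [Submodule.coe_add, LinearMap.map_add₂, map_add, LinearMap.add_apply, add_mul, hv,
        hv']
    | smul c v _ hv =>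
      simp only [Submodule.coe_smul, LinearMap.map_smul₂, map_smul, LinearMap.smul_apply,
        smul_mul_assoc, hv]
    | mem v hv =>
      induction hw using Submodule.span_induction with
      | zero => simp
      | add w w' _ _ hw hw' =>
        simp only [Submodule.coe_add, map_add, LinearMap.add_apply, mul_add, hw, hw']
      | smul c w _ hw =>
        simp only [Submodule.coe_smul, map_smul, LinearMap.smul_apply, mul_smul_comm, hw]
      | mem w hw => exact key v w hv hw x

theorem isSpinEquivariant_iff : IsSpinEquivariant s s' Φ ↔
    IsPairEquivariant s (Module.End.rTensorAlgHom ℂ D7 D7) Φ ∧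
      IsPairEquivariant s' (Module.End.lTensorAlgHom ℂ D7 D7) Φ := by
  rw [isPairEquivariant_iff, isPairEquivariant_iff]
  constructor
  · intro h
    constructor
    · intro g x
      have := h g 1 x
      rw [map_one, mul_one, map_one] at this
      exact this
    · intro g x
      have := h 1 g x
      rw [map_one, one_mul, map_one] at this
      exact this
  · rintro ⟨h, h'⟩ g g' x
    rw [map_mul, Module.End.mul_apply, h, h']
    change (sevenSpin _ s g).rTensor D7 ((sevenSpin _ s' g').lTensor D7 (Φ x)) = _
    rw [← LinearMap.comp_apply, LinearMap.rTensor_comp_lTensor]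

theorem IsPairEquivariant.apply (h : IsPairEquivariant s R Φ) (v w : O7) (t : D7 ⊗[ℂ] D7) :
    R (cl v * cl w) t = Φ (evenAction (pr (s.symm v) (s.symm w)) (Φ.symm t)) := by
  rw [h, s.apply_symm_apply, s.apply_symm_apply, Φ.apply_symm_apply]

/-- An equivariant isomorphism is unique up to a scalar. -/
theorem IsSpinEquivariant.exists_eq_smul {Φ' : evenExterior E ≃ₗ[ℂ] D7 ⊗[ℂ] D7}
    (h : IsSpinEquivariant s s' Φ) (h' : IsSpinEquivariant s s' Φ') :
    ∃ c : ℂ, ∀ x, Φ' x = c • Φ x := by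
  obtain ⟨hl, hr⟩ := isSpinEquivariant_iff.1 h
  obtain ⟨hl', hr'⟩ := isSpinEquivariant_iff.1 h'
  obtain ⟨c, hc⟩ := exists_eq_smul_of_commute (M := Φ'.toLinearMap ∘ₗ Φ.symm.toLinearMap)
    (fun v w t => by
      have h1 := hl.apply v w t
      have h2 := hl' (s.symm v) (s.symm w) (Φ.symm t)
      rw [s.apply_symm_apply, s.apply_symm_apply] at h2
      refine Eq.trans ?_ h2
      refine (congrArg (Φ' ∘ Φ.symm) h1).trans (congrArg Φ' ?_)
      exact Φ.symm_apply_apply _)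
    (fun v w t => by
      have h1 := hr.apply v w t
      have h2 := hr' (s'.symm v) (s'.symm w) (Φ.symm t)
      rw [s'.apply_symm_apply, s'.apply_symm_apply] at h2
      refine Eq.trans ?_ h2
      refine (congrArg (Φ' ∘ Φ.symm) h1).trans (congrArg Φ' ?_)
      exact Φ.symm_apply_apply _)
  refine ⟨c, fun x => ?_⟩
  rw [← hc]
  change _ = Φ' (Φ.symm (Φ x))
  rw [Φ.symm_apply_apply]

end Equivariance

/-! ### Generic points of the seven-dimensional spin representation -/

section Generic

open CliffordAlgebra

variable {V : Type*} [AddCommGroup V] [Module ℂ V] {Q : QuadraticForm ℂ V} {W : Submodule ℂ V}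

/-- The even Clifford algebra of a seven-dimensional subspace acts on its spin representation. -/
def sevenAction (s : SevenSplitting Q W) : even (Q.restrict W) →ₐ[ℂ] Module.End ℂ D7 :=
  ((oddCliffordAction (Fin 3 → ℂ)).comp (map s.toIsometry)).comp (even (Q.restrict W)).val

theorem sevenAction_ι (s : SevenSplitting Q W) (v w : W) :
    sevenAction s ((even.ι (Q.restrict W)).bilin v w) = cl (s v) * cl (s w) := by
  change oddCliffordAction _ (map s.toIsometry (ι _ v * ι _ w)) = _
  rw [map_mul, map_apply_ι, map_apply_ι, map_mul, oddCliffordAction, lift_ι_apply, lift_ι_apply]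
  rfl

/-- The spanning condition is regularity for the even Clifford algebra of $W$, and the orbit of a
regular point is the regular locus. -/
theorem isGenericPoint_sevenSpin (s : SevenSplitting Q W) {x : D7} (hx : x ≠ 0)
    (h : Submodule.span ℂ (Set.range fun p : O7 × O7 => cl p.1 (cl p.2 x)) = ⊤) :
    IsGenericPoint (sevenSpin Q s) x := by
  have hreg : IsRegular (sevenAction s) x := by
    refine eq_top_iff.2 (h.ge.trans (Submodule.span_mono ?_))
    rintro _ ⟨⟨v, w⟩, rfl⟩
    refine ⟨(s.symm v, s.symm w), ?_⟩
    simp only [sevenAction_ι, s.apply_symm_apply]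
    rfl
  refine ⟨hx, ?_⟩
  rw [hreg.projOrbit_eq (ρ := sevenSpin Q s) (SevenSplitting.ne_zero s) fun g => rfl]
  exact isZariskiOpen_regularLocus

theorem span_intertwiner {A : D7 ≃ₗ[ℂ] D7} {ε : ℂ}
    {τ : (oddForm (Fin 3 → ℂ)).IsometryEquiv (oddForm (Fin 3 → ℂ))}
    (hA : ∀ w x, A (cl w x) = ε • cl (τ w) (A x)) :
    Submodule.span ℂ (Set.range fun p : O7 × O7 => cl p.1 (cl p.2 (A chi))) = ⊤ := by
  have h := congrArg (Submodule.map A.toLinearMap) span_cl_cl_chi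
  rw [Submodule.map_span, Submodule.map_top, LinearEquiv.range] at h
  refine eq_top_iff.2 (h.ge.trans (Submodule.span_le.2 ?_))
  rintro _ ⟨_, ⟨⟨v, w⟩, rfl⟩, rfl⟩
  have : A (cl v (cl w chi)) = (ε * ε) • cl (τ v) (cl (τ w) (A chi)) := by
    rw [hA, hA, map_smul, smul_smul]
  refine (congrArg (· ∈ _) this).mpr (Submodule.smul_mem _ _ (Submodule.subset_span ?_))
  exact ⟨(τ v, τ w), rfl⟩

end Generic

/-! ### The decomposition attached to an adapted model -/

section Decomposition

variable {E : Type*} [AddCommGroup E] [Module ℂ E]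

/-- An intertwiner is only defined with a sign $\varepsilon$, but it enters twice in a product of
two vectors and $\varepsilon^2=1$. -/
theorem rTensor_intertwiner {A A' : D7 ≃ₗ[ℂ] D7} {ε : ℂ} (hε : ε = 1 ∨ ε = -1)
    {τ : (oddForm (Fin 3 → ℂ)).IsometryEquiv (oddForm (Fin 3 → ℂ))}
    (hA : ∀ w x, A (cl w x) = ε • cl (τ w) (A x)) (v w : O7) (t : D7 ⊗[ℂ] D7) :
    TensorProduct.congr A A' ((cl v * cl w).rTensor D7 t) =
      (cl (τ v) * cl (τ w)).rTensor D7 (TensorProduct.congr A A' t) := by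
  have h2 : ε * ε = 1 := by rcases hε with rfl | rfl <;> norm_num
  induction t using TensorProduct.induction_on with
  | zero => simp only [map_zero]
  | add x y hx hy => simp only [map_add, hx, hy]
  | tmul x y =>
    rw [LinearMap.rTensor_tmul, TensorProduct.congr_tmul, TensorProduct.congr_tmul,
      LinearMap.rTensor_tmul, Module.End.mul_apply, Module.End.mul_apply, hA, hA, map_smul,
      smul_smul, h2, one_smul]

theorem lTensor_intertwiner {A A' : D7 ≃ₗ[ℂ] D7} {ε : ℂ} (hε : ε = 1 ∨ ε = -1)
    {τ : (oddForm (Fin 3 → ℂ)).IsometryEquiv (oddForm (Fin 3 → ℂ))}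
    (hA : ∀ w x, A' (cl w x) = ε • cl (τ w) (A' x)) (v w : O7) (t : D7 ⊗[ℂ] D7) :
    TensorProduct.congr A A' ((cl v * cl w).lTensor D7 t) =
      (cl (τ v) * cl (τ w)).lTensor D7 (TensorProduct.congr A A' t) := by
  have h2 : ε * ε = 1 := by rcases hε with rfl | rfl <;> norm_num
  induction t using TensorProduct.induction_on with
  | zero => simp only [map_zero]
  | add x y hx hy => simp only [map_add, hx, hy]
  | tmul x y =>
    rw [LinearMap.lTensor_tmul, TensorProduct.congr_tmul, TensorProduct.congr_tmul,
      LinearMap.lTensor_tmul, Module.End.mul_apply, Module.End.mul_apply, hA, hA, map_smul,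
      smul_smul, h2, one_smul]

/-- A given splitting differs from that of the model by an isometry of the standard space. The
corresponding intertwiners correct $\Phi$ factor by factor, and carry $\chi$ to a spinor that is
again regular. -/
theorem Model.exists_equivariant (m : Model E) (s : SevenSplitting (evenForm E) m.left)
    (s' : SevenSplitting (evenForm E) m.swap.left) :
    ∃ A A' : D7 ≃ₗ[ℂ] D7, IsSpinEquivariant s s' (m.Φ.trans (TensorProduct.congr A A')) ∧
      IsGenericPoint (sevenSpin _ s) (A chi) ∧ IsGenericPoint (sevenSpin _ s') (A' chi) := by
  obtain ⟨A, ε, hε, hA⟩ := exists_intertwiner (m.leftIsometry.symm.trans s)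
  obtain ⟨A', ε', hε', hA'⟩ := exists_intertwiner (m.swap.leftIsometry.symm.trans s')
  refine ⟨A, A', isSpinEquivariant_iff.2 ⟨fun v w x => ?_, fun v w x => ?_⟩,
    isGenericPoint_sevenSpin s (fun h => chi_ne_zero (A.map_eq_zero_iff.1 h))
      (span_intertwiner hA),
    isGenericPoint_sevenSpin s' (fun h => chi_ne_zero (A'.map_eq_zero_iff.1 h))
      (span_intertwiner hA')⟩
  · have h1 := m.evenAction_left (m.leftIsometry v) (m.leftIsometry w) x
    rw [m.σ_leftIsometry, m.σ_leftIsometry] at h1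
    refine (congrArg (TensorProduct.congr A A') h1).trans ((rTensor_intertwiner hε hA _ _ _).trans ?_)
    change (cl (s (m.leftIsometry.symm (m.leftIsometry v))) *
      cl (s (m.leftIsometry.symm (m.leftIsometry w)))).rTensor D7 _ = _
    rw [QuadraticMap.IsometryEquiv.symm_apply_apply, QuadraticMap.IsometryEquiv.symm_apply_apply]
    rfl
  · have h1 := m.evenAction_right (m.swap.leftIsometry v) (m.swap.leftIsometry w) x
    have h2 : ∀ v : m.swap.left, m.σ (0, m.swap.leftIsometry v) = v := m.swap.σ_leftIsometry
    rw [h2, h2] at h1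
    refine (congrArg (TensorProduct.congr A A') h1).trans
      ((lTensor_intertwiner hε' hA' _ _ _).trans ?_)
    change (cl (s' (m.swap.leftIsometry.symm (m.swap.leftIsometry v))) *
      cl (s' (m.swap.leftIsometry.symm (m.swap.leftIsometry w)))).lTensor D7 _ = _
    rw [QuadraticMap.IsometryEquiv.symm_apply_apply, QuadraticMap.IsometryEquiv.symm_apply_apply]
    rfl

theorem evenForm_ne_zero (m : Model E) : evenForm E ≠ 0 :=
  ne_zero_of_isometryEquiv m.σ.symm (v := (vu, 0)) (by simp [oddForm_vu])

end Decomposition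

end SpinFourteen

end

/-! ### The main theorem -/

open SpinFourteen in
theorem mainTheorem3 {E : Type*} [AddCommGroup E] [Module ℂ E]
    (hE : Module.finrank ℂ E = 7) :
    ∃ U : Set (ℙ ℂ (evenExterior E)), IsZariskiOpen U ∧ U.Nonempty ∧
      ∀ (ψ : evenExterior E) (hψ : ψ ≠ 0), Projectivization.mk ℂ ψ hψ ∈ U →
        projOrbit (halfSpin E) ψ = U ∧
        ∃ W W' : Submodule ℂ (Module.Dual ℂ E × E),
          (IsOrthogonalDecomposition (evenForm E) W W' ∧ StabilizerPreserves ψ W W') ∧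
          (∀ X X' : Submodule ℂ (Module.Dual ℂ E × E),
            IsOrthogonalDecomposition (evenForm E) X X' → StabilizerPreserves ψ X X' →
              (X = W ∧ X' = W') ∨ (X = W' ∧ X' = W)) ∧
          Nonempty (SevenSplitting (evenForm E) W) ∧
          Nonempty (SevenSplitting (evenForm E) W') ∧
          ∀ (s : SevenSplitting (evenForm E) W) (s' : SevenSplitting (evenForm E) W'),
            ∃ Φ : evenExterior E ≃ₗ[ℂ]
                ExteriorAlgebra ℂ (Fin 3 → ℂ) ⊗[ℂ] ExteriorAlgebra ℂ (Fin 3 → ℂ),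
              IsSpinEquivariant s s' Φ ∧
              (∀ Φ', IsSpinEquivariant s s' Φ' → ∃ c : ℂ, ∀ x, Φ' x = c • Φ x) ∧
              ∃ χ χ' : ExteriorAlgebra ℂ (Fin 3 → ℂ),
                IsGenericPoint (sevenSpin _ s) χ ∧ IsGenericPoint (sevenSpin _ s') χ' ∧
                Φ ψ = χ ⊗ₜ[ℂ] χ' := by
  have : Module.Finite ℂ E := Module.finite_of_finrank_pos (by omega)
  obtain ⟨m₀⟩ := exists_model hE
  have : Nontrivial (evenExterior E) := by
    have : Nontrivial D7 := ⟨⟨chi, 0, chi_ne_zero⟩⟩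
    have : Nontrivial (D7 ⊗[ℂ] D7) := Module.nontrivial_of_finrank_pos (R := ℂ)
      (by rw [Module.finrank_tensorProduct, finrank_D7]; norm_num)
    exact m₀.Φ.toEquiv.nontrivial
  -- One model gives one regular spinor, the preimage of $\chi\otimes\chi$. All others lie in its
  -- orbit, so the model can be transported to them.
  have h₀ : m₀.IsAdapted (m₀.Φ.symm (chi ⊗ₜ chi)) := m₀.Φ.apply_symm_apply _
  refine ⟨regularLocus evenAction, isZariskiOpen_regularLocus,
    ⟨_, (mk_mem_regularLocus h₀.isRegular.ne_zero).2 h₀.isRegular⟩, fun ψ hψ hU => ?_⟩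
  rw [mk_mem_regularLocus] at hU
  have hQ := evenForm_ne_zero m₀
  obtain ⟨m, hm⟩ := exists_isAdapted_of_sameOrbit h₀
    (h₀.isRegular.sameOrbit (ρ := halfSpin E) hQ halfSpin_eq hU)
  refine ⟨hU.projOrbit_eq (ρ := halfSpin E) hQ halfSpin_eq, m.left, m.swap.left,
    ⟨m.isOrthogonalDecomposition, hm.stabilizerPreserves⟩, fun X X' hX h => hm.unique hX h,
    ⟨m.leftIsometry⟩, ⟨m.swap.leftIsometry⟩, fun s s' => ?_⟩
  obtain ⟨A, A', hΦ, hA, hA'⟩ := m.exists_equivariant s s'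
  refine ⟨_, hΦ, fun Φ' hΦ' => hΦ.exists_eq_smul hΦ', A chi, A' chi, hA, hA', ?_⟩
  change TensorProduct.congr A A' (m.Φ ψ) = _
  rw [hm, TensorProduct.congr_tmul]
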